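/- **Proposition 5.1 (multi-dimensional local limit theorem).** *Setting.* Let $(X,\mathcal A,\mu)$ be a $\sigma$-finite measure space and $f:X\to X$ a conservative, ergodic, measure preserving transformation. Let $d\ge 2$. Assume the following. (A1) *Dynamical separation.* $X=Y\cup A_1\cup\dots\cup A_d$ with disjoint measurable sets, $\mu(Y)=1$, $\mu(A_1)=\dots=\mu(A_d)=\infty$, and $f^{-1}(A_j)\subset A_j\cup Y$ for every $j$. Put $\varphi(x)=\min\{k\ge1: f^k(x)\in Y\}$ (finite a.e.), $S_A(n)=\sum_{k=1}^n 1_A\circ f^k$, $F(x)=f^{\varphi(x)}(x)$ (the first return map on $Y$), $\varphi_k=\sum_{m=1}^k\varphi\circ F^{m-1}$, and $r_{j,n}=\mu(Y\cap\{S_{A_j}(\varphi)=n\})$ for $1\le j\le d$, $n\ge1$. (A2) *Regular variation.* $\alpha\in(0,1)$, $\beta_1,\dots,\beta_d\in(0,1)$ with $\sum_j\beta_j=1$, and $\ell:[0,\infty)\to(0,\infty)$ is measurable and slowly varying at $\infty$; for each $j$, as $n\to\infty$, $$\sum_{k\ge n} r_{j,k}\sim\beta_j n^{-\alpha}\ell(n),\qquad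 r_{j,n}=O(n^{-\alpha-1}\ell(n)).$$ Let $R$ be the transfer operator of $F$ on $L^1(Y)$ (complex-valued functions, measure $\mu|_Y$), that is, $\int_Y (Ru)v\,d\mu=\int_Y u\,(v\circ F)\,d\mu$ for $u\in L^1(Y)$, $v\in L^\infty(Y)$. Put $R_{0,0}u=R(1_{\{\varphi=1\}}u)$ and $R_{j,n}u=R(1_{\{S_{A_j}(\varphi)=n\}}u)$, and, for $z\in\mathbb C^d$ with $|z_j|\le1$ for all $j$, $R(z)=R_{0,0}+\sum_{j=1}^d\sum_{n\ge1}z_j^nR_{j,n}$. (A3) *Aperiodic renewal sequence.* $\mathcal B\subset L^\infty(Y)$ is a complex Banach space that contains the constant functions, with $\|u\|_{L^\infty(Y)}\le\|u\|_{\mathcal B}$, such that 1. $R_{0,0}$ and all $R_{j,n}$ restrict to bounded operators on $\mathcal B$, and there is $C>0$ with $\|R_{j,n}\|_{\mathscr L(\mathcal B)}\le C r_{j,n}$ for all $1\le j\le d$ and $n\ge1$; 2. the spectrum of $R\in\mathscr L(\mathcal B)$ consists of the isolated, (algebraically) simple eigenvalue $1$ and a compact subset of the open unit disc; 3. for each $z\in\mathbb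 C^d\setminus\{(1,\dots,1)\}$ with $|z_1|=\dots=|z_d|=1$, the spectral radius of $R(z)\in\mathscr L(\mathcal B)$ is strictly less than $1$. *Notation.* For $n_1,\dots,n_d,k\ge0$ and $u\in\mathcal B$ put $Pu=\int_Yu\,d\mu$ (a constant function) and $$T_{n_1,\dots,n_d}(k)u=R^k\bigl(1_{\bigcap_{j=1}^d\{S_{A_j}(\varphi_k)=n_j\}}u\bigr).$$ Put $b_n=\dfrac1{\Gamma(1-\alpha)\,\mu(Y\cap\{\varphi\ge n\})}$ and $a_k=\min\{n\ge1:b_n>k\}$. *Claim.* Under (A1), (A2) and (A3), $P$ and all $T_{n_1,\dots,n_d}(k)$ are bounded operators on $\mathcal B$. For each $j$, the one-sided $\alpha$-stable law with Laplace transform $t\mapsto\exp(-\beta_jt^\alpha)$, $t\ge0$, has a continuous probability density $\psi_j:[0,\infty)\to[0,\infty)$. Moreover, $$\sup_{n_1,\dots,n_d\in\mathbb Z_{\ge0}}\Bigl\|a_k^d\,T_{n_1,\dots,n_d}(k)-\Bigl(\prod_{j=1}^d\psi_j\Bigl(\frac{n_j}{a_k}\Bigr)\Bigr)P\Bigr\|_{\mathscr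 L(\mathcal B)}\longrightarrow0\qquad(k\to\infty).$$ -/

import Mathlib

open MeasureTheory Filter Topology Asymptotics
open scoped ENNReal NNReal

noncomputable section

namespace LocLim

/-! ### Return times and occupation times -/

section Dynamics

variable {X : Type*}

/-- The first return time `φ(x) = min {k ≥ 1 : f^k x ∈ Y}`. If the orbit never returns to `Y` the
value is `0`; for a conservative ergodic `f` and `μ Y > 0` this concerns only a null set. -/
def firstReturn (f : X → X) (Y : Set X) (x : X) : ℕ :=
  sInf {k : ℕ | 1 ≤ k ∧ f^[k] x ∈ Y}

open Classical in
/-- The occupation time `S_A(n)(x) = ∑_{k=1}^n 1_A (f^k x)`. -/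
def occupation (f : X → X) (A : Set X) (n : ℕ) (x : X) : ℕ :=
  ∑ k ∈ Finset.Icc 1 n, if f^[k] x ∈ A then 1 else 0

/-- The first return map `F(x) = f^{φ(x)}(x)`; it is considered on `Y`, which it maps to itself. -/
def returnMap (f : X → X) (Y : Set X) (x : X) : X :=
  f^[firstReturn f Y x] x

/-- The `k`-th return time `φ_k = ∑_{m=1}^k φ ∘ F^{m-1}`. -/
def returnTime (f : X → X) (Y : Set X) (k : ℕ) (x : X) : ℕ :=
  ∑ m ∈ Finset.range k, firstReturn f Y ((returnMap f Y)^[m] x)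

/-- The set `{S_A(φ) = n}`. -/
def excursionSet (f : X → X) (Y A : Set X) (n : ℕ) : Set X :=
  {x | occupation f A (firstReturn f Y x) x = n}

/-- `r_n = μ[Y ∩ {S_A(φ) = n}]`. -/
def excursionProb [MeasurableSpace X] (f : X → X) (μ : Measure X) (Y A : Set X) (n : ℕ) : ℝ :=
  μ.real (Y ∩ excursionSet f Y A n)

/-- `b_n = 1 / (Γ(1-α) μ[Y ∩ {φ ≥ n}])`. -/
def returnSeq [MeasurableSpace X] (f : X → X) (μ : Measure X) (Y : Set X) (α : ℝ) (n : ℕ) : ℝ :=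
  1 / (Real.Gamma (1 - α) * μ.real (Y ∩ {x | n ≤ firstReturn f Y x}))

/-- `a_k = min {n ≥ 1 : b_n > k}`. -/
def scaling [MeasurableSpace X] (f : X → X) (μ : Measure X) (Y : Set X) (α : ℝ) (k : ℕ) : ℕ :=
  sInf {n : ℕ | 1 ≤ n ∧ (k : ℝ) < returnSeq f μ Y α n}

lemma returnMap_mem (f : X → X) {Y : Set X} {x : X} (hx : x ∈ Y) : returnMap f Y x ∈ Y := by
  unfold returnMap
  by_cases h : {k : ℕ | 1 ≤ k ∧ f^[k] x ∈ Y}.Nonempty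
  · exact (Nat.sInf_mem h).2
  · rw [Set.not_nonempty_iff_eq_empty] at h
    simpa [firstReturn, h] using hx

end Dynamics

/-! ### Transfer operators -/

section Transfer

variable {X : Type*} [MeasurableSpace X]

/-- For real `g ∈ L¹(ν)`, the density with respect to `ν` of the image under `F` of the signed
measure `g dν`. -/
def transferReal (ν : Measure X) (F : X → X) (g : X → ℝ) : X → ℝ :=
  SignedMeasure.rnDeriv ((ν.withDensityᵥ g).map F) ν

/-- The transfer operator `R` of `F` with respect to `ν`, on complex-valued functions:
`R u` is the density with respect to `ν` of the image under `F` of the complex measure `u dν`.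
The function `R u` is determined up to `ν`-null sets by the class of `u` in `L¹(ν)`. -/
def transfer (ν : Measure X) (F : X → X) (u : X → ℂ) : X → ℂ := fun x =>
  (transferReal ν F (fun y => (u y).re) x : ℂ) +
    (transferReal ν F (fun y => (u y).im) x : ℂ) * Complex.I

lemma integrable_transferReal (ν : Measure X) (F : X → X) (g : X → ℝ) :
    Integrable (transferReal ν F g) ν :=
  SignedMeasure.integrable_rnDeriv _ _

lemma setIntegral_transferReal (ν : Measure X) [SigmaFinite ν] {F : X → X}
    (hF : Measure.QuasiMeasurePreserving F ν ν) {g : X → ℝ} (hg : Integrable g ν) {s : Set X}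
    (hs : MeasurableSet s) :
    ∫ x in s, transferReal ν F g x ∂ν = ∫ x in F ⁻¹' s, g x ∂ν := by
  have hac : ((ν.withDensityᵥ g).map F) ≪ᵥ ν.toENNRealVectorMeasure := by
    refine VectorMeasure.AbsolutelyContinuous.mk fun t ht h0 => ?_
    rw [Measure.toENNRealVectorMeasure_apply_measurable ht] at h0
    rw [VectorMeasure.map_apply _ hF.measurable ht,
      withDensityᵥ_apply hg (hF.measurable ht)]
    exact setIntegral_measure_zero _ (hF.preimage_null h0)
  have h := (SignedMeasure.absolutelyContinuous_iff_withDensityᵥ_rnDeriv_eq _ ν).1 hac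
  have h2 : (ν.withDensityᵥ (SignedMeasure.rnDeriv ((ν.withDensityᵥ g).map F) ν)) s =
      ((ν.withDensityᵥ g).map F) s := by rw [h]
  rw [withDensityᵥ_apply (SignedMeasure.integrable_rnDeriv _ _) hs,
    VectorMeasure.map_apply _ hF.measurable hs, withDensityᵥ_apply hg (hF.measurable hs)] at h2
  exact h2

/-- The characterizing property `∫_s R u dν = ∫ u · (1_s ∘ F) dν` of the transfer operator. -/
theorem setIntegral_transfer (ν : Measure X) [SigmaFinite ν] {F : X → X}
    (hF : Measure.QuasiMeasurePreserving F ν ν) {u : X → ℂ} (hu : Integrable u ν) {s : Set X}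
    (hs : MeasurableSet s) :
    ∫ x in s, transfer ν F u x ∂ν = ∫ x in F ⁻¹' s, u x ∂ν := by
  have h1 := setIntegral_transferReal ν hF hu.re hs
  have h2 := setIntegral_transferReal ν hF hu.im hs
  have i1 : Integrable (fun x => (transferReal ν F (fun y => (u y).re) x : ℂ)) (ν.restrict s) :=
    ((integrable_transferReal ν F _).ofReal (𝕜 := ℂ)).integrableOn
  have i2 : Integrable (fun x => (transferReal ν F (fun y => (u y).im) x : ℂ) * Complex.I)
      (ν.restrict s) :=
    (((integrable_transferReal ν F _).ofReal (𝕜 := ℂ)).mul_const _).integrableOn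
  have h3 := integral_re_add_im (𝕜 := ℂ) (hu.integrableOn (s := F ⁻¹' s))
  simp only [RCLike.re_eq_complex_re, RCLike.im_eq_complex_im, RCLike.I_to_complex,
    RCLike.ofReal_eq_complex_ofReal] at h1 h2 h3
  unfold transfer
  rw [integral_add i1 i2, integral_mul_const, integral_complex_ofReal, integral_complex_ofReal,
    h1, h2, h3]

end Transfer

/-! ### Operators on a Banach space of bounded functions -/

section Operators

variable {X : Type*} [MeasurableSpace X] {ν : Measure X}
variable {B : Type*} [NormedAddCommGroup B] [NormedSpace ℂ B]

/-- The bounded operator `S` on `B` (embedded in `L^∞(ν)` by `ι`) is the restriction to `B` of the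
operator `T` on functions. For injective `ι` there is at most one such `S`. -/
def Induces (ι : B →ₗ[ℂ] Lp ℂ ∞ ν) (T : (X → ℂ) → (X → ℂ)) (S : B →L[ℂ] B) : Prop :=
  ∀ u : B, (ι (S u) : X → ℂ) =ᵐ[ν] T (ι u : X → ℂ)

open Classical in
/-- The operator `T` regarded as an element of `𝓛(B)` (and `0` if this is not possible). -/
def inducedOp (ι : B →ₗ[ℂ] Lp ℂ ∞ ν) (T : (X → ℂ) → (X → ℂ)) : B →L[ℂ] B :=
  if h : ∃ S, Induces ι T S then h.choose else 0

lemma inducedOp_eq {ι : B →ₗ[ℂ] Lp ℂ ∞ ν} (hι : Function.Injective ι)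
    {T : (X → ℂ) → (X → ℂ)} {S : B →L[ℂ] B} (h : Induces ι T S) : inducedOp ι T = S := by
  have hex : ∃ S, Induces ι T S := ⟨S, h⟩
  rw [inducedOp, dif_pos hex]
  ext u
  exact hι (Lp.ext ((hex.choose_spec u).trans (h u).symm))

/-- `c` is an eigenvalue of `T` of algebraic multiplicity one: the kernel of `T - c` is
one-dimensional and complementary to the range of `T - c`. -/
def IsSimpleEigenvalue (T : B →L[ℂ] B) (c : ℂ) : Prop :=
  Module.finrank ℂ (LinearMap.ker (T - c • ContinuousLinearMap.id ℂ B : B →L[ℂ] B).toLinearMap) = 1 ∧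
  IsCompl (LinearMap.ker (T - c • ContinuousLinearMap.id ℂ B : B →L[ℂ] B).toLinearMap)
    (LinearMap.range (T - c • ContinuousLinearMap.id ℂ B : B →L[ℂ] B).toLinearMap)

end Operators

section Renewal

variable {X : Type*} [MeasurableSpace X]

/-- The transfer operator `R` of the first return map `F`, with respect to `μ|_Y`. -/
def returnTransfer (f : X → X) (μ : Measure X) (Y : Set X) (u : X → ℂ) : X → ℂ :=
  transfer (μ.restrict Y) (returnMap f Y) u

lemma measurable_firstReturn {f : X → X} (hf : Measurable f) {Y : Set X} (hY : MeasurableSet Y) :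
    Measurable (firstReturn f Y) := by
  have hm : ∀ k, MeasurableSet {x | 1 ≤ k ∧ f^[k] x ∈ Y} := fun k =>
    (MeasurableSet.const _).inter (hf.iterate k hY)
  have hle : ∀ n, MeasurableSet {x | 1 ≤ n ∧ firstReturn f Y x = n} := by
    intro n
    have : {x | 1 ≤ n ∧ firstReturn f Y x = n} =
        {x | 1 ≤ n ∧ f^[n] x ∈ Y} ∩ ⋂ k ∈ Finset.range n, {x | 1 ≤ k ∧ f^[k] x ∈ Y}ᶜ := by
      ext x
      simp only [Set.mem_ofPred_eq, Set.mem_inter_iff, Set.mem_iInter, Finset.mem_range,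
        Set.mem_compl_iff]
      constructor
      · rintro ⟨h1, h2⟩
        have hne : {k : ℕ | 1 ≤ k ∧ f^[k] x ∈ Y}.Nonempty :=
          Nat.nonempty_of_pos_sInf (by unfold firstReturn at h2; omega)
        refine ⟨?_, fun k hk => Nat.notMem_of_lt_sInf (s := {k : ℕ | 1 ≤ k ∧ f^[k] x ∈ Y})
          (by unfold firstReturn at h2; omega)⟩
        have := Nat.sInf_mem hne
        unfold firstReturn at h2
        rw [h2] at this
        exact this
      · rintro ⟨h1, h2⟩
        refine ⟨h1.1, le_antisymm (Nat.sInf_le h1) ?_⟩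
        by_contra hlt
        exact h2 _ (not_le.1 hlt) (Nat.sInf_mem (s := {k : ℕ | 1 ≤ k ∧ f^[k] x ∈ Y}) ⟨n, h1⟩)
    rw [this]
    exact (hm n).inter (Finset.measurableSet_biInter _ fun k _ => (hm k).compl)
  refine measurable_to_countable' fun n => ?_
  rcases Nat.eq_zero_or_pos n with rfl | hn
  · have : firstReturn f Y ⁻¹' {0} = (⋃ n, {x | 1 ≤ n ∧ firstReturn f Y x = n})ᶜ := by
      ext x
      simp only [Set.mem_preimage, Set.mem_singleton_iff, Set.mem_compl_iff, Set.mem_iUnion,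
        Set.mem_ofPred_eq]
      constructor
      · rintro h ⟨n, h1, h2⟩
        omega
      · intro h
        by_contra h0
        exact h ⟨_, Nat.one_le_iff_ne_zero.2 h0, rfl⟩
    rw [this]
    exact (MeasurableSet.iUnion hle).compl
  · have : firstReturn f Y ⁻¹' {n} = {x | 1 ≤ n ∧ firstReturn f Y x = n} := by
      ext x
      simp [Nat.one_le_iff_ne_zero, hn.ne']
    rw [this]
    exact hle n

/-- The first return map is nonsingular, so that its transfer operator is well defined. -/
lemma quasiMeasurePreserving_returnMap {f : X → X} {μ : Measure X} (hf : MeasurePreserving f μ μ)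
    {Y : Set X} (hY : MeasurableSet Y) :
    Measure.QuasiMeasurePreserving (returnMap f Y) (μ.restrict Y) (μ.restrict Y) := by
  have hpre : ∀ s, returnMap f Y ⁻¹' s = ⋃ n, {x | firstReturn f Y x = n} ∩ f^[n] ⁻¹' s := by
    intro s
    ext x
    simp [returnMap]
  have hmeas : Measurable (returnMap f Y) := by
    intro s hs
    rw [hpre]
    exact MeasurableSet.iUnion fun n =>
      (measurable_firstReturn hf.measurable hY (measurableSet_singleton n)).inter
        (hf.measurable.iterate n hs)
  refine ⟨hmeas, Measure.AbsolutelyContinuous.mk fun s hs h0 => ?_⟩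
  rw [Measure.restrict_apply hs] at h0
  rw [Measure.map_apply hmeas hs, Measure.restrict_apply (hmeas hs)]
  refine measure_mono_null (t := ⋃ n, f^[n] ⁻¹' (s ∩ Y)) ?_ (measure_iUnion_null fun n =>
    (hf.iterate n).quasiMeasurePreserving.preimage_null h0)
  rintro x ⟨hx, hxY⟩
  exact Set.mem_iUnion.2 ⟨firstReturn f Y x, hx, returnMap_mem f hxY⟩

/-- `R_{0,0} u = R (1_{φ = 1} u)`. -/
def renewalZero (f : X → X) (μ : Measure X) (Y : Set X) (u : X → ℂ) : X → ℂ :=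
  returnTransfer f μ Y ({x | firstReturn f Y x = 1}.indicator u)

/-- `R_{j,n} u = R (1_{S_A(φ) = n} u)`, where `A = A_j`. -/
def renewal (f : X → X) (μ : Measure X) (Y A : Set X) (n : ℕ) (u : X → ℂ) : X → ℂ :=
  returnTransfer f μ Y ((excursionSet f Y A n).indicator u)

/-- `T_{n_1,…,n_d}(k) u = R^k (1_{S_{A_j}(φ_k) = n_j for all j} u)`. -/
def occupationTransfer {d : ℕ} (f : X → X) (μ : Measure X) (Y : Set X) (A : Fin d → Set X)
    (n : Fin d → ℕ) (k : ℕ) (u : X → ℂ) : X → ℂ :=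
  (returnTransfer f μ Y)^[k]
    ({x | ∀ j, occupation f (A j) (returnTime f Y k x) x = n j}.indicator u)

/-- `P u = ∫_Y u dμ`, as a constant function. -/
def meanValue (μ : Measure X) (Y : Set X) (u : X → ℂ) : X → ℂ :=
  fun _ => ∫ y in Y, u y ∂μ

variable {B : Type*} [NormedAddCommGroup B] [NormedSpace ℂ B]

/-- `R(z) = R_{0,0} + ∑_{j, n ≥ 1} z_j^n R_{j,n}` in `𝓛(B)`. -/
def renewalSeries {d : ℕ} (f : X → X) (μ : Measure X) (Y : Set X) (A : Fin d → Set X)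
    (ι : B →ₗ[ℂ] Lp ℂ ∞ (μ.restrict Y)) (z : Fin d → ℂ) : B →L[ℂ] B :=
  inducedOp ι (renewalZero f μ Y) +
    ∑ j, ∑' n : ℕ, z j ^ (n + 1) • inducedOp ι (renewal f μ Y (A j) (n + 1))

/-! ### The standing assumptions -/

/-- Dynamical separation. -/
structure DynamicalSeparation {d : ℕ} (f : X → X) (μ : Measure X) (Y : Set X)
    (A : Fin d → Set X) : Prop where
  measurableSet_base : MeasurableSet Y
  measurableSet_ray : ∀ j, MeasurableSet (A j)
  cover : Y ∪ ⋃ j, A j = Set.univ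
  disjoint_base : ∀ j, Disjoint Y (A j)
  disjoint_ray : Pairwise fun i j => Disjoint (A i) (A j)
  measure_base : μ Y = 1
  measure_ray : ∀ j, μ (A j) = ∞
  preimage_subset : ∀ j, f ⁻¹' (A j) ⊆ A j ∪ Y

/-- A measurable function `ℓ : [0,∞) → (0,∞)` which is slowly varying at infinity. -/
structure IsSlowlyVarying (ℓ : ℝ≥0 → ℝ) : Prop where
  measurable : Measurable ℓ
  pos : ∀ t, 0 < ℓ t
  tendsto : ∀ c : ℝ≥0, 0 < c → Tendsto (fun t => ℓ (c * t) / ℓ t) atTop (𝓝 1)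

/-- Regular variation of the distributions of the excursion lengths. -/
structure RegularVariation {d : ℕ} (f : X → X) (μ : Measure X) (Y : Set X)
    (A : Fin d → Set X) (α : ℝ) (β : Fin d → ℝ) (ℓ : ℝ≥0 → ℝ) : Prop where
  index_mem : α ∈ Set.Ioo (0 : ℝ) 1
  weight_mem : ∀ j, β j ∈ Set.Ioo (0 : ℝ) 1
  sum_weight : ∑ j, β j = 1
  slowly : IsSlowlyVarying ℓ
  tail : ∀ j, (fun n : ℕ => ∑' k : ℕ, excursionProb f μ Y (A j) (n + k)) ~[atTop]
    fun n : ℕ => β j * (n : ℝ) ^ (-α) * ℓ n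
  bound : ∀ j, (fun n : ℕ => excursionProb f μ Y (A j) n) =O[atTop]
    fun n : ℕ => (n : ℝ) ^ (-α - 1) * ℓ n

/-- Aperiodic renewal sequence. The normed space `B` is embedded in `L^∞(Y)` by `ι`. -/
structure AperiodicRenewal {d : ℕ} (f : X → X) (μ : Measure X) (Y : Set X)
    (A : Fin d → Set X) (ι : B →ₗ[ℂ] Lp ℂ ∞ (μ.restrict Y)) : Prop where
  injective : Function.Injective ι
  norm_le : ∀ u, ‖ι u‖ ≤ ‖u‖
  const_mem : ∀ c : ℂ, ∃ u, (ι u : X → ℂ) =ᵐ[μ.restrict Y] fun _ => c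
  induces_zero : ∃ S, Induces ι (renewalZero f μ Y) S
  induces : ∀ j, ∀ n, 1 ≤ n → ∃ S, Induces ι (renewal f μ Y (A j) n) S
  norm_bound : ∃ C : ℝ, 0 < C ∧ ∀ j, ∀ n, 1 ≤ n →
    ‖inducedOp ι (renewal f μ Y (A j) n)‖ ≤ C * excursionProb f μ Y (A j) n
  simple : IsSimpleEigenvalue (inducedOp ι (returnTransfer f μ Y)) 1
  spectral_gap : ∃ K : Set ℂ, IsCompact K ∧ K ⊆ Metric.ball 0 1 ∧
    spectrum ℂ (inducedOp ι (returnTransfer f μ Y)) = {1} ∪ K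
  aperiodic : ∀ z : Fin d → ℂ, (∀ j, ‖z j‖ = 1) → z ≠ 1 →
    spectralRadius ℂ (renewalSeries f μ Y A ι z) < 1

end Renewal

/-! ### One-sided stable densities -/

/-- `ψ` (on `[0,∞)`) is the continuous probability density of a nonnegative random variable `ξ` with
Laplace transform `E[exp(-t ξ)] = exp(-t^α c)`, `t ≥ 0`. (The value at `t = 0` is the total mass.)
These properties determine `ψ` on `[0,∞)`. -/
structure IsStableDensity (α c : ℝ) (ψ : ℝ → ℝ) : Prop where
  continuousOn : ContinuousOn ψ (Set.Ici 0)
  nonneg : ∀ y, 0 ≤ y → 0 ≤ ψ y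
  integrableOn : IntegrableOn ψ (Set.Ici 0)
  laplace : ∀ t : ℝ, 0 ≤ t →
    ∫ y in Set.Ici (0 : ℝ), Real.exp (-t * y) * ψ y = Real.exp (-(t ^ α * c))

end LocLim

end

/-! The proof is Fourier inversion on the torus combined with perturbation theory for the operators
R(z).

By dynamical separation an excursion from Y visits at most one ray. Hence R splits into R_{0,0} and
the R_{j,n}, and T_n(k) is the coefficient of z^n in R(z)^k (`induces_occupationTransfer`). So
(2π)^d T_n(k) is the integral of e^{-i n·θ} R(e^{iθ})^k over the cube (`renewalCoeff_eq_integral`).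
Likewise (2π)^d ∏ ψ_j(n_j/a) is the integral of e^{-i n·t/a} times the product of the stable
characteristic functions exp(-β_j (-i t_j)^α). After the substitution θ = t/a_k the characters in
both integrals coincide and have modulus one, so the norm in the claim is bounded, for all n at
once, by an L¹ norm that does not involve n (`norm_smul_renewalCoeff_sub_le`). It remains to show
that this L¹ norm tends to zero.

Pointwise limit. Near θ = 0 the spectral gap gives R(e^{iθ})^k = λ^k Π + O(q^k), with Π → P and λ =
∫ R(e^{iθ})1 dμ + o(‖R(e^{iθ}) - R(1)‖) (`exists_dominant_eigenvalue`). With ν_j the law of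
S_{A_j}(φ), 1 - ∫ R(e^{iθ})1 dμ is the sum over j of ∫ (1 - e^{iθ_j s}) dν_j; each summand involves
a single coordinate, which is why the limit is a product. Regular variation yields its asymptotics
(`tendsto_integral_one_sub_exp_div`), and ‖R(e^{iθ}) - R(1)‖ is at most of the order of the tails at
1/|θ_j|. The choice of a_k then gives the limit of λ^k.

Domination. Near zero |λ| is at most exp(-c ∑ ν_j[1/|θ_j|, ∞)), and Potter's bounds turn λ^k at
t/a_k into a product of factors exp(-b_j |t_j|^{α/2}). Away from zero aperiodicity and compactness
give C q^k; the cube dilated by a_k has volume polynomial in k, so this part vanishes in the limit.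

The stable densities are defined by Fourier inversion. Their positivity, support and Laplace
transform come from approximating the stable law by explicit laws on lattices, tested against
exp(-s|x|). -/

noncomputable section

namespace LocLim

/-! ### The kernel `exp (-s |x|)` -/

lemma integrable_exp_neg_mul_abs {s : ℝ} (hs : 0 < s) :
    Integrable fun y : ℝ => Real.exp (-s * |y|) := by
  have h1 : IntegrableOn (fun y : ℝ => Real.exp (-s * |y|)) (Set.Ioi 0) :=
    (integrableOn_exp_mul_Ioi (neg_lt_zero.2 hs) 0).congr_fun
      (fun y hy => by simp only [abs_of_pos (Set.mem_Ioi.1 hy)]) measurableSet_Ioi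
  have h2 : IntegrableOn (fun y : ℝ => Real.exp (-s * |y|)) (Set.Iic 0) :=
    (integrableOn_exp_mul_Iic hs 0).congr_fun
      (fun y hy => by simp only [abs_of_nonpos (Set.mem_Iic.1 hy), neg_mul_neg]) measurableSet_Iic
  rw [← integrableOn_univ, ← Set.Iic_union_Ioi (a := (0 : ℝ))]
  exact h2.union h1

/-- This Fourier pair is the test kernel for stable laws: both members are explicit and positive,
and exp(-s|x - y|) factorises for y ≤ 0 ≤ x, which connects Fourier integrals with Laplace
transforms. -/
lemma integral_exp_neg_mul_abs_mul_exp {s : ℝ} (hs : 0 < s) (t : ℝ) :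
    ∫ y : ℝ, (Real.exp (-s * |y|) : ℂ) * Complex.exp (-(t * y : ℝ) * Complex.I) =
      ((2 * s / (s ^ 2 + t ^ 2) : ℝ) : ℂ) := by
  have hint : Integrable fun y : ℝ =>
      (Real.exp (-s * |y|) : ℂ) * Complex.exp (-(t * y : ℝ) * Complex.I) := by
    refine (integrable_exp_neg_mul_abs hs).mono' (by fun_prop) (Eventually.of_forall fun y => ?_)
    rw [norm_mul, Complex.norm_real, Real.norm_of_nonneg (Real.exp_pos _).le, Complex.norm_exp]
    simp
  have h1 : (↑s + ↑t * Complex.I : ℂ) ≠ 0 := fun h => hs.ne' (by simpa using congrArg Complex.re h)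
  have h2 : (↑s - ↑t * Complex.I : ℂ) ≠ 0 := fun h => hs.ne' (by simpa using congrArg Complex.re h)
  rw [← intervalIntegral.integral_Iic_add_Ioi hint.integrableOn hint.integrableOn (b := 0)]
  have e1 : ∫ y : ℝ in Set.Iic 0, (Real.exp (-s * |y|) : ℂ) *
      Complex.exp (-(t * y : ℝ) * Complex.I) = 1 / (↑s - ↑t * Complex.I) := by
    rw [setIntegral_congr_fun (g := fun y : ℝ => Complex.exp ((↑s - ↑t * Complex.I) * y))
      measurableSet_Iic]
    · rw [integral_exp_mul_complex_Iic (by simpa using hs)]; simp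
    · intro y hy
      simp only [abs_of_nonpos (Set.mem_Iic.1 hy)]
      push_cast
      rw [← Complex.exp_add]; ring_nf
  have e2 : ∫ y : ℝ in Set.Ioi 0, (Real.exp (-s * |y|) : ℂ) *
      Complex.exp (-(t * y : ℝ) * Complex.I) = 1 / (↑s + ↑t * Complex.I) := by
    rw [setIntegral_congr_fun (g := fun y : ℝ => Complex.exp (-(↑s + ↑t * Complex.I) * y))
      measurableSet_Ioi]
    · rw [integral_exp_mul_complex_Ioi (by simpa using hs)]
      simp only [Complex.ofReal_zero, mul_zero, Complex.exp_zero, neg_div_neg_eq]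
    · intro y hy
      simp only [abs_of_pos (Set.mem_Ioi.1 hy)]
      push_cast
      rw [← Complex.exp_add]; ring_nf
  rw [e1, e2]
  have h3 : ((s : ℂ) ^ 2 + t ^ 2) ≠ 0 := by
    have : (s ^ 2 + t ^ 2 : ℝ) ≠ 0 := by positivity
    exact_mod_cast this
  push_cast
  rw [div_add_div _ _ h2 h1, div_eq_div_iff (mul_ne_zero h2 h1) h3]
  ring_nf
  simp only [Complex.I_sq]
  ring

lemma integrable_cauchyKernel {s : ℝ} (hs : 0 < s) :
    Integrable fun t : ℝ => 2 * s / (s ^ 2 + t ^ 2) := by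
  have := (integrable_inv_one_add_sq.comp_mul_left' (inv_ne_zero hs.ne')).const_mul (2 / s)
  refine this.congr (Eventually.of_forall fun t => ?_)
  have : s ^ 2 + t ^ 2 ≠ 0 := by positivity
  have : 1 + (s⁻¹ * t) ^ 2 ≠ 0 := by positivity
  simp only
  field_simp

lemma integral_cauchyKernel_mul_exp {s : ℝ} (hs : 0 < s) (x : ℝ) :
    ∫ t : ℝ, ((2 * s / (s ^ 2 + t ^ 2) : ℝ) : ℂ) * Complex.exp ((t * x : ℝ) * Complex.I) =
      2 * Real.pi * (Real.exp (-s * |x|) : ℂ) := by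
  set f : ℝ → ℂ := fun y => (Real.exp (-s * |y|) : ℂ) with hf
  have hF : ∀ w, FourierTransform.fourier f w =
      ((2 * s / (s ^ 2 + (2 * Real.pi * w) ^ 2) : ℝ) : ℂ) := by
    intro w
    rw [Real.fourier_eq', ← integral_exp_neg_mul_abs_mul_exp hs]
    refine integral_congr_ae (Eventually.of_forall fun y => ?_)
    simp only [hf, smul_eq_mul, RCLike.inner_apply, conj_trivial]
    rw [mul_comm]
    congr 3
    push_cast
    ring
  have hpi : (2 * Real.pi) ≠ 0 := by positivity
  have hinv := Continuous.fourierInv_fourier_eq (f := f) (by fun_prop)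
    (integrable_exp_neg_mul_abs hs).ofReal (by
      refine (((integrable_cauchyKernel hs).comp_mul_left' hpi).ofReal (𝕜 := ℂ)).congr
        (Eventually.of_forall fun w => ?_)
      simp only [hF]; rfl)
  have h := congrFun hinv x
  rw [Real.fourierInv_eq'] at h
  -- The substitution by 2π passes from characters exp(2πi v x) to exp(i t x).
  have h2 := Measure.integral_comp_mul_left (fun t : ℝ => ((2 * s / (s ^ 2 + t ^ 2) : ℝ) : ℂ) *
    Complex.exp ((t * x : ℝ) * Complex.I)) (2 * Real.pi)
  have h3 : (∫ v : ℝ, Complex.exp ((2 * Real.pi * inner ℝ v x : ℝ) * Complex.I) •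
      FourierTransform.fourier f v) = ∫ v : ℝ,
      ((2 * s / (s ^ 2 + (2 * Real.pi * v) ^ 2) : ℝ) : ℂ) *
        Complex.exp ((2 * Real.pi * v * x : ℝ) * Complex.I) := by
    refine integral_congr_ae (Eventually.of_forall fun v => ?_)
    simp only [hF, smul_eq_mul, RCLike.inner_apply, conj_trivial]
    rw [mul_comm]
    congr 3
    push_cast
    ring
  rw [h3, h2, abs_of_pos (by positivity)] at h
  rw [hf] at h
  simp only at h
  rw [← h, Complex.real_smul]
  push_cast
  rw [mul_inv_cancel_left₀ (by exact_mod_cast hpi)]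

/-! ### Power series with nonnegative coefficients -/

/-- `f` is given on the closed unit disc by an absolutely convergent power series with the
nonnegative coefficients `c`. -/
structure HasNonnegSeries (f : ℂ → ℂ) (c : ℕ → ℝ) : Prop where
  nonneg : ∀ n, 0 ≤ c n
  summable : Summable c
  hasSum : ∀ w : ℂ, ‖w‖ ≤ 1 → HasSum (fun n => (c n : ℂ) * w ^ n) (f w)

namespace HasNonnegSeries

variable {f g : ℂ → ℂ} {c e : ℕ → ℝ}

lemma norm_term_le (hf : HasNonnegSeries f c) {w : ℂ} (hw : ‖w‖ ≤ 1) (n : ℕ) :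
    ‖(c n : ℂ) * w ^ n‖ ≤ c n := by
  rw [norm_mul, norm_pow, Complex.norm_real, Real.norm_of_nonneg (hf.nonneg n)]
  exact mul_le_of_le_one_right (hf.nonneg n) (pow_le_one₀ (norm_nonneg _) hw)

lemma summable_norm (hf : HasNonnegSeries f c) {w : ℂ} (hw : ‖w‖ ≤ 1) :
    Summable fun n => ‖(c n : ℂ) * w ^ n‖ :=
  hf.summable.of_nonneg_of_le (fun _ => norm_nonneg _) (hf.norm_term_le hw)

lemma apply_one (hf : HasNonnegSeries f c) : f 1 = ((∑' n, c n : ℝ) : ℂ) := by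
  rw [← (hf.hasSum 1 (by simp)).tsum_eq, Complex.ofReal_tsum]
  simp

lemma norm_le (hf : HasNonnegSeries f c) {w : ℂ} (hw : ‖w‖ ≤ 1) : ‖f w‖ ≤ ∑' n, c n := by
  rw [← (hf.hasSum w hw).tsum_eq]
  exact tsum_of_norm_bounded hf.summable.hasSum (hf.norm_term_le hw)

lemma one : HasNonnegSeries (fun _ => 1) (Pi.single 0 1) where
  nonneg n := by by_cases h : n = 0 <;> simp [h]
  summable := (hasSum_pi_single 0 1).summable
  hasSum w _ := by
    have := hasSum_pi_single (0 : ℕ) (1 : ℂ)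
    convert! this using 2 with n
    by_cases h : n = 0 <;> simp [h]

lemma mul (hf : HasNonnegSeries f c) (hg : HasNonnegSeries g e) :
    HasNonnegSeries (fun w => f w * g w)
      (fun n => ∑ kl ∈ Finset.HasAntidiagonal.antidiagonal n, c kl.1 * e kl.2) where
  nonneg n := Finset.sum_nonneg fun kl _ => mul_nonneg (hf.nonneg _) (hg.nonneg _)
  summable := (summable_norm_sum_mul_antidiagonal_of_summable_norm
    hf.summable.norm hg.summable.norm).of_norm
  hasSum w hw := by
    have h1 := hf.summable_norm hw
    have h2 := hg.summable_norm hw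
    have h3 := tsum_mul_tsum_eq_tsum_sum_antidiagonal_of_summable_norm h1 h2
    have h4 := (summable_norm_sum_mul_antidiagonal_of_summable_norm h1 h2).of_norm.hasSum
    rw [← h3, (hf.hasSum w hw).tsum_eq, (hg.hasSum w hw).tsum_eq] at h4
    convert! h4 using 2 with n
    push_cast
    rw [Finset.sum_mul]
    refine Finset.sum_congr rfl fun kl hkl => ?_
    rw [← Finset.HasAntidiagonal.mem_antidiagonal.1 hkl]
    ring

lemma exists_pow (hf : HasNonnegSeries f c) (N : ℕ) :
    ∃ c', HasNonnegSeries (fun w => f w ^ N) c' := by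
  induction N with
  | zero => exact ⟨_, by simpa using one⟩
  | succ N ih =>
    obtain ⟨c', h⟩ := ih
    exact ⟨_, by simpa only [pow_succ] using h.mul hf⟩

/-- On the unit circle the series is the characteristic function of atoms of mass `c n` at the
points n h, so smoothing produces a visibly nonnegative sum. Positivity of the stable densities
originates here. -/
lemma integral_cauchyKernel (hf : HasNonnegSeries f c) {s : ℝ} (hs : 0 < s) (h y : ℝ) :
    ∫ t : ℝ, ((2 * s / (s ^ 2 + t ^ 2) : ℝ) : ℂ) * Complex.exp (-(t * y : ℝ) * Complex.I) *
        f (Complex.exp ((t * h : ℝ) * Complex.I)) =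
      ((2 * Real.pi * ∑' n, c n * Real.exp (-s * |n * h - y|) : ℝ) : ℂ) := by
  set F : ℕ → ℝ → ℂ := fun n t => (c n : ℂ) * (((2 * s / (s ^ 2 + t ^ 2) : ℝ) : ℂ) *
    Complex.exp ((t * (n * h - y) : ℝ) * Complex.I)) with hF
  have hnorm : ∀ n t, ‖F n t‖ = c n * (2 * s / (s ^ 2 + t ^ 2)) := by
    intro n t
    simp only [hF, norm_mul, Complex.norm_exp_ofReal_mul_I, Complex.norm_real, mul_one]
    rw [Real.norm_of_nonneg (hf.nonneg n), Real.norm_of_nonneg (by positivity)]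
  have hFm : ∀ n, AEStronglyMeasurable (F n) := fun n => by
    refine Measurable.aestronglyMeasurable ?_
    simp only [hF]
    fun_prop
  have hint : ∀ n, Integrable (F n) := fun n =>
    ((integrable_cauchyKernel hs).const_mul (c n)).mono' (hFm n)
      (Eventually.of_forall fun t => (hnorm n t).le)
  have hsum := hasSum_integral_of_summable_integral_norm (F := F) hint (by
    simp_rw [hnorm, integral_const_mul]
    exact hf.summable.mul_right _)
  have e1 : (∫ t : ℝ, ((2 * s / (s ^ 2 + t ^ 2) : ℝ) : ℂ) *
      Complex.exp (-(t * y : ℝ) * Complex.I) * f (Complex.exp ((t * h : ℝ) * Complex.I))) =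
      ∫ t, ∑' n, F n t := by
    refine integral_congr_ae (Eventually.of_forall fun t => ?_)
    simp only
    rw [← (hf.hasSum _ (Complex.norm_exp_ofReal_mul_I _).le).tsum_eq, ← tsum_mul_left]
    refine tsum_congr fun n => ?_
    simp only [hF]
    rw [← Complex.exp_nat_mul, mul_left_comm, mul_assoc, ← Complex.exp_add]
    congr 3
    push_cast
    ring
  rw [e1, ← hsum.tsum_eq]
  simp only [hF, integral_const_mul, integral_cauchyKernel_mul_exp hs]
  push_cast
  rw [← tsum_mul_left]
  exact tsum_congr fun n => by ring

end HasNonnegSeries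

/-! ### Stable laws as limits -/

/-- Consecutive terms differ by the factor (n + 1 - α)/(n + 2) ≥ 0, so all have the sign of the
first one, -α. Thus 1 - (1 - w)^α has nonnegative coefficients. -/
lemma choose_mul_neg_one_pow_nonpos {α : ℝ} (h0 : 0 < α) (h1 : α < 1) (n : ℕ) :
    Ring.choose α (n + 1) * (-1) ^ (n + 1) ≤ 0 := by
  have hstep : ∀ n : ℕ, Ring.choose α (n + 1) * (n + 1) = Ring.choose α n * (α - n) := by
    intro n
    rw [Ring.choose_eq_smul, Ring.choose_eq_smul, descPochhammer_succ_right,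
      Polynomial.smeval_mul, Nat.factorial_succ]
    simp only [Polynomial.smeval_sub, Polynomial.smeval_X, Polynomial.smeval_natCast, smul_eq_mul]
    have : (n.factorial : ℝ) ≠ 0 := by positivity
    push_cast
    field_simp
    simp
  induction n with
  | zero =>
    have := hstep 0
    simp at this ⊢
    exact h0.le
  | succ n ih =>
    have h := hstep (n + 1)
    have e : Ring.choose α (n + 1 + 1) * (-1) ^ (n + 1 + 1) =
        (Ring.choose α (n + 1) * (-1) ^ (n + 1)) * ((n + 1 - α) / (n + 2)) := by
      have h2 : (n + 2 : ℝ) ≠ 0 := by positivity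
      have h3 : Ring.choose α (n + 1 + 1) = Ring.choose α (n + 1) * (α - (n + 1)) / (n + 2) := by
        rw [eq_div_iff h2]
        push_cast at h
        linarith
      rw [h3, pow_succ (-1 : ℝ) (n + 1)]
      field_simp
      ring
    rw [e]
    refine mul_nonpos_of_nonpos_of_nonneg ih (div_nonneg ?_ (by positivity))
    have : (0 : ℝ) ≤ n := n.cast_nonneg
    linarith

/-- The damping r < 1 keeps r w inside the disc of convergence of the binomial series for every w in
the closed unit disc. -/
lemma exists_hasNonnegSeries_one_sub_cpow {α r : ℝ} (h0 : 0 < α) (h1 : α < 1) (hr0 : 0 < r)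
    (hr1 : r < 1) : ∃ c, HasNonnegSeries (fun w => 1 - (1 - r * w) ^ (α : ℂ)) c := by
  set b : ℕ → ℝ := fun n => -(Ring.choose α n * (-1) ^ n) * r ^ n with hb
  have hs : ∀ w : ℂ, ‖w‖ ≤ 1 →
      HasSum (fun n => (b n : ℂ) * w ^ n) (-(1 - r * w) ^ (α : ℂ)) := by
    intro w hw
    have hmem : (-(r * w) : ℂ) ∈ Metric.eball (0 : ℂ) 1 := by
      rw [mem_eball_zero_iff, enorm_neg, ← ofReal_norm]
      refine ENNReal.ofReal_lt_one.2 ?_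
      rw [norm_mul, Complex.norm_real, Real.norm_of_nonneg hr0.le]
      nlinarith [norm_nonneg w]
    have h := (Complex.one_add_cpow_hasFPowerSeriesOnBall_zero (a := (α : ℂ))).hasSum hmem
    simp only [binomialSeries_apply, zero_add] at h
    convert! h.neg using 2 with n
    simp only [hb, List.ofFn_const, List.prod_replicate, smul_eq_mul]
    rw [← Complex.ofReal_choose]
    push_cast
    rw [neg_pow (↑r * w), mul_pow]
    ring
  have hsum : Summable b := by
    have := (hs 1 (by simp)).summable
    simpa using Complex.summable_ofReal.1 (by simpa using this)
  have hnn : ∀ n, 0 ≤ b (n + 1) := fun n =>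
    mul_nonneg (neg_nonneg.2 (choose_mul_neg_one_pow_nonpos h0 h1 n)) (by positivity)
  have hb0 : b 0 = -1 := by simp [hb]
  refine ⟨fun n => b n + (Pi.single 0 1 : ℕ → ℝ) n, ⟨fun n => ?_, ?_, fun w hw => ?_⟩⟩
  · cases n with
    | zero => simp [hb0]
    | succ n => simpa using hnn n
  · exact hsum.add HasNonnegSeries.one.summable
  · have := (HasNonnegSeries.one.hasSum w hw).add (hs w hw)
    rw [← sub_eq_add_neg] at this
    convert! this using 2 with n
    push_cast
    ring

lemma ofReal_mul_cpow {h : ℝ} (hh : 0 < h) (x y : ℂ) :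
    ((h : ℂ) * x) ^ y = (h : ℂ) ^ y * x ^ y := by
  rcases eq_or_ne x 0 with rfl | hx
  · rcases eq_or_ne y 0 with rfl | hy
    · simp
    · simp [Complex.zero_cpow hy]
  · have hh' : (h : ℂ) ≠ 0 := by exact_mod_cast hh.ne'
    rw [Complex.cpow_def_of_ne_zero (mul_ne_zero hh' hx), Complex.cpow_def_of_ne_zero hh',
      Complex.cpow_def_of_ne_zero hx, Complex.log_ofReal_mul hh hx, ← Complex.ofReal_log hh.le,
      ← Complex.exp_add, add_mul]

/-- The damping 1 - h² is of second order and does not affect the limit at scale h. -/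
lemma tendsto_one_sub_mul_exp_div (z : ℂ) :
    Tendsto (fun h : ℝ => (1 - ((1 - h ^ 2 : ℝ) : ℂ) * Complex.exp (-(z * h))) / h) (𝓝[>] 0)
      (𝓝 z) := by
  have hd : HasDerivAt (fun h : ℝ => Complex.exp (-(z * h))) (-z) 0 := by
    have := (((hasDerivAt_id (0 : ℝ)).ofReal_comp.const_mul z).neg).cexp
    simpa using this
  have h1 := hd.tendsto_slope_zero_right
  have h2 : Tendsto (fun h : ℝ => (h : ℂ) * Complex.exp (-(z * h))) (𝓝[>] 0) (𝓝 0) := by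
    have : Continuous fun h : ℝ => (h : ℂ) * Complex.exp (-(z * h)) := by fun_prop
    exact tendsto_nhdsWithin_of_tendsto_nhds (by simpa using this.tendsto 0)
  have h3 := h1.neg.add h2
  rw [neg_neg, add_zero] at h3
  refine h3.congr' ?_
  filter_upwards [self_mem_nhdsWithin] with h hh
  have : (h : ℂ) ≠ 0 := by exact_mod_cast (Set.mem_Ioi.1 hh).ne'
  simp only [zero_add, Complex.ofReal_zero, mul_zero, neg_zero, Complex.exp_zero,
    Complex.real_smul, Complex.ofReal_inv]
  push_cast
  field_simp
  ring

/-- The function `z ↦ exp (-(z^α c))` on the right half-plane, which is the Laplace transform of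
a one-sided stable law. -/
def stableTransform (α c : ℝ) (z : ℂ) : ℂ := Complex.exp (-(c * z ^ (α : ℂ)))

/-- Sums of N damped Sibuya variables on a lattice of step h, where h^α = c/N: the function is (1 -
(1 - (1 - h²) w)^α)^N. At w = e^{-zh} the inner bracket is asymptotic to z h, so the power behaves
like (1 - c z^α/N)^N. The limit holds up to the imaginary axis, and the bound by one on the disc
permits dominated convergence. -/
lemma exists_approx_stableTransform {α c : ℝ} (h0 : 0 < α) (h1 : α < 1) (hc : 0 < c) :
    ∃ (f : ℕ → ℂ → ℂ) (h : ℕ → ℝ), (∀ n, 0 < h n) ∧ (∀ n, ∃ e, HasNonnegSeries (f n) e) ∧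
      (∀ n w, ‖w‖ ≤ 1 → ‖f n w‖ ≤ 1) ∧
      ∀ z : ℂ, 0 ≤ z.re → Tendsto (fun n => f n (Complex.exp (-(z * h n)))) atTop
        (𝓝 (stableTransform α c z)) := by
  set h : ℕ → ℝ := fun N => (c / N) ^ (1 / α) with hh
  have hpos : ∀ N, 0 < N → 0 < h N := fun N hN => by positivity
  have hlim0 : Tendsto h atTop (𝓝 0) := by
    have := (tendsto_const_div_atTop_nhds_zero_nat c).rpow_const (p := 1 / α)
      (Or.inr (by positivity))
    rwa [Real.zero_rpow (by positivity)] at this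
  have hlim : Tendsto h atTop (𝓝[>] 0) :=
    tendsto_nhdsWithin_iff.2 ⟨hlim0, (eventually_gt_atTop 0).mono fun N hN => hpos N hN⟩
  -- Shifting the index by `M` puts every h, and with it every 1 - h², into (0, 1).
  obtain ⟨M, hM⟩ := eventually_atTop.1 ((hlim0.eventually_lt_const zero_lt_one).and
    (eventually_gt_atTop 0))
  have hfs : ∀ n, ∃ e, HasNonnegSeries
      (fun w => 1 - (1 - ((1 - h (n + M) ^ 2 : ℝ) : ℂ) * w) ^ (α : ℂ)) e := fun n => by
    have := hM (n + M) (by omega)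
    have hp := hpos _ this.2
    exact exists_hasNonnegSeries_one_sub_cpow h0 h1 (by nlinarith) (by nlinarith)
  refine ⟨fun n w => (1 - (1 - ((1 - h (n + M) ^ 2 : ℝ) : ℂ) * w) ^ (α : ℂ)) ^ (n + M),
    fun n => h (n + M), fun n => hpos _ (hM (n + M) (by omega)).2, fun n => ?_, ?_, ?_⟩
  · obtain ⟨e, he⟩ := hfs n
    exact he.exists_pow _
  · intro n w hw
    obtain ⟨e, he⟩ := hfs n
    rw [norm_pow]
    refine pow_le_one₀ (norm_nonneg _) ((he.norm_le hw).trans ?_)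
    have h2 := he.apply_one
    have hp := hpos _ (hM (n + M) (by omega)).2
    -- The coefficients sum to the value at w = 1, which is 1 - (h²)^α ≤ 1.
    have e1 : (1 - ((1 - h (n + M) ^ 2 : ℝ) : ℂ) * 1) = ((h (n + M) ^ 2 : ℝ) : ℂ) := by
      push_cast; ring
    rw [e1, ← Complex.ofReal_cpow (by positivity)] at h2
    have h3 : 1 - (h (n + M) ^ 2) ^ α = ∑' n, e n := by exact_mod_cast h2
    rw [← h3]
    have : 0 ≤ (h (n + M) ^ 2) ^ α := by positivity
    linarith
  · intro z hz
    have key : Tendsto (fun N : ℕ => (1 + -(1 - ((1 - h N ^ 2 : ℝ) : ℂ) *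
        Complex.exp (-(z * h N))) ^ (α : ℂ)) ^ N) atTop (𝓝 (stableTransform α c z)) := by
      refine Complex.tendsto_one_add_pow_exp_of_tendsto ?_
      have hcont := (Complex.continuousAt_cpow_const_of_re_pos (z := z) (w := α) (Or.inl hz)
        (by simpa using h0)).tendsto
      have := ((hcont.comp ((tendsto_one_sub_mul_exp_div z).comp hlim)).const_mul (c : ℂ)).neg
      refine this.congr' ?_
      filter_upwards [eventually_gt_atTop 0] with N hN
      have hp := hpos N hN
      have hp' : (h N : ℂ) ≠ 0 := by exact_mod_cast hp.ne'
      simp only [Function.comp_apply]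
      set x := 1 - ((1 - h N ^ 2 : ℝ) : ℂ) * Complex.exp (-(z * h N))
      have hx : x ^ (α : ℂ) = (h N : ℂ) ^ (α : ℂ) * (x / h N) ^ (α : ℂ) := by
        rw [← ofReal_mul_cpow hp, mul_div_cancel₀ _ hp']
      have hα : (h N : ℂ) ^ (α : ℂ) = ((c / N : ℝ) : ℂ) := by
        rw [← Complex.ofReal_cpow hp.le, hh]
        simp only
        rw [← Real.rpow_mul (by positivity), one_div_mul_cancel h0.ne', Real.rpow_one]
      have hN' : (N : ℂ) ≠ 0 := by exact_mod_cast hN.ne'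
      rw [hx, hα]
      push_cast
      field_simp
    refine (key.comp (tendsto_add_atTop_nat M)).congr fun n => ?_
    simp only [Function.comp_apply, sub_eq_add_neg]

/-! ### One-sided stable densities -/

/-- In the principal branch the argument is -πα/2 or πα/2 according to the sign of t, so the real
part is even in t. As the cosine is positive for α < 1, the stable characteristic functions decay
like exp(-const |t|^α). -/
lemma re_neg_mul_I_cpow {α : ℝ} (t : ℝ) (h0 : 0 < α) :
    ((-(t * Complex.I) : ℂ) ^ (α : ℂ)).re = |t| ^ α * Real.cos (Real.pi * α / 2) := by
  have hα : (α : ℂ) ≠ 0 := by exact_mod_cast h0.ne'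
  rcases lt_trichotomy t 0 with ht | rfl | ht
  · have e : (-(t * Complex.I) : ℂ) = ((-t : ℝ) : ℂ) * Complex.I := by push_cast; ring
    rw [e, ofReal_mul_cpow (neg_pos.2 ht), ← Complex.ofReal_cpow (neg_pos.2 ht).le,
      Complex.re_ofReal_mul, abs_of_neg ht, Complex.cpow_def_of_ne_zero Complex.I_ne_zero,
      Complex.log_I]
    congr 1
    rw [show (Real.pi / 2 * Complex.I * α : ℂ) = ((Real.pi * α / 2 : ℝ) : ℂ) * Complex.I by
      push_cast; ring, Complex.exp_ofReal_mul_I_re]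
  · simp [Complex.zero_cpow hα, Real.zero_rpow h0.ne']
  · have e : (-(t * Complex.I) : ℂ) = (t : ℂ) * (-Complex.I) := by ring
    rw [e, ofReal_mul_cpow ht, ← Complex.ofReal_cpow ht.le,
      Complex.re_ofReal_mul, abs_of_pos ht, Complex.cpow_def_of_ne_zero (by simp),
      Complex.log_neg_I]
    congr 1
    rw [show (-(Real.pi / 2) * Complex.I * α : ℂ) = ((-(Real.pi * α / 2) : ℝ) : ℂ) * Complex.I by
      push_cast; ring, Complex.exp_ofReal_mul_I_re, Real.cos_neg]

lemma cos_pi_mul_div_two_pos {α : ℝ} (h0 : 0 < α) (h1 : α < 1) :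
    0 < Real.cos (Real.pi * α / 2) :=
  Real.cos_pos_of_mem_Ioo ⟨by nlinarith [Real.pi_pos], by nlinarith [Real.pi_pos]⟩

lemma integrable_exp_neg_mul_abs_rpow {p b : ℝ} (hp : 0 < p) (hb : 0 < b) :
    Integrable fun t : ℝ => Real.exp (-b * |t| ^ p) := by
  have h : IntegrableOn (fun t : ℝ => Real.exp (-b * |t| ^ p)) (Set.Ioi 0) := by
    refine (integrableOn_rpow_mul_exp_neg_mul_rpow (s := 0) (by norm_num) hp hb).congr_fun
      (fun t ht => ?_) measurableSet_Ioi
    simp [abs_of_pos (Set.mem_Ioi.1 ht)]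
  have h2 : IntegrableOn (fun t : ℝ => Real.exp (-b * |t| ^ p)) (Set.Iio 0) := by
    have := (h.comp_neg)
    simpa using this
  rw [← integrableOn_univ, ← Set.Iio_union_Ici (a := (0 : ℝ))]
  exact h2.union ((integrableOn_Ici_iff_integrableOn_Ioi (by simp)).2 h)

section StableDensity

variable {α c : ℝ}

lemma norm_stableTransform (h0 : 0 < α) (t : ℝ) :
    ‖stableTransform α c (-(t * Complex.I))‖ =
      Real.exp (-(c * Real.cos (Real.pi * α / 2)) * |t| ^ α) := by
  rw [stableTransform, Complex.norm_exp, Complex.neg_re, Complex.re_ofReal_mul,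
    re_neg_mul_I_cpow t h0]
  congr 1
  ring

lemma measurable_stableTransform : Measurable (stableTransform α c) := by
  unfold stableTransform
  fun_prop

lemma integrable_stableTransform (h0 : 0 < α) (h1 : α < 1) (hc : 0 < c) :
    Integrable fun t : ℝ => stableTransform α c (-(t * Complex.I)) := by
  refine (integrable_exp_neg_mul_abs_rpow h0 (mul_pos hc (cos_pi_mul_div_two_pos h0 h1))).mono'
    ?_ (Eventually.of_forall fun t => (norm_stableTransform h0 t).le)
  exact (measurable_stableTransform.comp (by fun_prop)).aestronglyMeasurable

/-- The Fourier integral defining the stable density. -/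
def stableFourier (α c y : ℝ) : ℂ :=
  ∫ t : ℝ, Complex.exp (-(t * y : ℝ) * Complex.I) * stableTransform α c (-(t * Complex.I))

/-- The continuous density of the one-sided stable law with Laplace transform
`t ↦ exp (-(t^α c))`. -/
def stableDensity (α c y : ℝ) : ℝ := (stableFourier α c y).re / (2 * Real.pi)

lemma norm_exp_neg_ofReal_mul_I (x : ℝ) : ‖Complex.exp (-(x : ℂ) * Complex.I)‖ = 1 := by
  rw [← Complex.ofReal_neg, Complex.norm_exp_ofReal_mul_I]

lemma continuous_stableFourier (h0 : 0 < α) (h1 : α < 1) (hc : 0 < c) :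
    Continuous (stableFourier α c) := by
  refine continuous_of_dominated (bound := fun t => ‖stableTransform α c (-(t * Complex.I))‖)
    (fun y => ?_) (fun y => Eventually.of_forall fun t => ?_)
    (integrable_stableTransform h0 h1 hc).norm (Eventually.of_forall fun t => by fun_prop)
  · exact (Continuous.aestronglyMeasurable (by fun_prop)).mul
      (integrable_stableTransform h0 h1 hc).aestronglyMeasurable
  · rw [norm_mul, norm_exp_neg_ofReal_mul_I, one_mul]

/-- The Fourier integral smoothed with the Fourier transform of `exp (-s |x|)`. -/
def smoothedFourier (α c s y : ℝ) : ℂ :=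
  ∫ t : ℝ, ((2 * s / (s ^ 2 + t ^ 2) : ℝ) : ℂ) * Complex.exp (-(t * y : ℝ) * Complex.I) *
    stableTransform α c (-(t * Complex.I))

/-- A substitute for weak convergence of laws: atoms `e n k` at the nonnegative points k h
approximate the stable law when tested against exp(-s|x - y|) and against exp(-s x). -/
lemma tendsto_smoothedFourier_approx (h0 : 0 < α) (h1 : α < 1) (hc : 0 < c) :
    ∃ (h : ℕ → ℝ) (e : ℕ → ℕ → ℝ), (∀ n, 0 < h n) ∧ (∀ n k, 0 ≤ e n k) ∧
      (∀ s, 0 < s → ∀ y, Tendsto (fun n => ((2 * Real.pi *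
        ∑' k, e n k * Real.exp (-s * |k * h n - y|) : ℝ) : ℂ)) atTop
        (𝓝 (smoothedFourier α c s y))) ∧
      ∀ s, 0 < s → Tendsto (fun n => ∑' k, e n k * Real.exp (-s * (k * h n))) atTop
        (𝓝 (Real.exp (-(s ^ α * c)))) := by
  obtain ⟨f, h, hh, he, hb, hlim⟩ := exists_approx_stableTransform h0 h1 hc
  choose e he using he
  refine ⟨h, e, hh, fun n => (he n).nonneg, fun s hs y => ?_, fun s hs => ?_⟩
  · simp_rw [← fun n => (he n).integral_cauchyKernel hs (h n) y]
    have hmeas : Measurable fun t : ℝ => ((2 * s / (s ^ 2 + t ^ 2) : ℝ) : ℂ) *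
        Complex.exp (-(t * y : ℝ) * Complex.I) := by fun_prop
    refine tendsto_integral_of_dominated_convergence (fun t => 2 * s / (s ^ 2 + t ^ 2))
      (fun n => ?_) (integrable_cauchyKernel hs) (fun n => Eventually.of_forall fun t => ?_)
      (Eventually.of_forall fun t => ?_)
    · refine hmeas.aestronglyMeasurable.mul ?_
      have hm : Measurable fun t : ℝ =>
          ∑' k, (e n k : ℂ) * (Complex.exp ((t * h n : ℝ) * Complex.I)) ^ k :=
        Measurable.tsum fun k => by fun_prop
      refine hm.aestronglyMeasurable.congr (Eventually.of_forall fun t => ?_)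
      exact ((he n).hasSum _ (Complex.norm_exp_ofReal_mul_I _).le).tsum_eq
    · rw [norm_mul, norm_mul, norm_exp_neg_ofReal_mul_I, mul_one, Complex.norm_real,
        Real.norm_of_nonneg (by positivity)]
      exact mul_le_of_le_one_right (by positivity)
        (hb n _ (Complex.norm_exp_ofReal_mul_I _).le)
    · refine Tendsto.const_mul _ ?_
      refine (hlim (-(t * Complex.I)) (by simp)).congr fun n => ?_
      congr 2
      push_cast
      ring
  · have hl := (hlim s (by simpa using hs.le))
    have h2 : stableTransform α c s = ((Real.exp (-(s ^ α * c)) : ℝ) : ℂ) := by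
      rw [stableTransform, ← Complex.ofReal_cpow hs.le, mul_comm]
      push_cast
      rfl
    rw [h2] at hl
    have h3 := (Complex.continuous_re.tendsto _).comp hl
    rw [Complex.ofReal_re] at h3
    refine h3.congr fun n => ?_
    simp only [Function.comp_apply]
    have hn : ‖Complex.exp (-(s * h n))‖ ≤ 1 := by
      rw [Complex.norm_exp]
      simp
      have := hh n
      positivity
    rw [← ((he n).hasSum _ hn).tsum_eq]
    have e1 : (∑' k, (e n k : ℂ) * Complex.exp (-(s * h n)) ^ k) =
        ((∑' k, e n k * Real.exp (-s * (k * h n)) : ℝ) : ℂ) := by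
      push_cast
      refine tsum_congr fun k => ?_
      rw [← Complex.exp_nat_mul]
      congr 2
      ring
    rw [e1, Complex.ofReal_re]

lemma smoothedFourier_nonneg (h0 : 0 < α) (h1 : α < 1) (hc : 0 < c) {s : ℝ} (hs : 0 < s) (y : ℝ) :
    0 ≤ (smoothedFourier α c s y).re := by
  obtain ⟨h, e, -, he, hlim, -⟩ := tendsto_smoothedFourier_approx h0 h1 hc
  refine ge_of_tendsto' ((Complex.continuous_re.tendsto _).comp (hlim s hs y)) fun n => ?_
  simp only [Function.comp_apply, Complex.ofReal_re]
  exact mul_nonneg (by positivity) (tsum_nonneg fun k => mul_nonneg (he n k) (Real.exp_pos _).le)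

lemma smoothedFourier_im (h0 : 0 < α) (h1 : α < 1) (hc : 0 < c) {s : ℝ} (hs : 0 < s) (y : ℝ) :
    (smoothedFourier α c s y).im = 0 := by
  obtain ⟨h, e, -, he, hlim, -⟩ := tendsto_smoothedFourier_approx h0 h1 hc
  refine tendsto_nhds_unique ((Complex.continuous_im.tendsto _).comp (hlim s hs y)) ?_
  simp only [Function.comp_def, Complex.ofReal_im]
  exact tendsto_const_nhds

/-- The approximating atoms are nonnegative, so |k h - y| = k h + |y| for y ≤ 0; the kernel
factorises and leaves the Laplace transform. -/
lemma smoothedFourier_of_nonpos (h0 : 0 < α) (h1 : α < 1) (hc : 0 < c) {s : ℝ} (hs : 0 < s)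
    {y : ℝ} (hy : y ≤ 0) : smoothedFourier α c s y =
      ((2 * Real.pi * (Real.exp (-s * |y|) * Real.exp (-(s ^ α * c))) : ℝ) : ℂ) := by
  obtain ⟨h, e, hh, he, hlim, hlim2⟩ := tendsto_smoothedFourier_approx h0 h1 hc
  refine tendsto_nhds_unique (hlim s hs y) ?_
  refine (Complex.continuous_ofReal.tendsto _).comp (Tendsto.const_mul _ ?_)
  refine ((hlim2 s hs).const_mul (Real.exp (-s * |y|))).congr fun n => ?_
  rw [← tsum_mul_left]
  refine tsum_congr fun k => ?_
  have : 0 ≤ (k : ℝ) * h n := mul_nonneg k.cast_nonneg (hh n).le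
  rw [mul_left_comm, ← Real.exp_add, abs_of_nonpos hy, abs_of_nonneg (by linarith)]
  congr 2
  ring

/-- As s → ∞, (s/2) exp(-s|x|) is an approximate identity: its transform s²/(s² + t²) is at most one
and tends to one. -/
lemma tendsto_smoothedFourier (h0 : 0 < α) (h1 : α < 1) (hc : 0 < c) (y : ℝ) :
    Tendsto (fun n : ℕ => (((n + 1 : ℝ) / 2 : ℝ) : ℂ) * smoothedFourier α c (n + 1) y) atTop
      (𝓝 (stableFourier α c y)) := by
  simp only [smoothedFourier, ← integral_const_mul]
  refine tendsto_integral_of_dominated_convergence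
    (fun t => ‖stableTransform α c (-(t * Complex.I))‖) (fun n => ?_)
    (integrable_stableTransform h0 h1 hc).norm (fun n => Eventually.of_forall fun t => ?_)
    (Eventually.of_forall fun t => ?_)
  · refine (((Measurable.aestronglyMeasurable ?_).mul
      (integrable_stableTransform h0 h1 hc).aestronglyMeasurable)).const_mul _
    fun_prop
  · have hk : (0 : ℝ) < n + 1 := by positivity
    rw [norm_mul, norm_mul, norm_mul, norm_exp_neg_ofReal_mul_I, mul_one, Complex.norm_real,
      Complex.norm_real, Real.norm_of_nonneg (by positivity), Real.norm_of_nonneg (by positivity),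
      ← mul_assoc]
    refine mul_le_of_le_one_left (norm_nonneg _) ?_
    rw [div_mul_div_comm, div_le_one (by positivity)]
    nlinarith [sq_nonneg t]
  · simp_rw [← mul_assoc]
    refine Tendsto.mul_const _ ?_
    have hl : Tendsto (fun n : ℕ => ((n + 1 : ℝ) / 2) *
        (2 * (n + 1 : ℝ) / ((n + 1 : ℝ) ^ 2 + t ^ 2))) atTop (𝓝 1) := by
      have h3 : Tendsto (fun n : ℕ => (n + 1 : ℝ)) atTop atTop :=
        tendsto_atTop_add_const_right _ _ tendsto_natCast_atTop_atTop
      have h4 : Tendsto (fun n : ℕ => (1 + (t / (n + 1 : ℝ)) ^ 2)⁻¹) atTop (𝓝 1) := by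
        have := (((h3.const_div_atTop t).pow 2).const_add 1).inv₀ (by simp)
        simpa using this
      refine h4.congr fun n => ?_
      have : (0 : ℝ) < n + 1 := by positivity
      field_simp
    have := ((Complex.continuous_ofReal.tendsto _).comp hl).mul_const
      (Complex.exp (-(t * y : ℝ) * Complex.I))
    rw [Complex.ofReal_one, one_mul] at this
    refine this.congr fun n => ?_
    simp only [Function.comp_apply, Complex.ofReal_mul]

lemma stableFourier_eq (h0 : 0 < α) (h1 : α < 1) (hc : 0 < c) (y : ℝ) :
    stableFourier α c y = ((2 * Real.pi * stableDensity α c y : ℝ) : ℂ) := by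
  have him : (stableFourier α c y).im = 0 := by
    refine tendsto_nhds_unique
      ((Complex.continuous_im.tendsto _).comp (tendsto_smoothedFourier h0 h1 hc y)) ?_
    refine tendsto_const_nhds.congr fun n => ?_
    have : (0 : ℝ) < n + 1 := by positivity
    simp only [Function.comp_apply, Complex.im_ofReal_mul, smoothedFourier_im h0 h1 hc this,
      mul_zero]
  have hpi : (2 * Real.pi) ≠ 0 := by positivity
  rw [stableDensity, mul_div_cancel₀ _ hpi]
  exact Complex.ext (by simp) (by simp [him])

lemma stableDensity_nonneg (h0 : 0 < α) (h1 : α < 1) (hc : 0 < c) (y : ℝ) :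
    0 ≤ stableDensity α c y := by
  refine div_nonneg (ge_of_tendsto' ((Complex.continuous_re.tendsto _).comp
    (tendsto_smoothedFourier h0 h1 hc y)) fun n => ?_) (by positivity)
  have : (0 : ℝ) < n + 1 := by positivity
  simp only [Function.comp_apply, Complex.re_ofReal_mul]
  exact mul_nonneg (by positivity) (smoothedFourier_nonneg h0 h1 hc this y)

/-- The rescaled smoothed integral at y < 0 is at most π s exp(-s|y|), which vanishes as s → ∞. -/
lemma stableDensity_of_neg (h0 : 0 < α) (h1 : α < 1) (hc : 0 < c) {y : ℝ} (hy : y < 0) :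
    stableDensity α c y = 0 := by
  refine le_antisymm ?_ (stableDensity_nonneg h0 h1 hc y)
  refine div_nonpos_of_nonpos_of_nonneg ?_ (by positivity)
  have hlim : Tendsto (fun n : ℕ => Real.pi * ((n + 1 : ℝ) * Real.exp (-(n + 1 : ℝ) * |y|))) atTop
      (𝓝 0) := by
    have h3 : Tendsto (fun n : ℕ => (n + 1 : ℝ)) atTop atTop :=
      tendsto_atTop_add_const_right _ _ tendsto_natCast_atTop_atTop
    have h5 := (Real.tendsto_pow_mul_exp_neg_atTop_nhds_zero 1).comp
      (h3.atTop_mul_const (abs_pos.2 hy.ne))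
    have h6 := (h5.const_mul (Real.pi / |y|))
    rw [mul_zero] at h6
    refine h6.congr fun n => ?_
    have : |y| ≠ 0 := abs_ne_zero.2 hy.ne
    simp only [Function.comp_apply, pow_one]
    field_simp
  refine le_of_tendsto_of_tendsto' ((Complex.continuous_re.tendsto _).comp
    (tendsto_smoothedFourier h0 h1 hc y)) hlim fun n => ?_
  have hn : (0 : ℝ) < n + 1 := by positivity
  simp only [Function.comp_apply, Complex.re_ofReal_mul, smoothedFourier_of_nonpos h0 h1 hc hn hy.le,
    Complex.ofReal_re]
  have : Real.exp (-((n + 1 : ℝ) ^ α * c)) ≤ 1 := by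
    rw [Real.exp_le_one_iff]
    have : 0 ≤ (n + 1 : ℝ) ^ α * c := by positivity
    linarith
  calc _ = Real.pi * ((n + 1 : ℝ) * (Real.exp (-(n + 1 : ℝ) * |y|) *
      Real.exp (-((n + 1 : ℝ) ^ α * c)))) := by ring
    _ ≤ _ := by
      gcongr
      exact mul_le_of_le_one_right (Real.exp_pos _).le this

lemma continuous_stableDensity (h0 : 0 < α) (h1 : α < 1) (hc : 0 < c) :
    Continuous (stableDensity α c) :=
  (Complex.continuous_re.comp (continuous_stableFourier h0 h1 hc)).div_const _

lemma norm_stableFourier_le (y : ℝ) :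
    ‖stableFourier α c y‖ ≤ ∫ t : ℝ, ‖stableTransform α c (-(t * Complex.I))‖ := by
  refine (norm_integral_le_integral_norm _).trans_eq ?_
  simp only [norm_mul, norm_exp_neg_ofReal_mul_I, one_mul]

/-- By Fubini, testing the density against the kernel gives the smoothed integral at the point 0,
where `smoothedFourier_of_nonpos` evaluates it. This yields the Laplace transform at s > 0. -/
lemma integral_exp_neg_mul_abs_mul_stableFourier (h0 : 0 < α) (h1 : α < 1) (hc : 0 < c) {s : ℝ}
    (hs : 0 < s) :
    ∫ y : ℝ, (Real.exp (-s * |y|) : ℂ) * stableFourier α c y = smoothedFourier α c s 0 := by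
  simp only [stableFourier, ← integral_const_mul]
  rw [integral_integral_swap]
  · simp only [smoothedFourier]
    refine integral_congr_ae (Eventually.of_forall fun t => ?_)
    simp only [← mul_assoc, integral_mul_const, integral_exp_neg_mul_abs_mul_exp hs]
    simp
  · have hprod := (integrable_exp_neg_mul_abs hs).ofReal (𝕜 := ℂ) |>.mul_prod
      (integrable_stableTransform h0 h1 hc)
    refine hprod.mono (AEStronglyMeasurable.mul ?_ (AEStronglyMeasurable.mul ?_ ?_))
      (Eventually.of_forall fun p => ?_)
    · exact Continuous.aestronglyMeasurable (by fun_prop)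
    · exact Continuous.aestronglyMeasurable (by fun_prop)
    · exact (measurable_stableTransform.comp (by fun_prop)).aestronglyMeasurable
    · simp only [Function.uncurry, norm_mul, norm_exp_neg_ofReal_mul_I, one_mul]
      exact le_rfl

lemma integrable_exp_neg_mul_abs_mul_stableDensity (h0 : 0 < α) (h1 : α < 1) (hc : 0 < c) {s : ℝ}
    (hs : 0 < s) : Integrable fun y : ℝ => Real.exp (-s * |y|) * stableDensity α c y := by
  refine (integrable_exp_neg_mul_abs hs).mul_bdd (c := (∫ t : ℝ,
    ‖stableTransform α c (-(t * Complex.I))‖) / (2 * Real.pi))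
    (continuous_stableDensity h0 h1 hc).aestronglyMeasurable (Eventually.of_forall fun y => ?_)
  rw [stableDensity, norm_div, Real.norm_of_nonneg (by positivity : 0 ≤ 2 * Real.pi)]
  gcongr
  exact (Complex.abs_re_le_norm _).trans (norm_stableFourier_le y)

lemma setIntegral_Ici_exp_mul_stableDensity (h0 : 0 < α) (h1 : α < 1) (hc : 0 < c) {s : ℝ}
    (hs : 0 < s) :
    ∫ y in Set.Ici (0 : ℝ), Real.exp (-s * y) * stableDensity α c y = Real.exp (-(s ^ α * c)) := by
  have h := integral_exp_neg_mul_abs_mul_stableFourier h0 h1 hc hs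
  rw [smoothedFourier_of_nonpos h0 h1 hc hs le_rfl] at h
  simp_rw [stableFourier_eq h0 h1 hc, ← Complex.ofReal_mul] at h
  rw [integral_complex_ofReal] at h
  have h2 := Complex.ofReal_injective h
  simp_rw [mul_left_comm _ (2 * Real.pi)] at h2
  rw [integral_const_mul] at h2
  have h3 := mul_left_cancel₀ (by positivity : (2 * Real.pi) ≠ 0) h2
  simp only [abs_zero, mul_zero, Real.exp_zero, one_mul] at h3
  rw [← h3, ← integral_indicator measurableSet_Ici]
  refine integral_congr_ae (Eventually.of_forall fun y => ?_)
  simp only [Set.indicator_apply, Set.mem_Ici]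
  split_ifs with hy
  · rw [abs_of_nonneg hy]
  · rw [stableDensity_of_neg h0 h1 hc (not_le.1 hy), mul_zero]

/-- The Laplace transform is already known for s > 0. Fatou's lemma along s = 1/(n + 1) gives
integrability, and then dominated convergence gives total mass one. -/
theorem isStableDensity_stableDensity (h0 : 0 < α) (h1 : α < 1) (hc : 0 < c) :
    IsStableDensity α c (stableDensity α c) := by
  have hmono : ∀ y ∈ Set.Ici (0 : ℝ), ∀ n : ℕ,
      Real.exp (-(1 / ((n : ℝ) + 1)) * y) = Real.exp (-(1 / ((n : ℝ) + 1)) * |y|) :=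
    fun y hy n => by rw [abs_of_nonneg hy]
  have hI : ∀ n : ℕ, IntegrableOn
      (fun y => Real.exp (-(1 / ((n : ℝ) + 1)) * y) * stableDensity α c y) (Set.Ici 0) := fun n =>
    (integrable_exp_neg_mul_abs_mul_stableDensity h0 h1 hc
      (s := 1 / ((n : ℝ) + 1)) (by positivity)).integrableOn.congr_fun
      (fun y hy => by simp only [hmono y hy n]) measurableSet_Ici
  have hz : Tendsto (fun n : ℕ => (1 / ((n : ℝ) + 1))) atTop (𝓝 0) :=
    tendsto_one_div_add_atTop_nhds_zero_nat
  have hpt : ∀ y, Tendsto (fun n : ℕ => Real.exp (-(1 / ((n : ℝ) + 1)) * y) * stableDensity α c y)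
      atTop (𝓝 (stableDensity α c y)) := fun y => by
    have := ((Real.continuous_exp.tendsto _).comp (hz.neg.mul_const y)).mul_const
      (stableDensity α c y)
    simpa using this
  have hval : Tendsto (fun n : ℕ => ∫ y in Set.Ici (0 : ℝ),
      Real.exp (-(1 / ((n : ℝ) + 1)) * y) * stableDensity α c y) atTop (𝓝 1) := by
    have e : ∀ n : ℕ, ∫ y in Set.Ici (0 : ℝ), Real.exp (-(1 / ((n : ℝ) + 1)) * y) *
        stableDensity α c y = Real.exp (-((1 / ((n : ℝ) + 1)) ^ α * c)) := fun n =>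
      setIntegral_Ici_exp_mul_stableDensity h0 h1 hc (by positivity)
    simp_rw [e]
    have := ((hz.rpow_const (Or.inr h0.le)).mul_const c).neg
    have := (Real.continuous_exp.tendsto _).comp this
    simpa [Real.zero_rpow h0.ne', Function.comp_def] using this
  have hint : IntegrableOn (stableDensity α c) (Set.Ici 0) := by
    refine integrable_of_tendsto (Eventually.of_forall hpt) (fun n => (hI n).aestronglyMeasurable)
      ?_
    have e : ∀ n : ℕ, ∫⁻ y in Set.Ici (0 : ℝ), ‖Real.exp (-(1 / ((n : ℝ) + 1)) * y) *
        stableDensity α c y‖ₑ = ENNReal.ofReal (∫ y in Set.Ici (0 : ℝ),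
          Real.exp (-(1 / ((n : ℝ) + 1)) * y) * stableDensity α c y) := fun n => by
      rw [ofReal_integral_eq_lintegral_ofReal (hI n) (Eventually.of_forall fun y =>
        mul_nonneg (Real.exp_pos _).le (stableDensity_nonneg h0 h1 hc y))]
      refine lintegral_congr fun y => ?_
      rw [Real.enorm_of_nonneg (mul_nonneg (Real.exp_pos _).le (stableDensity_nonneg h0 h1 hc y))]
    simp_rw [e]
    rw [(ENNReal.tendsto_ofReal hval).liminf_eq]
    exact ENNReal.ofReal_ne_top
  refine ⟨(continuous_stableDensity h0 h1 hc).continuousOn,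
    fun y _ => stableDensity_nonneg h0 h1 hc y, hint, fun t ht => ?_⟩
  rcases ht.eq_or_lt with rfl | ht
  · simp only [neg_zero, zero_mul, Real.exp_zero, one_mul, Real.zero_rpow h0.ne']
    refine tendsto_nhds_unique (tendsto_integral_of_dominated_convergence (stableDensity α c)
      (fun n => (hI n).aestronglyMeasurable) hint (fun n => ?_)
      (Eventually.of_forall hpt)) hval
    filter_upwards [ae_restrict_mem measurableSet_Ici] with y hy
    rw [norm_mul, Real.norm_of_nonneg (stableDensity_nonneg h0 h1 hc y),
      Real.norm_of_nonneg (Real.exp_pos _).le]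
    refine mul_le_of_le_one_left (stableDensity_nonneg h0 h1 hc y) (Real.exp_le_one_iff.2 ?_)
    have : 0 ≤ 1 / ((n : ℝ) + 1) * y := mul_nonneg (by positivity) hy
    linarith
  · exact setIntegral_Ici_exp_mul_stableDensity h0 h1 hc ht

end StableDensity

/-! ### Monotone regularly varying functions -/

/-- A positive nonincreasing function, regularly varying at infinity with index `-α`. -/
structure IsRegVarTail (G : ℝ → ℝ) (α : ℝ) : Prop where
  antitone : Antitone G
  pos : ∀ x, 0 < G x
  tendsto : ∀ x, 0 < x → Tendsto (fun a => G (a * x) / G a) atTop (𝓝 (x ^ (-α)))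

/-- Monotonicity passes from integers to reals: with m = ⌊a/N⌋, the number a lies between N m and (N
+ 1) m, so G(a x)/G(a) is squeezed between ratios G(p m)/G(q m) with p/q close to x. -/
lemma IsRegVarTail.of_nat {G : ℝ → ℝ} {α : ℝ} (hG : Antitone G) (hpos : ∀ x, 0 < G x)
    (h : ∀ p : ℕ, 0 < p → Tendsto (fun n : ℕ => G (p * n) / G n) atTop (𝓝 ((p : ℝ) ^ (-α)))) :
    IsRegVarTail G α := by
  refine ⟨hG, hpos, fun x hx => ?_⟩
  have hratio : ∀ p q : ℕ, 0 < p → 0 < q →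
      Tendsto (fun n : ℕ => G (p * n) / G (q * n)) atTop (𝓝 (((p : ℝ) / q) ^ (-α))) := by
    intro p q hp hq
    have := (h p hp).div (h q hq) (by positivity)
    rw [Real.div_rpow p.cast_nonneg q.cast_nonneg]
    refine this.congr fun n => ?_
    simp only [Pi.div_apply]
    rw [div_div_div_cancel_right₀ (hpos _).ne']
  have hfloor : ∀ N : ℕ, 0 < N → Tendsto (fun a : ℝ => ⌊a / N⌋₊) atTop atTop := fun N hN =>
    tendsto_nat_floor_atTop.comp (tendsto_id.atTop_div_const (by positivity))
  have hN : Tendsto (fun N : ℕ => ((N : ℝ) + 1) / N) atTop (𝓝 1) := by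
    have := (tendsto_const_div_atTop_nhds_zero_nat (1 : ℝ)).const_add 1
    rw [add_zero] at this
    refine this.congr' ?_
    filter_upwards [eventually_gt_atTop 0] with N hN
    have : (N : ℝ) ≠ 0 := by positivity
    field_simp
  have hbounds : ∀ N : ℕ, 0 < N → ∀ᶠ a : ℝ in atTop,
      (N : ℝ) * (⌊a / N⌋₊ : ℕ) ≤ a ∧ a ≤ ((N + 1 : ℕ) : ℝ) * (⌊a / N⌋₊ : ℕ) := by
    intro N hN
    have hN' : (0 : ℝ) < N := by positivity
    -- The condition m ≥ N absorbs the rounding: a < N m + N ≤ (N + 1) m.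
    filter_upwards [(hfloor N hN).eventually_ge_atTop N, eventually_gt_atTop 0] with a ha ha0
    have h1 : ((⌊a / N⌋₊ : ℕ) : ℝ) ≤ a / N := Nat.floor_le (by positivity)
    have h2 : a / N < (⌊a / N⌋₊ : ℕ) + 1 := Nat.lt_floor_add_one _
    have h3 : (N : ℝ) ≤ (⌊a / N⌋₊ : ℕ) := by exact_mod_cast ha
    rw [le_div_iff₀ hN'] at h1
    rw [div_lt_iff₀ hN'] at h2
    push_cast
    exact ⟨by linarith, by nlinarith⟩
  refine tendsto_order.2 ⟨fun b hb => ?_, fun b hb => ?_⟩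
  · have hlim : Tendsto (fun N : ℕ => ((⌈x * (N + 1)⌉₊ : ℝ) / N) ^ (-α)) atTop (𝓝 (x ^ (-α))) := by
      refine Tendsto.rpow_const ?_ (Or.inl hx.ne')
      have h1 := (tendsto_nat_ceil_mul_div_atTop (R := ℝ) hx.le).comp
        (tendsto_atTop_add_const_right _ 1 (tendsto_natCast_atTop_atTop (R := ℝ)))
      have := h1.mul hN
      rw [mul_one] at this
      refine this.congr fun N => ?_
      have : (N : ℝ) + 1 ≠ 0 := by positivity
      simp only [Function.comp_apply]
      rw [div_mul_div_cancel₀ this]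
    obtain ⟨N, hbN, hN0⟩ := ((hlim.eventually_const_lt hb).and (eventually_gt_atTop 0)).exists
    have hp : 0 < ⌈x * (N + 1)⌉₊ := Nat.ceil_pos.2 (by positivity)
    have hev := (((hratio _ N hp hN0).comp (hfloor N hN0)).eventually_const_lt hbN)
    filter_upwards [hev, hbounds N hN0] with a h1 ⟨h2, h3⟩
    refine h1.trans_le ?_
    refine div_le_div₀ (hpos _).le (hG ?_) (hpos _) (hG h2)
    have : x * (N + 1) ≤ ⌈x * (N + 1)⌉₊ := Nat.le_ceil _
    calc a * x ≤ ((N + 1 : ℕ) : ℝ) * (⌊a / N⌋₊ : ℕ) * x := by gcongr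
      _ = x * (N + 1) * (⌊a / N⌋₊ : ℕ) := by push_cast; ring
      _ ≤ _ := by gcongr
  · have hlim : Tendsto (fun N : ℕ => ((⌊x * N⌋₊ : ℝ) / ((N + 1 : ℕ) : ℝ)) ^ (-α)) atTop
        (𝓝 (x ^ (-α))) := by
      refine Tendsto.rpow_const ?_ (Or.inl hx.ne')
      have h1 := (tendsto_nat_floor_mul_div_atTop (R := ℝ) hx.le).comp
        (tendsto_natCast_atTop_atTop (R := ℝ))
      have := h1.div hN one_ne_zero
      rw [div_one] at this
      refine this.congr' ?_
      filter_upwards [eventually_gt_atTop 0] with N hN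
      have : (N : ℝ) ≠ 0 := by positivity
      simp only [Function.comp_apply, Pi.div_apply]
      push_cast
      rw [div_div_div_cancel_right₀ this]
    have hxN : ∀ᶠ N : ℕ in atTop, 0 < ⌊x * N⌋₊ :=
      (tendsto_nat_floor_atTop.comp
        (tendsto_natCast_atTop_atTop.const_mul_atTop hx)).eventually_gt_atTop 0
    obtain ⟨N, ⟨hbN, hN0⟩, hp⟩ :=
      (((hlim.eventually_lt_const hb).and (eventually_gt_atTop 0)).and hxN).exists
    have hev := (((hratio _ (N + 1) hp N.succ_pos).comp (hfloor N hN0)).eventually_lt_const hbN)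
    filter_upwards [hev, hbounds N hN0] with a h1 ⟨h2, h3⟩
    refine LE.le.trans_lt ?_ h1
    refine div_le_div₀ (hpos _).le (hG ?_) (hpos _) (hG h3)
    have : (⌊x * N⌋₊ : ℝ) ≤ x * N := Nat.floor_le (by positivity)
    calc (⌊x * N⌋₊ : ℝ) * (⌊a / N⌋₊ : ℕ) ≤ x * N * (⌊a / N⌋₊ : ℕ) := by gcongr
      _ = x * (N * (⌊a / N⌋₊ : ℕ)) := by ring
      _ ≤ x * a := by gcongr
      _ = _ := mul_comm _ _

namespace IsRegVarTail

variable {G : ℝ → ℝ} {α : ℝ}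

/-- Potter's upper bound. -/
lemma exists_rpow_mul_le (hG : IsRegVarTail G α) {p : ℝ} (hp : α < p) (hp0 : 0 < p) :
    ∃ C a₀ : ℝ, 0 < C ∧ 0 < a₀ ∧ ∀ a, a₀ ≤ a → ∀ y, 0 < y → y ≤ a →
      y ^ p * G y ≤ C * (a ^ p * G a) := by
  have h2 : (2⁻¹ : ℝ) ^ (-α) < 2 ^ p := by
    rw [Real.inv_rpow zero_le_two, Real.rpow_neg zero_le_two, inv_inv]
    exact Real.rpow_lt_rpow_of_exponent_lt one_lt_two hp
  obtain ⟨a₁, ha₁⟩ := eventually_atTop.1 ((hG.tendsto 2⁻¹ (by norm_num)).eventually_lt_const h2)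
  set a₀ := max a₁ 1 with ha₀
  have ha₀pos : 0 < a₀ := by positivity
  have hhalf : ∀ a, a₀ ≤ a → G (a / 2) ≤ 2 ^ p * G a := fun a ha => by
    have := ha₁ a ((le_max_left _ _).trans ha)
    rw [div_lt_iff₀ (hG.pos _)] at this
    exact this.le
  set C := max (2 ^ p) (((2 * a₀) ^ p * G 0) / (a₀ ^ p * G (2 * a₀))) with hC
  have hG2 := hG.pos (2 * a₀)
  have hCpos : 0 < C := lt_max_of_lt_left (by positivity)
  refine ⟨C, a₀, hCpos, ha₀pos, ?_⟩
  -- Halving a does not increase a^p G(a). The descent stops when y > a/2, which costs 2^p, or when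
  -- a lies in [a₀, 2a₀], where the second entry of `C` suffices.
  have key : ∀ m : ℕ, ∀ a, a₀ ≤ a → a ≤ 2 ^ (m + 1) * a₀ → ∀ y, 0 < y → y ≤ a →
      y ^ p * G y ≤ C * (a ^ p * G a) := by
    intro m
    induction m with
    | zero =>
      intro a h1 h2 y h3 h4
      rw [zero_add, pow_one] at h2
      have e1 : y ^ p * G y ≤ (2 * a₀) ^ p * G 0 := by
        have := hG.antitone h3.le
        have := (hG.pos y).le
        gcongr
        exact h4.trans h2
      have e2 : a₀ ^ p * G (2 * a₀) ≤ a ^ p * G a := by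
        have := hG.antitone h2
        have := ha₀pos.trans_le h1
        gcongr
      have e3 := le_max_right (2 ^ p) (((2 * a₀) ^ p * G 0) / (a₀ ^ p * G (2 * a₀)))
      rw [← hC, div_le_iff₀ (by positivity)] at e3
      exact e1.trans (e3.trans (by gcongr))
    | succ m ih =>
      intro a h1 h2 y h3 h4
      have hapos : 0 < a := ha₀pos.trans_le h1
      have hGa := hG.pos a
      by_cases ha : a ≤ 2 * a₀
      · refine ih a h1 (ha.trans ?_) y h3 h4
        rw [pow_succ', mul_assoc]
        have : (1 : ℝ) ≤ 2 ^ m := one_le_pow₀ one_le_two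
        nlinarith
      push Not at ha
      rcases le_total y (a / 2) with hy | hy
      · calc y ^ p * G y ≤ C * ((a / 2) ^ p * G (a / 2)) := by
              refine ih _ (by linarith) ?_ y h3 hy
              rw [pow_succ'] at h2
              linarith
          _ ≤ C * ((a / 2) ^ p * (2 ^ p * G a)) := by gcongr; exact hhalf a h1
          _ = C * (a ^ p * G a) := by
              rw [← mul_assoc ((a / 2) ^ p), ← Real.mul_rpow (by positivity) zero_le_two]
              congr 4
              ring
      · calc y ^ p * G y ≤ a ^ p * (2 ^ p * G a) := by
              have := (hG.antitone hy).trans (hhalf a h1)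
              have := (hG.pos y).le
              gcongr
          _ = 2 ^ p * (a ^ p * G a) := by ring
          _ ≤ _ := by gcongr; exact le_max_left _ _
  intro a ha y hy hya
  obtain ⟨m, hm⟩ := pow_unbounded_of_one_lt (a / a₀) one_lt_two
  refine key m a ha ?_ y hy hya
  rw [div_lt_iff₀ ha₀pos] at hm
  rw [pow_succ']
  nlinarith

/-- Potter's lower bound. -/
lemma exists_le_rpow_mul (hG : IsRegVarTail G α) {q : ℝ} (hq : q < α) (hq0 : 0 < q) :
    ∃ C a₀ : ℝ, 0 < C ∧ 0 < a₀ ∧ ∀ y, a₀ ≤ y → ∀ a, y ≤ a →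
      a ^ q * G a ≤ C * (y ^ q * G y) := by
  have h2 : (2 : ℝ) ^ (-α) < 2 ^ (-q) :=
    Real.rpow_lt_rpow_of_exponent_lt one_lt_two (neg_lt_neg hq)
  obtain ⟨a₁, ha₁⟩ := eventually_atTop.1 ((hG.tendsto 2 (by norm_num)).eventually_lt_const h2)
  set a₀ := max a₁ 1 with ha₀
  have ha₀pos : 0 < a₀ := by positivity
  have hdouble : ∀ a, a₀ ≤ a → 2 ^ q * G (2 * a) ≤ G a := fun a ha => by
    have := ha₁ a ((le_max_left _ _).trans ha)
    rw [div_lt_iff₀ (hG.pos _), Real.rpow_neg zero_le_two, mul_comm a] at this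
    have h3 : (0 : ℝ) < 2 ^ q := by positivity
    calc 2 ^ q * G (2 * a) ≤ 2 ^ q * ((2 ^ q)⁻¹ * G a) := by gcongr
      _ = G a := by rw [mul_inv_cancel_left₀ h3.ne']
  refine ⟨2 ^ q, a₀, by positivity, ha₀pos, ?_⟩
  -- Doubling y does not increase y^q G(y); the last stage, with a ≤ 2y, costs the factor 2^q.
  have key : ∀ m : ℕ, ∀ y, a₀ ≤ y → ∀ a, y ≤ a → a ≤ 2 ^ m * y →
      a ^ q * G a ≤ 2 ^ q * (y ^ q * G y) := by
    intro m
    induction m with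
    | zero =>
      intro y hy a h1 h2
      have hy0 : 0 < y := ha₀pos.trans_le hy
      obtain rfl : a = y := le_antisymm (by simpa using h2) h1
      have := hG.pos a
      exact le_mul_of_one_le_left (by positivity) (Real.one_le_rpow one_le_two hq0.le)
    | succ m ih =>
      intro y hy a h1 h2
      have hy0 : 0 < y := ha₀pos.trans_le hy
      have ha0 : 0 < a := hy0.trans_le h1
      have hGy := hG.pos y
      rcases le_total a (2 * y) with ha | ha
      · calc a ^ q * G a ≤ (2 * y) ^ q * G y := by
              have := hG.antitone h1
              have := (hG.pos a).le
              gcongr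
          _ = _ := by rw [Real.mul_rpow zero_le_two hy0.le, mul_assoc]
      · calc a ^ q * G a ≤ 2 ^ q * ((2 * y) ^ q * G (2 * y)) :=
              ih (2 * y) (by linarith) a ha (by rw [pow_succ] at h2; linarith)
          _ = 2 ^ q * (y ^ q * (2 ^ q * G (2 * y))) := by
              rw [Real.mul_rpow zero_le_two hy0.le]; ring
          _ ≤ _ := by gcongr; exact hdouble y hy
  intro y hy a hya
  have hy0 : 0 < y := ha₀pos.trans_le hy
  obtain ⟨m, hm⟩ := pow_unbounded_of_one_lt (a / y) one_lt_two
  rw [div_lt_iff₀ hy0] at hm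
  exact key m y hy a hya hm.le

end IsRegVarTail

/-! ### The integral of `x^(-α)` against an exponential -/

lemma integrableOn_Ioc_exp_mul_rpow {α : ℝ} (h1 : α < 1) (z : ℂ) (K : ℝ) :
    IntegrableOn (fun x : ℝ => Complex.exp (-(z * x)) * ((x ^ (-α) : ℝ) : ℂ)) (Set.Ioc 0 K) := by
  rcases le_total K 0 with hK | hK
  · simp [Set.Ioc_eq_empty_of_le hK]
  have h := (intervalIntegrable_iff_integrableOn_Ioc_of_le hK).1
    (intervalIntegral.intervalIntegrable_rpow' (a := 0) (b := K) (r := -α) (by linarith))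
  have h2 : IntervalIntegrable (fun x : ℝ => ((x ^ (-α) : ℝ) : ℂ)) volume 0 K :=
    (intervalIntegrable_iff_integrableOn_Ioc_of_le hK).2 (Integrable.ofReal h)
  exact (intervalIntegrable_iff_integrableOn_Ioc_of_le hK).1
    (h2.continuousOn_mul (g := fun x : ℝ => Complex.exp (-(z * x)))
      (Continuous.continuousOn (by fun_prop)))

/-- For real z this is the Gamma integral. Both sides are analytic in the right half-plane, the left
one as the moment generating function of x^{-α} dx at -z, and they agree at real points accumulating
at 1. -/
lemma integral_Ioi_exp_mul_rpow {α : ℝ} (h1 : α < 1) {z : ℂ} (hz : 0 < z.re) :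
    ∫ x in Set.Ioi (0 : ℝ), Complex.exp (-(z * x)) * ((x ^ (-α) : ℝ) : ℂ) =
      z ^ (α - 1 : ℂ) * Real.Gamma (1 - α) := by
  set m : Measure ℝ := (volume.restrict (Set.Ioi 0)).withDensity
    fun x => ((Real.toNNReal (x ^ (-α)) : ℝ≥0) : ℝ≥0∞) with hm
  have hmeas : Measurable fun x : ℝ => Real.toNNReal (x ^ (-α)) := by fun_prop
  have hMGF : ∀ w : ℂ, ProbabilityTheory.complexMGF id m w =
      ∫ x in Set.Ioi (0 : ℝ), Complex.exp (w * x) * ((x ^ (-α) : ℝ) : ℂ) := by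
    intro w
    rw [ProbabilityTheory.complexMGF, hm, integral_withDensity_eq_integral_smul hmeas]
    refine setIntegral_congr_fun measurableSet_Ioi fun x hx => ?_
    have hx0 : (0 : ℝ) ≤ x ^ (-α) := Real.rpow_nonneg (le_of_lt hx) _
    simp only [id_eq, NNReal.smul_def, Real.coe_toNNReal _ hx0, Complex.real_smul]
    exact mul_comm _ _
  have hset : Set.Iio 0 ⊆ interior (ProbabilityTheory.integrableExpSet id m) := by
    refine interior_maximal (fun t ht => ?_) isOpen_Iio
    change Integrable _ m
    rw [hm, integrable_withDensity_iff_integrable_smul hmeas]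
    refine IntegrableOn.congr_fun (integrableOn_rpow_mul_exp_neg_mul_rpow (s := -α) (p := 1)
      (b := -t) (by linarith) one_pos (neg_pos.2 ht)) (fun x hx => ?_) measurableSet_Ioi
    have hx0 : (0 : ℝ) ≤ x ^ (-α) := Real.rpow_nonneg (le_of_lt hx) _
    simp only [id_eq, NNReal.smul_def, Real.coe_toNNReal _ hx0, neg_neg, Real.rpow_one, smul_eq_mul]
  have hopen : IsOpen {z : ℂ | 0 < z.re} := isOpen_lt continuous_const Complex.continuous_re
  have hf : AnalyticOnNhd ℂ (fun z : ℂ => ProbabilityTheory.complexMGF id m (-z))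
      {z : ℂ | 0 < z.re} := fun z hz =>
    AnalyticAt.fun_comp (ProbabilityTheory.analyticAt_complexMGF
      (hset (by simpa using hz))) analyticAt_id.neg
  have hg : AnalyticOnNhd ℂ (fun z : ℂ => z ^ (α - 1 : ℂ) * (Real.Gamma (1 - α) : ℂ))
      {z : ℂ | 0 < z.re} := fun z hz =>
    (analyticAt_id.cpow analyticAt_const (Or.inl hz)).mul analyticAt_const
  have hreal : ∀ r : ℝ, 0 < r → ProbabilityTheory.complexMGF id m (-(r : ℂ)) =
      (r : ℂ) ^ (α - 1 : ℂ) * (Real.Gamma (1 - α) : ℂ) := by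
    intro r hr
    rw [hMGF]
    have h := Real.integral_rpow_mul_exp_neg_mul_Ioi (a := 1 - α) (by linarith) hr
    have e1 : ∫ x in Set.Ioi (0 : ℝ), Complex.exp (-(r : ℂ) * x) * ((x ^ (-α) : ℝ) : ℂ) =
        ((∫ x in Set.Ioi (0 : ℝ), x ^ (1 - α - 1) * Real.exp (-(r * x)) : ℝ) : ℂ) := by
      rw [← integral_complex_ofReal]
      refine integral_congr_ae (Eventually.of_forall fun x => ?_)
      simp only [sub_sub_cancel_left]
      push_cast
      rw [mul_comm, neg_mul]
    rw [e1, h, one_div, Real.inv_rpow hr.le, ← Real.rpow_neg hr.le, neg_sub]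
    push_cast
    rw [Complex.ofReal_cpow hr.le]
    push_cast
    rfl
  have hconn : IsPreconnected {z : ℂ | 0 < z.re} := (convex_halfSpace_re_gt 0).isPreconnected
  have hlim : Tendsto (fun n : ℕ => ((1 + 1 / ((n : ℝ) + 1) : ℝ) : ℂ)) atTop (𝓝[≠] 1) := by
    refine tendsto_nhdsWithin_iff.2 ⟨?_, Eventually.of_forall fun n => ?_⟩
    · have := (Complex.continuous_ofReal.tendsto _).comp
        ((tendsto_one_div_add_atTop_nhds_zero_nat (𝕜 := ℝ)).const_add 1)
      simpa [Function.comp_def] using this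
    · have : (1 + 1 / ((n : ℝ) + 1) : ℝ) ≠ 1 := by
        rw [Ne, add_eq_left]
        positivity
      simpa only [Set.mem_compl_iff, Set.mem_singleton_iff, Complex.ofReal_eq_one] using this
  have heq := hf.eqOn_of_preconnected_of_frequently_eq hg hconn (z₀ := 1) (by simp)
    (hlim.frequently (Eventually.frequently (Eventually.of_forall fun n =>
      hreal _ (by positivity)))) hz
  simp only [hMGF] at heq
  simpa only [neg_mul] using heq

lemma norm_exp_neg_mul_le_one {z : ℂ} (hz : 0 ≤ z.re) {x : ℝ} (hx : 0 ≤ x) :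
    ‖Complex.exp (-(z * x))‖ ≤ 1 := by
  rw [Complex.norm_exp, Real.exp_le_one_iff]
  simp
  positivity

/-- Integration by parts. The bound is independent of z, so it survives the limit Re z → 0, where
the tail integral stops converging absolutely. -/
lemma norm_mul_integral_Ioi_exp_mul_rpow_le {α : ℝ} (h0 : 0 < α) {z : ℂ} (hz : 0 < z.re)
    {K : ℝ} (hK : 0 < K) :
    IntegrableOn (fun x : ℝ => Complex.exp (-(z * x)) * ((x ^ (-α) : ℝ) : ℂ)) (Set.Ioi K) ∧
    ‖z * ∫ x in Set.Ioi K, Complex.exp (-(z * x)) * ((x ^ (-α) : ℝ) : ℂ)‖ ≤ 2 * K ^ (-α) := by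
  have hexp : IntegrableOn (fun x : ℝ => Complex.exp (-z * x)) (Set.Ioi K) :=
    integrableOn_exp_mul_complex_Ioi (by simpa using hz) K
  have hexp' : IntegrableOn (fun x : ℝ => Complex.exp (-(z * x))) (Set.Ioi K) := by
    simpa only [neg_mul] using hexp
  have hm : ∀ r : ℝ, AEStronglyMeasurable (fun x : ℝ => ((x ^ r : ℝ) : ℂ))
      (volume.restrict (Set.Ioi K)) := fun r => by
    refine Measurable.aestronglyMeasurable ?_
    fun_prop
  have hint1 : IntegrableOn (fun x : ℝ => Complex.exp (-(z * x)) * ((x ^ (-α) : ℝ) : ℂ))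
      (Set.Ioi K) := by
    refine hexp'.mul_bdd (c := K ^ (-α)) (hm _) ?_
    filter_upwards [ae_restrict_mem measurableSet_Ioi] with x hx
    have hx0 : 0 < x := hK.trans hx
    rw [Complex.norm_real, Real.norm_of_nonneg (by positivity)]
    exact Real.rpow_le_rpow_of_nonpos hK (le_of_lt hx) (by linarith)
  have hrp : IntegrableOn (fun x : ℝ => α * x ^ (-α - 1)) (Set.Ioi K) :=
    (integrableOn_Ioi_rpow_of_lt (by linarith) hK).const_mul α
  have hint2 : IntegrableOn (fun x : ℝ => Complex.exp (-(z * x)) * ((-α * x ^ (-α - 1) : ℝ) : ℂ))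
      (Set.Ioi K) := by
    refine hrp.mono' (hexp'.aestronglyMeasurable.mul ?_) ?_
    · refine Measurable.aestronglyMeasurable ?_
      fun_prop
    · filter_upwards [ae_restrict_mem measurableSet_Ioi] with x hx
      have hx0 : 0 < x := hK.trans hx
      rw [norm_mul, Complex.norm_real, neg_mul, norm_neg, Real.norm_of_nonneg (by positivity)]
      exact mul_le_of_le_one_left (by positivity) (norm_exp_neg_mul_le_one hz.le hx0.le)
  refine ⟨hint1, ?_⟩
  have hderiv : ∀ x ∈ Set.Ioi K, HasDerivAt
      (fun x : ℝ => Complex.exp (-(z * x)) * ((x ^ (-α) : ℝ) : ℂ))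
      (-(z * (Complex.exp (-(z * x)) * ((x ^ (-α) : ℝ) : ℂ))) +
        Complex.exp (-(z * x)) * ((-α * x ^ (-α - 1) : ℝ) : ℂ)) x := by
    intro x hx
    have hx0 : 0 < x := hK.trans hx
    have h1 : HasDerivAt (fun x : ℝ => Complex.exp (-(z * x))) (Complex.exp (-(z * x)) * (-(z * 1)))
        x := (((hasDerivAt_id x).ofReal_comp.const_mul z).neg).cexp
    have h2 := (Real.hasDerivAt_rpow_const (p := -α) (Or.inl hx0.ne')).ofReal_comp
    convert! h1.mul h2 using 1
    ring
  have hcont : ContinuousWithinAt (fun x : ℝ => Complex.exp (-(z * x)) * ((x ^ (-α) : ℝ) : ℂ))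
      (Set.Ici K) K := by
    refine ContinuousAt.continuousWithinAt ?_
    refine ContinuousAt.mul (by fun_prop) ?_
    exact Complex.continuous_ofReal.continuousAt.comp
      (Real.continuousAt_rpow_const _ _ (Or.inl hK.ne'))
  have hlim : Tendsto (fun x : ℝ => Complex.exp (-(z * x)) * ((x ^ (-α) : ℝ) : ℂ)) atTop (𝓝 0) := by
    refine squeeze_zero_norm' (a := fun x => x ^ (-α)) ?_ (tendsto_rpow_neg_atTop h0)
    filter_upwards [eventually_ge_atTop 0] with x hx
    rw [norm_mul, Complex.norm_real, Real.norm_of_nonneg (by positivity)]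
    exact mul_le_of_le_one_left (by positivity) (norm_exp_neg_mul_le_one hz.le hx)
  have hFTC := integral_Ioi_of_hasDerivAt_of_tendsto hcont hderiv
    (((hint1.const_mul z).neg).add hint2) hlim
  have hn : Integrable (fun x : ℝ => -(z * (Complex.exp (-(z * x)) * ((x ^ (-α) : ℝ) : ℂ))))
    (volume.restrict (Set.Ioi K)) := (hint1.const_mul z).neg
  rw [integral_add hn hint2, integral_neg, integral_const_mul] at hFTC
  have hb2 : ‖∫ x in Set.Ioi K, Complex.exp (-(z * x)) * ((-α * x ^ (-α - 1) : ℝ) : ℂ)‖ ≤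
      K ^ (-α) := by
    refine (norm_integral_le_of_norm_le hrp ?_).trans_eq ?_
    · filter_upwards [ae_restrict_mem measurableSet_Ioi] with x hx
      have hx0 : 0 < x := hK.trans hx
      rw [norm_mul, Complex.norm_real, neg_mul, norm_neg, Real.norm_of_nonneg (by positivity)]
      exact mul_le_of_le_one_left (by positivity) (norm_exp_neg_mul_le_one hz.le hx0.le)
    · rw [integral_const_mul, integral_Ioi_rpow_of_lt (by linarith) hK]
      simp only [sub_add_cancel]
      field_simp
  have hb1 : ‖Complex.exp (-(z * K)) * ((K ^ (-α) : ℝ) : ℂ)‖ ≤ K ^ (-α) := by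
    rw [norm_mul, Complex.norm_real, Real.norm_of_nonneg (by positivity)]
    exact mul_le_of_le_one_left (by positivity) (norm_exp_neg_mul_le_one hz.le hK.le)
  have e : z * ∫ x in Set.Ioi K, Complex.exp (-(z * x)) * ((x ^ (-α) : ℝ) : ℂ) =
      Complex.exp (-(z * K)) * ((K ^ (-α) : ℝ) : ℂ) +
        ∫ x in Set.Ioi K, Complex.exp (-(z * x)) * ((-α * x ^ (-α - 1) : ℝ) : ℂ) := by
    linear_combination -hFTC
  rw [e]
  exact (norm_add_le _ _).trans (by linarith)

/-- For Re z > 0 the difference is the tail integral beyond K. The boundary case follows by letting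
z + 1/(n + 1) tend to z, which is harmless on a bounded interval. -/
lemma norm_mul_integral_Ioc_exp_mul_rpow_sub_le {α : ℝ} (h0 : 0 < α) (h1 : α < 1) {z : ℂ}
    (hz : 0 ≤ z.re) {K : ℝ} (hK : 0 < K) :
    ‖z * (∫ x in Set.Ioc 0 K, Complex.exp (-(z * x)) * ((x ^ (-α) : ℝ) : ℂ)) -
      Real.Gamma (1 - α) * z ^ (α : ℂ)‖ ≤ 2 * K ^ (-α) := by
  have hpos : ∀ z : ℂ, 0 < z.re →
      ‖z * (∫ x in Set.Ioc 0 K, Complex.exp (-(z * x)) * ((x ^ (-α) : ℝ) : ℂ)) -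
        Real.Gamma (1 - α) * z ^ (α : ℂ)‖ ≤ 2 * K ^ (-α) := by
    intro z hz
    obtain ⟨hi, hb⟩ := norm_mul_integral_Ioi_exp_mul_rpow_le h0 hz hK
    have hz0 : z ≠ 0 := fun h => by simp [h] at hz
    have hG := integral_Ioi_exp_mul_rpow h1 hz
    have hsplit : (∫ x in Set.Ioi (0 : ℝ), Complex.exp (-(z * x)) * ((x ^ (-α) : ℝ) : ℂ)) =
        (∫ x in Set.Ioc 0 K, Complex.exp (-(z * x)) * ((x ^ (-α) : ℝ) : ℂ)) +
        ∫ x in Set.Ioi K, Complex.exp (-(z * x)) * ((x ^ (-α) : ℝ) : ℂ) := by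
      rw [← setIntegral_union (Set.Ioc_disjoint_Ioi le_rfl) measurableSet_Ioi
        (integrableOn_Ioc_exp_mul_rpow h1 z K) hi, Set.Ioc_union_Ioi_eq_Ioi hK.le]
    have hpow : z * z ^ (α - 1 : ℂ) = z ^ (α : ℂ) := by
      rw [Complex.cpow_sub _ _ hz0, Complex.cpow_one, mul_div_cancel₀ _ hz0]
    rw [hG] at hsplit
    have e : z * (∫ x in Set.Ioc 0 K, Complex.exp (-(z * x)) * ((x ^ (-α) : ℝ) : ℂ)) -
        Real.Gamma (1 - α) * z ^ (α : ℂ) =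
        -(z * ∫ x in Set.Ioi K, Complex.exp (-(z * x)) * ((x ^ (-α) : ℝ) : ℂ)) := by
      rw [← hpow]
      linear_combination -z * hsplit
    rw [e, norm_neg]
    exact hb
  have hl : Tendsto (fun n : ℕ => z + ((1 / ((n : ℝ) + 1) : ℝ) : ℂ)) atTop (𝓝 z) := by
    have := ((Complex.continuous_ofReal.tendsto _).comp
      (tendsto_one_div_add_atTop_nhds_zero_nat (𝕜 := ℝ))).const_add z
    simpa only [Complex.ofReal_zero, add_zero, Function.comp_def] using this
  have hre : ∀ n : ℕ, 0 < (z + ((1 / ((n : ℝ) + 1) : ℝ) : ℂ)).re := fun n => by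
    rw [Complex.add_re, Complex.ofReal_re]
    positivity
  refine le_of_tendsto' (Tendsto.norm (Tendsto.sub (Tendsto.mul hl ?_) (Tendsto.const_mul _ ?_)))
    fun n => hpos _ (hre n)
  · refine tendsto_integral_of_dominated_convergence (fun x => x ^ (-α))
      (fun n => (integrableOn_Ioc_exp_mul_rpow h1 _ K).aestronglyMeasurable) ?_ (fun n => ?_)
      (Eventually.of_forall fun x => ?_)
    · exact (intervalIntegrable_iff_integrableOn_Ioc_of_le hK.le).1
        (intervalIntegral.intervalIntegrable_rpow' (by linarith))
    · filter_upwards [ae_restrict_mem measurableSet_Ioc] with x hx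
      have := hx.1
      rw [norm_mul, Complex.norm_real, Real.norm_of_nonneg (by positivity)]
      exact mul_le_of_le_one_left (by positivity) (norm_exp_neg_mul_le_one (hre n).le hx.1.le)
    · exact (Complex.continuous_exp.continuousAt.tendsto.comp (hl.mul_const _).neg).mul_const _
  · exact ((Complex.continuousAt_cpow_const_of_re_pos (z := z) (w := α) (Or.inl hz)
      (by simpa using h0)).tendsto).comp hl

/-! ### Characteristic functions of regularly varying laws -/

/-- The tail function of a measure on the real line. -/
def tailFun (ν : Measure ℝ) (x : ℝ) : ℝ := ν.real (Set.Ici x)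

section Tail

variable {ν : Measure ℝ} [IsFiniteMeasure ν]

lemma antitone_tailFun : Antitone (tailFun ν) := fun _ _ h =>
  measureReal_mono (Set.Ici_subset_Ici.2 h)

omit [IsFiniteMeasure ν] in
lemma tailFun_nonneg (x : ℝ) : 0 ≤ tailFun ν x := measureReal_nonneg

/-- Layer-cake formula: x ≤ s/a says that s lies in [a x, ∞), and Fubini integrates this condition
into the tail. -/
lemma integral_integral_Ioc_min {E : Type*} [NormedAddCommGroup E] [NormedSpace ℝ E]
    [CompleteSpace E]
    (hν : ∀ᵐ s ∂ν, 0 ≤ s) {g : ℝ → E} (hg : Continuous g) {a K : ℝ} (ha : 0 < a) :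
    ∫ s, (∫ x in Set.Ioc 0 (min (s / a) K), g x) ∂ν =
      ∫ x in Set.Ioc 0 K, tailFun ν (a * x) • g x := by
  have e1 : ∀ᵐ s ∂ν, (∫ x in Set.Ioc 0 (min (s / a) K), g x) =
      ∫ x in Set.Ioc 0 K, (Set.Ici (a * x)).indicator (fun _ => g x) s := by
    filter_upwards [hν] with s hs
    have hset : Set.Ioc 0 (min (s / a) K) = Set.Ioc 0 K ∩ {x | a * x ≤ s} := by
      ext x
      simp only [Set.mem_Ioc, le_min_iff, Set.mem_inter_iff, Set.mem_ofPred_eq, le_div_iff₀ ha,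
        mul_comm a]
      tauto
    have hms : MeasurableSet {x : ℝ | a * x ≤ s} := measurableSet_le (by fun_prop) (by fun_prop)
    rw [hset, ← setIntegral_indicator hms]
    rfl
  rw [integral_congr_ae e1, integral_integral_swap]
  · refine integral_congr_ae (Eventually.of_forall fun x => ?_)
    simp only
    rw [integral_indicator_const _ measurableSet_Ici]
    rfl
  · have hm : MeasurableSet {p : ℝ × ℝ | a * p.2 ≤ p.1} :=
      measurableSet_le (by fun_prop) (by fun_prop)
    have e2 : (Function.uncurry fun (s x : ℝ) => (Set.Ici (a * x)).indicator (fun _ => g x) s) =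
        {p : ℝ × ℝ | a * p.2 ≤ p.1}.indicator fun p => g p.2 := by
      ext p
      rfl
    rw [e2]
    refine Integrable.indicator ?_ hm
    have hgi : Integrable g (volume.restrict (Set.Ioc 0 K)) :=
      (hg.integrableOn_Icc (a := 0) (b := K)).mono_set Set.Ioc_subset_Icc_self
    exact hgi.comp_snd ν

lemma integral_Ioc_exp (z : ℂ) {m : ℝ} (hm : 0 ≤ m) :
    ∫ x in Set.Ioc 0 m, z * Complex.exp (-(z * x)) = 1 - Complex.exp (-(z * m)) := by
  rw [← intervalIntegral.integral_of_le hm]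
  have hd : ∀ x ∈ Set.uIcc 0 m, HasDerivAt (fun x : ℝ => -Complex.exp (-(z * x)))
      (z * Complex.exp (-(z * x))) x := by
    intro x _
    have h1 : HasDerivAt (fun x : ℝ => Complex.exp (-(z * x))) (Complex.exp (-(z * x)) * (-(z * 1)))
        x := (((hasDerivAt_id x).ofReal_comp.const_mul z).neg).cexp
    convert! h1.neg using 1
    ring
  rw [intervalIntegral.integral_eq_sub_of_hasDerivAt hd
    (Continuous.intervalIntegrable (by fun_prop) _ _)]
  simp
  ring

lemma integral_one_sub_exp_min (hν : ∀ᵐ s ∂ν, 0 ≤ s) (z : ℂ) {a K : ℝ} (ha : 0 < a)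
    (hK : 0 < K) :
    ∫ s, (1 - Complex.exp (-(z * (min (s / a) K : ℝ)))) ∂ν =
      z * ∫ x in Set.Ioc 0 K, tailFun ν (a * x) • Complex.exp (-(z * x)) := by
  have h := integral_integral_Ioc_min hν (g := fun x : ℝ => z * Complex.exp (-(z * x)))
    (by fun_prop) (K := K) ha
  rw [← integral_const_mul]
  simp_rw [mul_smul_comm]
  rw [← h]
  refine integral_congr_ae ?_
  filter_upwards [hν] with s hs
  exact (integral_Ioc_exp z (by positivity)).symm

lemma integral_min (hν : ∀ᵐ s ∂ν, 0 ≤ s) {a K : ℝ} (ha : 0 < a) (hK : 0 < K) :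
    ∫ s, min (s / a) K ∂ν = ∫ x in Set.Ioc 0 K, tailFun ν (a * x) := by
  have h := integral_integral_Ioc_min hν (g := fun _ : ℝ => (1 : ℝ)) (by fun_prop) (K := K) ha
  simp only [smul_eq_mul, mul_one] at h
  rw [← h]
  refine integral_congr_ae ?_
  filter_upwards [hν] with s hs
  have : 0 ≤ min (s / a) K := by positivity
  simp [this]

variable {α : ℝ}

omit [IsFiniteMeasure ν] in
-- Potter's bound with the exponent (α + 1)/2 in (α, 1): above the index of variation, yet
-- integrable at the origin.
lemma exists_tailFun_bound (hG : IsRegVarTail (tailFun ν) α) (h0 : 0 < α) (h1 : α < 1) (K : ℝ) :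
    ∃ (D : ℝ → ℝ) (a₀ : ℝ), IntegrableOn D (Set.Ioc 0 K) ∧ 0 < a₀ ∧
      ∀ a, a₀ ≤ a → ∀ x ∈ Set.Ioc 0 K, tailFun ν (a * x) / tailFun ν a ≤ D x := by
  obtain ⟨C, a₀, hC, ha₀, h⟩ := hG.exists_rpow_mul_le (p := (α + 1) / 2) (by linarith)
    (by linarith)
  refine ⟨fun x => C * x ^ (-((α + 1) / 2)) + 1, a₀, ?_, ha₀, fun a ha x hx => ?_⟩
  · rcases le_total K 0 with hK | hK
    · simp [Set.Ioc_eq_empty_of_le hK]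
    refine Integrable.add (Integrable.const_mul ?_ _) (integrable_const _)
    exact (intervalIntegrable_iff_integrableOn_Ioc_of_le hK).1
      (intervalIntegral.intervalIntegrable_rpow' (by linarith))
  · have hx0 := hx.1
    have ha0 : 0 < a := ha₀.trans_le ha
    have hGa := hG.pos a
    rw [div_le_iff₀ hGa]
    rcases le_total x 1 with hx1 | hx1
    · have h2 := h a ha (a * x) (by positivity) (mul_le_of_le_one_right ha0.le hx1)
      rw [Real.mul_rpow ha0.le hx0.le, mul_assoc, mul_left_comm C] at h2
      have h3 := le_of_mul_le_mul_left h2 (by positivity)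
      have h4 : tailFun ν (a * x) ≤ C * x ^ (-((α + 1) / 2)) * tailFun ν a := by
        rw [Real.rpow_neg hx0.le]
        have : (0 : ℝ) < x ^ ((α + 1) / 2) := by positivity
        calc tailFun ν (a * x) = (x ^ ((α + 1) / 2))⁻¹ *
            (x ^ ((α + 1) / 2) * tailFun ν (a * x)) := by rw [inv_mul_cancel_left₀ this.ne']
          _ ≤ (x ^ ((α + 1) / 2))⁻¹ * (C * tailFun ν a) := by gcongr
          _ = _ := by ring
      rw [add_mul, one_mul]
      exact h4.trans (le_add_of_nonneg_right hGa.le)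
    · have : tailFun ν (a * x) ≤ tailFun ν a := hG.antitone (le_mul_of_one_le_right ha0.le hx1)
      rw [add_mul, one_mul]
      exact this.trans (le_add_of_nonneg_left (by positivity))

/-- Truncation at K alters the integrand only where s ≥ a K, and there by at most two. -/
lemma norm_one_sub_exp_sub_le (hν : ∀ᵐ s ∂ν, 0 ≤ s) {z : ℂ} (hz : 0 ≤ z.re) {a K : ℝ} (ha : 0 < a)
    (hK : 0 < K) :
    ‖(∫ s, (1 - Complex.exp (-(z * (s / a : ℝ)))) ∂ν) -
      ∫ s, (1 - Complex.exp (-(z * (min (s / a) K : ℝ)))) ∂ν‖ ≤ 2 * tailFun ν (a * K) := by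
  have hb : ∀ m : ℝ → ℝ, Measurable m → (∀ᵐ s ∂ν, 0 ≤ m s) →
      Integrable (fun s => 1 - Complex.exp (-(z * (m s : ℝ)))) ν := by
    intro m hm hm0
    refine (integrable_const (1 : ℂ)).sub (Integrable.of_bound (C := 1) ?_ ?_)
    · refine Measurable.aestronglyMeasurable ?_
      fun_prop
    · filter_upwards [hm0] with s hs
      exact norm_exp_neg_mul_le_one hz hs
  have h1 : ∀ᵐ s ∂ν, 0 ≤ s / a := hν.mono fun s hs => by positivity
  have h2 : ∀ᵐ s ∂ν, 0 ≤ min (s / a) K := hν.mono fun s hs => by positivity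
  rw [← integral_sub (hb _ (by fun_prop) h1) (hb _ (by fun_prop) h2)]
  refine (norm_integral_le_of_norm_le (g := (Set.Ici (a * K)).indicator fun _ => (2 : ℝ))
    ((integrable_const _).indicator measurableSet_Ici) ?_).trans_eq ?_
  · filter_upwards [h1, h2] with s hs1 hs2
    simp only [Set.indicator_apply, Set.mem_Ici]
    split_ifs with h
    · rw [sub_sub_sub_cancel_left]
      refine (norm_sub_le _ _).trans ?_
      have := norm_exp_neg_mul_le_one hz hs1
      have := norm_exp_neg_mul_le_one hz hs2
      linarith
    · have : s / a ≤ K := by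
        rw [div_le_iff₀ ha]
        linarith [not_le.1 h]
      rw [min_eq_left this, sub_self, norm_zero]
  · rw [integral_indicator_const _ measurableSet_Ici, smul_eq_mul, mul_comm]
    rfl

/-- An Abelian theorem valid up to the imaginary axis, the case of characteristic functions. After
truncation at K the integral is that of z e^{-zx} against the ratio of tails on (0, K], where
Potter's bound dominates; the truncation costs O(K^{-α}) on either side. -/
lemma tendsto_integral_one_sub_exp_div (hν : ∀ᵐ s ∂ν, 0 ≤ s) (hG : IsRegVarTail (tailFun ν) α)
    (h0 : 0 < α) (h1 : α < 1) {z : ℂ} (hz : 0 ≤ z.re) :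
    Tendsto (fun a : ℝ => (∫ s, (1 - Complex.exp (-(z * (s / a : ℝ)))) ∂ν) / tailFun ν a) atTop
      (𝓝 (Real.Gamma (1 - α) * z ^ (α : ℂ))) := by
  have hI : ∀ K : ℝ, Tendsto (fun a : ℝ => z * ∫ x in Set.Ioc 0 K,
      (tailFun ν (a * x) / tailFun ν a) • Complex.exp (-(z * x))) atTop
      (𝓝 (z * ∫ x in Set.Ioc 0 K, Complex.exp (-(z * x)) * ((x ^ (-α) : ℝ) : ℂ))) := by
    intro K
    obtain ⟨D, a₀, hD, ha₀, hb⟩ := exists_tailFun_bound hG h0 h1 K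
    refine Tendsto.const_mul _ ?_
    refine tendsto_integral_filter_of_dominated_convergence D (Eventually.of_forall fun a => ?_)
      ?_ hD ?_
    · have hm1 : Measurable fun x => tailFun ν (a * x) / tailFun ν a :=
        (antitone_tailFun.measurable.comp (measurable_const_mul a)).div_const _
      have hm2 : Measurable fun x : ℝ => Complex.exp (-(z * x)) := by fun_prop
      exact (hm1.smul hm2).aestronglyMeasurable
    · filter_upwards [eventually_ge_atTop a₀] with a ha
      filter_upwards [ae_restrict_mem measurableSet_Ioc] with x hx
      rw [norm_smul, Real.norm_of_nonneg (div_nonneg (tailFun_nonneg _) (tailFun_nonneg _))]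
      exact (mul_le_of_le_one_right (div_nonneg (tailFun_nonneg _) (tailFun_nonneg _))
        (norm_exp_neg_mul_le_one hz hx.1.le)).trans (hb a ha x hx)
    · filter_upwards [ae_restrict_mem measurableSet_Ioc] with x hx
      simp_rw [Complex.real_smul, mul_comm _ (Complex.exp _)]
      exact ((Complex.continuous_ofReal.tendsto _).comp (hG.tendsto x hx.1)).const_mul _
  rw [Metric.tendsto_nhds]
  intro ε hε
  -- Five parts: each of the two truncation errors carries a factor two.
  obtain ⟨K, hKε, hK⟩ : ∃ K : ℝ, K ^ (-α) < ε / 5 ∧ 0 < K :=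
    (((tendsto_rpow_neg_atTop h0).eventually_lt_const (by positivity)).and
      (eventually_gt_atTop 0)).exists
  have hev1 := (Metric.tendsto_nhds.1 (hI K)) (ε / 5) (by positivity)
  have hev2 := (hG.tendsto K hK).eventually_lt_const hKε
  filter_upwards [hev1, hev2, eventually_gt_atTop 0] with a ha1 ha2 ha0
  have hGa := hG.pos a
  have e : (z * ∫ x in Set.Ioc 0 K, (tailFun ν (a * x) / tailFun ν a) • Complex.exp (-(z * x))) =
      (∫ s, (1 - Complex.exp (-(z * (min (s / a) K : ℝ)))) ∂ν) / tailFun ν a := by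
    rw [integral_one_sub_exp_min hν z ha0 hK, mul_div_assoc, div_eq_mul_inv (∫ x in _, _),
      ← integral_mul_const]
    congr 2
    ext x
    rw [Complex.real_smul, Complex.real_smul]
    push_cast
    ring
  have hb1 := norm_one_sub_exp_sub_le hν hz ha0 hK
  have hb2 := norm_mul_integral_Ioc_exp_mul_rpow_sub_le h0 h1 hz hK
  rw [e] at ha1
  set W := ∫ s, (1 - Complex.exp (-(z * (s / a : ℝ)))) ∂ν
  set W' := ∫ s, (1 - Complex.exp (-(z * (min (s / a) K : ℝ)))) ∂ν
  have hb1' : dist (W / tailFun ν a) (W' / tailFun ν a) ≤ 2 * (tailFun ν (a * K) / tailFun ν a) := by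
    rw [dist_eq_norm, ← sub_div, norm_div, Complex.norm_real, Real.norm_of_nonneg hGa.le,
      ← mul_div_assoc]
    gcongr
  rw [← dist_eq_norm] at hb2
  generalize tailFun ν (a * K) / tailFun ν a = ρ at ha2 hb1'
  have htri := (dist_triangle4 _ _ _ _).trans (add_le_add (add_le_add hb1' ha1.le) hb2)
  refine htri.trans_lt ?_
  linarith only [ha2, hKε]

/-- |1 - e^{iθs}| ≤ min(|θ|s, 2), and the layer-cake formula at scale a = 1/|θ| converts this into
tails. -/
lemma exists_integral_norm_one_sub_exp_le (hν : ∀ᵐ s ∂ν, 0 ≤ s) (hG : IsRegVarTail (tailFun ν) α)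
    (h0 : 0 < α) (h1 : α < 1) :
    ∃ C a₀ : ℝ, 0 < C ∧ 0 < a₀ ∧ ∀ θ : ℝ, θ ≠ 0 → a₀ ≤ |θ|⁻¹ →
      ∫ s, ‖1 - Complex.exp ((θ * s : ℝ) * Complex.I)‖ ∂ν ≤ C * tailFun ν |θ|⁻¹ := by
  obtain ⟨D, a₀, hD, ha₀, hb⟩ := exists_tailFun_bound hG h0 h1 2
  refine ⟨max (∫ x in Set.Ioc 0 2, D x) 1, a₀, by positivity, ha₀, fun θ hθ ha => ?_⟩
  set a := |θ|⁻¹ with haθ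
  have ha0 : 0 < a := ha₀.trans_le ha
  have hGa := hG.pos a
  calc ∫ s, ‖1 - Complex.exp ((θ * s : ℝ) * Complex.I)‖ ∂ν ≤ ∫ s, min (s / a) 2 ∂ν := by
        refine integral_mono_of_nonneg (Eventually.of_forall fun s => norm_nonneg _) ?_ ?_
        · have hmin : Measurable fun s : ℝ => min (s / a) 2 := by fun_prop
          refine Integrable.of_bound (C := 2) hmin.aestronglyMeasurable ?_
          filter_upwards [hν] with s hs
          rw [Real.norm_of_nonneg (by positivity)]
          exact min_le_right _ _
        · filter_upwards [hν] with s hs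
          refine le_min ?_ ?_
          · rw [norm_sub_rev]
            have := Real.norm_exp_I_mul_ofReal_sub_one_le (x := θ * s)
            rw [mul_comm] at this
            refine this.trans_eq ?_
            rw [haθ, div_inv_eq_mul, norm_mul, Real.norm_eq_abs, Real.norm_of_nonneg hs, mul_comm]
          · refine (norm_sub_le _ _).trans ?_
            rw [Complex.norm_exp_ofReal_mul_I, norm_one]
            norm_num
    _ = ∫ x in Set.Ioc 0 2, tailFun ν (a * x) := integral_min hν ha0 two_pos
    _ ≤ ∫ x in Set.Ioc 0 2, D x * tailFun ν a := by
        refine integral_mono_of_nonneg (Eventually.of_forall fun s => tailFun_nonneg _)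
          (hD.mul_const _) ?_
        filter_upwards [ae_restrict_mem measurableSet_Ioc] with x hx
        have := hb a ha x hx
        rwa [div_le_iff₀ hGa] at this
    _ = (∫ x in Set.Ioc 0 2, D x) * tailFun ν a := integral_mul_const _ _
    _ ≤ _ := by gcongr; exact le_max_left _ _

/-- For either sign of θ the limiting constant has real part Γ(1-α) cos(πα/2) > 0, so the real part
has the full order of the tail. This forces the dominant eigenvalue strictly inside the disc. -/
lemma exists_le_re_integral_one_sub_exp (hν : ∀ᵐ s ∂ν, 0 ≤ s) (hG : IsRegVarTail (tailFun ν) α)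
    (h0 : 0 < α) (h1 : α < 1) :
    ∃ c a₀ : ℝ, 0 < c ∧ 0 < a₀ ∧ ∀ θ : ℝ, θ ≠ 0 → a₀ ≤ |θ|⁻¹ →
      c * tailFun ν |θ|⁻¹ ≤ (∫ s, (1 - Complex.exp ((θ * s : ℝ) * Complex.I)) ∂ν).re := by
  have hΓ : 0 < Real.Gamma (1 - α) := Real.Gamma_pos_of_pos (by linarith)
  have hcos := cos_pi_mul_div_two_pos h0 h1
  set c := Real.Gamma (1 - α) * Real.cos (Real.pi * α / 2) with hc
  have hcpos : 0 < c := mul_pos hΓ hcos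
  have key : ∀ ε : ℝ, |ε| = 1 → ∃ a₀ : ℝ, ∀ a, a₀ ≤ a → c / 2 * tailFun ν a ≤
      (∫ s, (1 - Complex.exp ((ε * (s / a) : ℝ) * Complex.I)) ∂ν).re := by
    intro ε hε
    have h := tendsto_integral_one_sub_exp_div hν hG h0 h1 (z := -(ε * Complex.I)) (by simp)
    have h2 := (Complex.continuous_re.tendsto _).comp h
    rw [Complex.re_ofReal_mul, re_neg_mul_I_cpow _ h0, hε, Real.one_rpow, one_mul, ← hc] at h2
    obtain ⟨a₀, ha₀⟩ := eventually_atTop.1 (h2.eventually_const_lt (half_lt_self hcpos))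
    refine ⟨a₀, fun a ha => ?_⟩
    have h3 := ha₀ a ha
    simp only [Function.comp_apply, Complex.div_ofReal_re] at h3
    rw [lt_div_iff₀ (hG.pos a)] at h3
    refine h3.le.trans_eq ?_
    congr 2
    ext s
    congr 2
    push_cast
    ring
  obtain ⟨a₁, ha₁⟩ := key 1 (by simp)
  obtain ⟨a₂, ha₂⟩ := key (-1) (by simp)
  refine ⟨c / 2, max (max a₁ a₂) 1, by positivity, by positivity, fun θ hθ ha => ?_⟩
  have e1 := (le_max_left _ _).trans ha
  rcases lt_or_gt_of_ne hθ with h | h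
  · have h2 := ha₂ _ ((le_max_right _ _).trans e1)
    simp only [div_inv_eq_mul, abs_of_neg h, neg_one_mul, mul_neg, neg_neg] at h2
    simpa only [abs_of_neg h, mul_comm θ] using h2
  · have h2 := ha₁ _ ((le_max_left _ _).trans e1)
    simp only [div_inv_eq_mul, abs_of_pos h, one_mul] at h2
    simpa only [abs_of_pos h, mul_comm θ] using h2

end Tail

/-! ### Perturbation of a simple dominant eigenvalue -/

/-- For one fixed m the inequality ‖b^m‖ < r < 1 is an open condition on b, and it forces geometric
decay of all powers at rate r^{1/m}, uniformly near `a`. -/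
lemma exists_eventually_norm_pow_le {A : Type*} [NormedRing A] [NormedAlgebra ℂ A]
    [CompleteSpace A] {a : A} (ha : spectralRadius ℂ a < 1) :
    ∃ C q : ℝ, 0 ≤ C ∧ 0 < q ∧ q < 1 ∧ ∀ᶠ b in 𝓝 a, ∀ k : ℕ, ‖b ^ k‖ ≤ C * q ^ k := by
  obtain ⟨m, hm, hm0⟩ : ∃ m : ℕ, ‖a ^ m‖ < 1 ∧ 0 < m := by
    have h := (spectrum.pow_norm_pow_one_div_tendsto_nhds_spectralRadius a).eventually_lt_const ha
    obtain ⟨m, hm, hm0⟩ := (h.and (eventually_gt_atTop 0)).exists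
    refine ⟨m, ?_, hm0⟩
    rw [ENNReal.ofReal_lt_one] at hm
    by_contra hcon
    exact absurd hm (not_lt.2 (Real.one_le_rpow (not_lt.1 hcon) (by positivity)))
  obtain ⟨r, hr, hr1⟩ := exists_between hm
  have hr0 : 0 < r := (norm_nonneg _).trans_lt hr
  -- `M` also dominates ‖1‖, which is not assumed to equal one.
  set M := ‖a‖ + 1 + ‖(1 : A)‖ with hM
  have hM1 : 1 ≤ M := by rw [hM]; linarith [norm_nonneg a, norm_nonneg (1 : A)]
  have hm0' : (m : ℝ) ≠ 0 := by positivity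
  have hq1 : r ^ (1 / m : ℝ) < 1 := Real.rpow_lt_one hr0.le hr1 (by positivity)
  refine ⟨M * M ^ m * r⁻¹, r ^ (1 / m : ℝ), by positivity, by positivity, hq1, ?_⟩
  have e1 : ∀ᶠ b in 𝓝 a, ‖b ^ m‖ < r :=
    (continuous_norm.comp (continuous_pow m)).continuousAt.eventually_lt_const hr
  have e2 : ∀ᶠ b in 𝓝 a, ‖b‖ < ‖a‖ + 1 :=
    continuous_norm.continuousAt.eventually_lt_const (lt_add_one _)
  filter_upwards [e1, e2] with b hb1 hb2 k
  have hbM : ‖b‖ ≤ M := by rw [hM]; linarith [norm_nonneg (1 : A)]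
  have hpow : ∀ (x : A) (y : ℝ) (n : ℕ), ‖x‖ ≤ y → ‖x ^ n‖ ≤ ‖(1 : A)‖ ⊔ 1 * y ^ n := by
    intro x y n hxy
    rcases n.eq_zero_or_pos with rfl | hn
    · simp
    · exact le_sup_of_le_right (by
        rw [one_mul]
        exact (norm_pow_le' x hn).trans (pow_le_pow_left₀ (norm_nonneg _) hxy n))
  have h1 : ‖(b ^ m) ^ (k / m)‖ ≤ M * r ^ (k / m) := by
    rcases Nat.eq_zero_or_pos (k / m) with h | h
    · rw [h, pow_zero, pow_zero, mul_one, hM]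
      linarith [norm_nonneg a]
    · refine (norm_pow_le' _ h).trans ((pow_le_pow_left₀ (norm_nonneg _) hb1.le _).trans ?_)
      exact le_mul_of_one_le_left (by positivity) hM1
  have h2 : ‖b ^ (k % m)‖ ≤ M ^ m := by
    rcases Nat.eq_zero_or_pos (k % m) with h | h
    · rw [h, pow_zero]
      refine le_trans ?_ (le_self_pow₀ hM1 hm0.ne')
      rw [hM]; linarith [norm_nonneg a]
    · exact (norm_pow_le' _ h).trans ((pow_le_pow_left₀ (norm_nonneg _) hbM _).trans
        (pow_le_pow_right₀ hM1 (Nat.mod_lt k hm0).le))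
  have h3 : r ^ (k / m) ≤ r⁻¹ * (r ^ (1 / m : ℝ)) ^ k := by
    rw [← Real.rpow_natCast, ← Real.rpow_natCast, ← Real.rpow_mul hr0.le, ← Real.rpow_neg_one,
      ← Real.rpow_add hr0]
    refine Real.rpow_le_rpow_of_exponent_ge hr0 hr1.le ?_
    have : (k : ℝ) < m * ((k / m : ℕ) + 1) := by
      exact_mod_cast Nat.lt_mul_div_succ k hm0
    rw [one_div, inv_mul_eq_div]
    have h4 : (k : ℝ) / m ≤ (k / m : ℕ) + 1 := by
      rw [div_le_iff₀ (by positivity)]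
      linarith
    linarith
  calc ‖b ^ k‖ = ‖(b ^ m) ^ (k / m) * b ^ (k % m)‖ := by
        rw [← pow_mul, ← pow_add, Nat.div_add_mod]
    _ ≤ (M * r ^ (k / m)) * M ^ m := (norm_mul_le _ _).trans (by gcongr)
    _ ≤ (M * (r⁻¹ * (r ^ (1 / m : ℝ)) ^ k)) * M ^ m := by gcongr
    _ = _ := by ring

/-- Q is an idempotent on which S acts as the scalar l, so the power splits along Q. The exponent
must be positive: at zero the two sides are 1 and 1 - Q. -/
lemma sub_smul_pow_succ {A : Type*} [Ring A] [Algebra ℂ A] {S Q : A} {l : ℂ}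
    (hSQ : S * Q = l • Q) (hQS : Q * S = l • Q) (hQQ : Q * Q = Q) (k : ℕ) :
    (S - l • Q) ^ (k + 1) = S ^ (k + 1) - l ^ (k + 1) • Q := by
  have hpow : ∀ k : ℕ, S ^ k * Q = l ^ k • Q := by
    intro k
    induction k with
    | zero => simp
    | succ k ih => rw [pow_succ, mul_assoc, hSQ, mul_smul_comm, ih, smul_smul, pow_succ']
  induction k with
  | zero => simp
  | succ k ih =>
    rw [pow_succ _ (k + 1), ih, sub_mul, mul_sub, mul_sub, mul_smul_comm, hpow, smul_mul_assoc, hQS,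
      smul_mul_smul_comm, hQQ, ← pow_succ S]
    module

lemma tendsto_clm_apply {ι E F : Type*} [NormedAddCommGroup E] [NormedSpace ℂ E]
    [NormedAddCommGroup F] [NormedSpace ℂ F] {l : Filter ι} {S : ι → E →L[ℂ] F} {S₀ : E →L[ℂ] F}
    {u : ι → E} {u₀ : E} (hS : Tendsto S l (𝓝 S₀)) (hu : Tendsto u l (𝓝 u₀)) :
    Tendsto (fun i => S i (u i)) l (𝓝 (S₀ u₀)) :=
  (isBoundedBilinearMap_apply.continuous.tendsto (S₀, u₀)).comp (hS.prodMk_nhds hu)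

section Perturbation

variable {E G : Type*} [NormedAddCommGroup E] [NormedSpace ℂ E] [CompleteSpace E]
  [NormedAddCommGroup G] [NormedSpace ℂ G] [CompleteSpace G]

/-- Continuation of a normalized eigenvector of a parametrized operator. -/
lemma exists_tendsto_eigenvector (M : G →L[ℂ] E →L[ℂ] E) {S₀ : G} {e : E} {φ : E →L[ℂ] ℂ}
    (he : φ e = 1) (hRe : M S₀ e = e) (hφR : ∀ u, φ (M S₀ u) = φ u)
    (hunit : IsUnit (1 - (M S₀ - φ.smulRight e))) :
    ∃ h : G → E, Tendsto h (𝓝 S₀) (𝓝 e) ∧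
      ∀ᶠ S in 𝓝 S₀, φ (h S) = 1 ∧ M S (h S) = φ (M S (h S)) • h S := by
  -- Implicit function theorem. Zeros of Φ are eigenvectors with eigenvalue φ(M S h), and the
  -- partial derivative in h at (S₀, e) is -(1 - (M S₀ - φ ⊗ e)), invertible by `hunit`.
  set Φ : G × E → E := fun p => M p.1 p.2 - φ (M p.1 p.2) • p.2 with hΦ
  have hcd : ContDiff ℂ 1 Φ := by
    have h1 : ContDiff ℂ 1 fun p : G × E => M p.1 p.2 :=
      (M.contDiff.comp contDiff_fst).clm_apply contDiff_snd
    exact h1.sub ((φ.contDiff.comp h1).smul contDiff_snd)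
  have hst : HasStrictFDerivAt Φ (fderiv ℂ Φ (S₀, e)) (S₀, e) :=
    hcd.contDiffAt.hasStrictFDerivAt one_ne_zero
  have hd1 : HasFDerivAt (fun h => Φ (S₀, h)) (fderiv ℂ Φ (S₀, e) ∘L .inr ℂ G E) e :=
    hst.hasFDerivAt.comp e (hasFDerivAt_prodMk_right S₀ e)
  have hd2 : HasFDerivAt (fun h => Φ (S₀, h)) (-(1 - (M S₀ - φ.smulRight e))) e := by
    have h1 : HasFDerivAt (fun h => M S₀ h) (M S₀) e := (M S₀).hasFDerivAt
    have h2 : HasFDerivAt (fun h => φ (M S₀ h)) φ e :=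
      φ.hasFDerivAt.congr_of_eventuallyEq (Eventually.of_forall fun h => hφR h)
    convert! h1.sub (h2.smul (hasFDerivAt_id e)) using 1
    ext k
    simp [hφR, he]
    abel
  have hinv : (fderiv ℂ Φ (S₀, e) ∘L .inr ℂ G E).IsInvertible := by
    rw [hd1.unique hd2]
    obtain ⟨v, hv⟩ := hunit.neg
    exact ⟨ContinuousLinearEquiv.unitsEquiv ℂ E v, by rw [← hv]; rfl⟩
  have hΦ0 : Φ (S₀, e) = 0 := by simp [hΦ, hRe, he]
  have hlim := hst.tendsto_implicitFunctionOfProdDomain hinv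
  refine ⟨hst.implicitFunctionOfProdDomain hinv, hlim, ?_⟩
  have hev := hst.eventually_apply_implicitFunctionOfProdDomain hinv
  set h := hst.implicitFunctionOfProdDomain hinv
  have hl : Tendsto (fun S => φ (M S (h S))) (𝓝 S₀) (𝓝 1) := by
    have := (φ.continuous.tendsto _).comp (tendsto_clm_apply (M.continuous.tendsto S₀) hlim)
    simpa only [hRe, he, Function.comp_def] using this
  filter_upwards [hev, hl.eventually_ne one_ne_zero] with S hS hne
  rw [hΦ0] at hS
  have hS' := sub_eq_zero.1 hS
  simp only at hS'
  refine ⟨?_, hS'⟩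
  -- Applying φ to the eigenvector equation gives l = l φ(h); as l ≠ 0, the normalisation φ(h) = 1
  -- is automatic.
  have := congrArg φ hS'
  rw [map_smul, smul_eq_mul] at this
  exact mul_left_cancel₀ hne (by rw [← this, mul_one])

/-- Transposition of operators. -/
def transposeCLM (E : Type*) [NormedAddCommGroup E] [NormedSpace ℂ E] :
    (E →L[ℂ] E) →L[ℂ] (E →L[ℂ] ℂ) →L[ℂ] (E →L[ℂ] ℂ) :=
  (ContinuousLinearMap.compL ℂ E E ℂ).flip

omit [CompleteSpace E] in
lemma transposeCLM_apply (S : E →L[ℂ] E) (ψ : E →L[ℂ] ℂ) : transposeCLM E S ψ = ψ ∘L S := rfl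

omit [CompleteSpace E] in
lemma isUnit_transposeCLM {S : E →L[ℂ] E} (h : IsUnit S) : IsUnit (transposeCLM E S) := by
  obtain ⟨u, rfl⟩ := h
  refine ⟨⟨transposeCLM E u, transposeCLM E ↑u⁻¹, ?_, ?_⟩, rfl⟩
  · ext ψ x
    simp only [mul_apply_eq_comp, transposeCLM_apply, ContinuousLinearMap.comp_apply,
      one_apply_eq_self]
    rw [← mul_apply_eq_comp, u.inv_mul, one_apply_eq_self]
  · ext ψ x
    simp only [mul_apply_eq_comp, transposeCLM_apply, ContinuousLinearMap.comp_apply,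
      one_apply_eq_self]
    rw [← mul_apply_eq_comp, u.mul_inv, one_apply_eq_self]

/-- Perturbation theory of a simple dominant eigenvalue. -/
theorem exists_dominant_eigenvalue {R : E →L[ℂ] E} {e : E} {φ : E →L[ℂ] ℂ}
    (he : φ e = 1) (hRe : R e = e) (hφR : ∀ u, φ (R u) = φ u)
    (hrad : spectralRadius ℂ (R - φ.smulRight e) < 1) :
    ∃ (lam : (E →L[ℂ] E) → ℂ) (Pi : (E →L[ℂ] E) → (E →L[ℂ] E)) (C q : ℝ),
      0 ≤ C ∧ 0 < q ∧ q < 1 ∧ Tendsto lam (𝓝 R) (𝓝 1) ∧ Tendsto Pi (𝓝 R) (𝓝 (φ.smulRight e)) ∧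
      (∀ᶠ S in 𝓝 R, ∀ k : ℕ, ‖S ^ (k + 1) - lam S ^ (k + 1) • Pi S‖ ≤ C * q ^ (k + 1)) ∧
      (fun S => lam S - φ (S e)) =o[𝓝 R] fun S => S - R := by
  have hunit : IsUnit (1 - (R - φ.smulRight e)) := by
    have h := spectrum.mem_resolventSet_of_spectralRadius_lt (k := (1 : ℂ))
      (a := R - φ.smulRight e) (by simpa using hrad)
    simpa [spectrum.mem_resolventSet_iff] using h
  obtain ⟨h, hlim, hh⟩ := exists_tendsto_eigenvector (ContinuousLinearMap.id ℂ (E →L[ℂ] E))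
    (S₀ := R) he hRe hφR hunit
  -- Left eigenvectors are eigenvectors of the transpose, normalised by evaluation at `e`.
  set ev : (E →L[ℂ] ℂ) →L[ℂ] ℂ := ContinuousLinearMap.apply ℂ ℂ e with hev
  have hT : transposeCLM E (1 - (R - φ.smulRight e)) =
      1 - (transposeCLM E R - ev.smulRight φ) := by
    ext ψ u
    change ψ (u - (R u - φ u • e)) = ψ u - (ψ (R u) - ψ e • φ u)
    rw [map_sub, map_sub, map_smul, smul_eq_mul, smul_eq_mul, mul_comm]
  obtain ⟨ν, hνlim, hν⟩ := exists_tendsto_eigenvector (transposeCLM E) (S₀ := R) (e := φ) (φ := ev)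
    (by simpa [hev] using he) (by ext u; exact hφR u)
    (fun ψ => by simp [hev, transposeCLM_apply, hRe])
    (by
      have := isUnit_transposeCLM hunit
      rwa [hT] at this)
  simp only [ContinuousLinearMap.id_apply] at hh
  have hνh : Tendsto (fun S => ν S (h S)) (𝓝 R) (𝓝 1) := by
    simpa only [he] using tendsto_clm_apply hνlim hlim
  set lam : (E →L[ℂ] E) → ℂ := fun S => φ (S (h S)) with hlam
  set Pi : (E →L[ℂ] E) → (E →L[ℂ] E) := fun S => (ν S (h S))⁻¹ • (ν S).smulRight (h S) with hPi
  have hlamlim : Tendsto lam (𝓝 R) (𝓝 1) := by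
    have := (φ.continuous.tendsto _).comp (tendsto_clm_apply tendsto_id hlim)
    simpa only [id_eq, hRe, he, Function.comp_def] using this
  have hPilim : Tendsto Pi (𝓝 R) (𝓝 (φ.smulRight e)) := by
    have h1 : Tendsto (fun S => (ν S).smulRight (h S)) (𝓝 R) (𝓝 (φ.smulRight e)) := by
      have := ((ContinuousLinearMap.smulRightL ℂ E E).continuous.tendsto φ).comp hνlim
      exact tendsto_clm_apply this hlim
    have := (hνh.inv₀ one_ne_zero).smul h1
    rwa [inv_one, one_smul] at this
  have hNlim : Tendsto (fun S => S - lam S • Pi S) (𝓝 R) (𝓝 (R - φ.smulRight e)) := by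
    have := (tendsto_id (x := 𝓝 R)).sub (hlamlim.smul hPilim)
    rwa [one_smul] at this
  obtain ⟨C, q, hC, hq0, hq1, hpow⟩ := exists_eventually_norm_pow_le hrad
  refine ⟨lam, Pi, C, q, hC, hq0, hq1, hlamlim, hPilim, ?_, ?_⟩
  · filter_upwards [hNlim.eventually hpow, hh, hν, hνh.eventually_ne one_ne_zero] with
      S hS ⟨hS1, hS2⟩ ⟨hS3, hS4⟩ hne k
    have hS2' : S (h S) = lam S • h S := hS2
    have hleft : ∀ u, ν S (S u) = lam S * ν S u := by
      set l := ev (transposeCLM E S (ν S)) with hl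
      have h1 : ∀ u, ν S (S u) = l * ν S u := fun u => by
        have := congrArg (fun ψ : E →L[ℂ] ℂ => ψ u) hS4
        simpa [transposeCLM_apply] using this
      have h2 : l = lam S := by
        have := h1 (h S)
        rw [hS2', map_smul, smul_eq_mul] at this
        exact (mul_right_cancel₀ hne this).symm
      rwa [← h2]
    have hSP : S * Pi S = lam S • Pi S := by
      ext u
      simp only [hPi, mul_apply_eq_comp, smul_apply,
        ContinuousLinearMap.smulRight_apply, map_smul, hS2']
      simp only [smul_smul]
      congr 1
      ring
    have hPS : Pi S * S = lam S • Pi S := by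
      ext u
      simp only [hPi, mul_apply_eq_comp, smul_apply,
        ContinuousLinearMap.smulRight_apply, hleft, smul_smul]
      congr 1
      ring
    have hPP : Pi S * Pi S = Pi S := by
      ext u
      simp only [hPi, mul_apply_eq_comp, smul_apply,
        ContinuousLinearMap.smulRight_apply, map_smul, smul_smul]
      congr 1
      field_simp
    rw [← sub_smul_pow_succ hSP hPS hPP]
    exact hS (k + 1)
  · rw [isLittleO_iff]
    intro c hc
    have hd : Tendsto (fun S => ‖φ‖ * ‖h S - e‖) (𝓝 R) (𝓝 0) := by
      have := ((hlim.sub_const e).norm).const_mul ‖φ‖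
      rwa [sub_self, norm_zero, mul_zero] at this
    filter_upwards [hh, hd.eventually_lt_const hc] with S ⟨hS1, _⟩ hS3
    -- Since φ(R(h - e)) = φ(h - e) = 0, the error is S - R applied to a vector that tends to zero.
    have e1 : lam S - φ (S e) = φ ((S - R) (h S - e)) := by
      rw [sub_apply, map_sub φ, hφR, map_sub φ (h S), hS1, he, sub_self,
        sub_zero, map_sub, map_sub]
    rw [e1]
    calc ‖φ ((S - R) (h S - e))‖ ≤ ‖φ‖ * (‖S - R‖ * ‖h S - e‖) :=
          (φ.le_opNorm _).trans (by gcongr; exact (S - R).le_opNorm _)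
      _ = ‖φ‖ * ‖h S - e‖ * ‖S - R‖ := by ring
      _ ≤ _ := by gcongr

/-- Splitting off a simple eigenvalue `1` leaves an operator of spectral radius less than one. -/
theorem spectralRadius_sub_smulRight_lt_one [Nontrivial E] {R : E →L[ℂ] E} {e : E} {φ : E →L[ℂ] ℂ}
    (he : φ e = 1) (hRe : R e = e) (hφR : ∀ u, φ (R u) = φ u) (hsimple : IsSimpleEigenvalue R 1)
    {K : Set ℂ} (hK : K ⊆ Metric.ball 0 1) (hspec : spectrum ℂ R = {1} ∪ K) :
    spectralRadius ℂ (R - φ.smulRight e) < 1 := by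
  set P : E →L[ℂ] E := φ.smulRight e with hP
  have hPu : ∀ u, P u = φ u • e := fun u => rfl
  have hRP : R * P = P := by ext u; simp [hPu, hRe]
  have hPR : P * R = P := by ext u; simp [hPu, hφR]
  have hPP : P * P = P := by ext u; simp [hPu, he]
  refine spectrum.spectralRadius_lt_of_forall_lt (r := 1) _ fun z hz => ?_
  by_contra hcon
  have hz1 : 1 ≤ ‖z‖ := by
    rw [not_lt] at hcon
    exact_mod_cast hcon
  refine hz ?_
  rw [spectrum.mem_resolventSet_iff]
  have hz0 : z ≠ 0 := fun h => by simp [h] at hz1; linarith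
  -- At z = 1 the operator R has no resolvent; there bijectivity is read off from simplicity, the
  -- kernel being spanned by `e` and complementary to the range.
  by_cases hzone : z = 1
  · subst hzone
    obtain ⟨hfin, hcompl⟩ := hsimple
    have hker : ∀ u, R u = u → u = φ u • e := by
      intro u hu
      have hu' : u ∈ LinearMap.ker (R - (1 : ℂ) • ContinuousLinearMap.id ℂ E : E →L[ℂ] E).toLinearMap := by
        simp [hu]
      have he' : e ∈ LinearMap.ker (R - (1 : ℂ) • ContinuousLinearMap.id ℂ E : E →L[ℂ] E).toLinearMap := by
        simp [hRe]
      have hene : (⟨e, he'⟩ : LinearMap.ker _) ≠ 0 := fun h => by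
        have h2 : e = 0 := congrArg Subtype.val h
        simp [h2] at he
      obtain ⟨c, hc⟩ := (finrank_eq_one_iff_of_nonzero' _ hene).1 hfin ⟨u, hu'⟩
      have hc' : c • e = u := congrArg Subtype.val hc
      rw [← hc', map_smul, he, smul_eq_mul, mul_one]
    rw [map_one, ContinuousLinearMap.isUnit_iff_bijective]
    constructor
    · rw [injective_iff_map_eq_zero]
      intro u hu
      have h1 : u - (R u - φ u • e) = 0 := by simpa [hPu] using hu
      have h2 : φ u = 0 := by
        have := congrArg φ h1
        simpa [hφR, he] using this
      have h3 : R u = u := by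
        rw [h2, zero_smul, sub_zero] at h1
        exact (sub_eq_zero.1 h1).symm
      rw [hker u h3, h2, zero_smul]
    · intro v
      obtain ⟨a, ha, b, hb, hab⟩ := Submodule.mem_sup.1
        (hcompl.sup_eq_top ▸ Submodule.mem_top : v ∈ _)
      obtain ⟨w, rfl⟩ := hb
      have ha' : R a = a := by simpa [sub_eq_zero] using ha
      refine ⟨a + (φ w • e - w), ?_⟩
      rw [← hab]
      simp [hPu, ha', hRe, he]
      rw [← hker a ha']
      abel
  · have hzR : z ∉ spectrum ℂ R := by
      rw [hspec]
      rintro (h | h)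
      · exact hzone h
      · have := hK h
        rw [mem_ball_zero_iff] at this
        linarith
    rw [spectrum.notMem_iff] at hzR
    obtain ⟨u, hu⟩ := hzR
    set A := algebraMap ℂ (E →L[ℂ] E) z with hA
    have hAP : A * P = z • P := by rw [hA, Algebra.algebraMap_eq_smul_one, smul_one_mul]
    have hPA : P * A = z • P := by rw [hA, Algebra.algebraMap_eq_smul_one, mul_smul_one]
    have hX : A - (R - P) = ↑u + P := by rw [hu]; abel
    have huP : (↑u : E →L[ℂ] E) * P = (z - 1) • P := by
      rw [hu, sub_mul, hAP, hRP, sub_smul, one_smul]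
    have hPu' : P * (↑u : E →L[ℂ] E) = (z - 1) • P := by
      rw [hu, mul_sub, hPA, hPR, sub_smul, one_smul]
    have hz1' : z - 1 ≠ 0 := sub_ne_zero.2 hzone
    have hvP : (↑u⁻¹ : E →L[ℂ] E) * P = (z - 1)⁻¹ • P := by
      have h : P = (z - 1)⁻¹ • ((↑u : E →L[ℂ] E) * P) := by rw [huP, inv_smul_smul₀ hz1']
      conv_lhs => rw [h, mul_smul_comm, ← mul_assoc, u.inv_mul, one_mul]
    have hPv : P * (↑u⁻¹ : E →L[ℂ] E) = (z - 1)⁻¹ • P := by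
      have h : P = (z - 1)⁻¹ • (P * (↑u : E →L[ℂ] E)) := by rw [hPu', inv_smul_smul₀ hz1']
      conv_lhs => rw [h, smul_mul_assoc, mul_assoc, u.mul_inv, mul_one]
    rw [hX]
    -- On the range of P, u acts as z - 1 and u + P as z; c P corrects the inverse there.
    set c : ℂ := z⁻¹ - (z - 1)⁻¹ with hc
    have hcz : (z - 1)⁻¹ + (c * (z - 1) + c) = 0 := by
      rw [hc]
      field_simp
      ring
    refine ⟨⟨↑u + P, ↑u⁻¹ + c • P, ?_, ?_⟩, rfl⟩
    · rw [add_mul, mul_add, mul_add, u.mul_inv, mul_smul_comm, huP, hPv, mul_smul_comm, hPP,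
        smul_smul, add_assoc, add_left_comm (_ • P), ← add_smul, ← add_smul, hcz, zero_smul,
        add_zero]
    · rw [add_mul, mul_add, mul_add, u.inv_mul, smul_mul_assoc, hPu', hvP, smul_mul_assoc, hPP,
        smul_smul, add_assoc, ← add_smul, ← add_smul, hcz, zero_smul, add_zero]

end Perturbation

/-! ### Pointwise structure of excursions -/

section Excursions

variable {X : Type*}

/-- The time `S_A(φ)` spent in `A` during the first excursion. -/
def excursion (f : X → X) (Y A : Set X) (x : X) : ℕ := occupation f A (firstReturn f Y x) x

lemma occupation_add (f : X → X) (A : Set X) (m n : ℕ) (x : X) :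
    occupation f A (m + n) x = occupation f A m x + occupation f A n (f^[m] x) := by
  induction n with
  | zero => simp [occupation]
  | succ n ih =>
    unfold occupation at ih ⊢
    rw [← add_assoc, Finset.sum_Icc_succ_top (by omega), Finset.sum_Icc_succ_top (by omega), ih,
      add_assoc, ← Function.iterate_add_apply, add_assoc m, add_comm m]

lemma returnTime_succ (f : X → X) (Y : Set X) (k : ℕ) (x : X) :
    returnTime f Y (k + 1) x = firstReturn f Y x + returnTime f Y k (returnMap f Y x) := by
  unfold returnTime
  rw [Finset.sum_range_succ', add_comm]
  rfl

lemma occupation_returnTime_succ (f : X → X) (Y A : Set X) (k : ℕ) (x : X) :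
    occupation f A (returnTime f Y (k + 1) x) x =
      excursion f Y A x + occupation f A (returnTime f Y k (returnMap f Y x)) (returnMap f Y x) := by
  rw [returnTime_succ, occupation_add]
  rfl

lemma iterate_firstReturn_mem {f : X → X} {Y : Set X} {x : X} (h : 1 ≤ firstReturn f Y x) :
    f^[firstReturn f Y x] x ∈ Y :=
  (Nat.sInf_mem (Nat.nonempty_of_pos_sInf h)).2

lemma iterate_notMem_of_lt_firstReturn {f : X → X} {Y : Set X} {x : X} {k : ℕ} (hk : 1 ≤ k)
    (h : k < firstReturn f Y x) : f^[k] x ∉ Y := fun hY =>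
  Nat.notMem_of_lt_sInf h ⟨hk, hY⟩

lemma firstReturn_eq_succ_iff {f : X → X} {Y : Set X} {x : X} {n : ℕ} :
    firstReturn f Y x = n + 1 ↔ f^[n + 1] x ∈ Y ∧ ∀ k < n, f^[k + 1] x ∉ Y := by
  constructor
  · intro h
    refine ⟨h ▸ iterate_firstReturn_mem (by omega), fun k hk => ?_⟩
    exact iterate_notMem_of_lt_firstReturn (by omega) (by omega)
  · rintro ⟨h1, h2⟩
    refine le_antisymm (Nat.sInf_le ⟨by omega, h1⟩) ?_
    by_contra hlt
    have hne : {k : ℕ | 1 ≤ k ∧ f^[k] x ∈ Y}.Nonempty := ⟨n + 1, by omega, h1⟩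
    have hm := Nat.sInf_mem hne
    change 1 ≤ firstReturn f Y x ∧ f^[firstReturn f Y x] x ∈ Y at hm
    have h3 := h2 (firstReturn f Y x - 1) (by omega)
    rw [Nat.sub_add_cancel hm.1] at h3
    exact h3 hm.2

variable [MeasurableSpace X] {d : ℕ} {f : X → X} {μ : Measure X} {Y : Set X} {A : Fin d → Set X}

lemma DynamicalSeparation.excursion_eq_zero (h : DynamicalSeparation f μ Y A) {x : X}
    (hx : firstReturn f Y x = 1) (j : Fin d) : excursion f Y (A j) x = 0 := by
  have h1 : f^[1] x ∈ Y := hx ▸ iterate_firstReturn_mem hx.ge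
  rw [excursion, hx, occupation]
  simp only [Finset.Icc_self, Finset.sum_singleton]
  exact if_neg fun hA => Set.disjoint_left.1 (h.disjoint_base j) h1 hA

/-- A point whose image lies in A_i lies itself in A_i or Y, so the orbit cannot change rays between
visits to Y. Times 1, …, n + 1 belong to one ray and time n + 2 to Y. -/
lemma DynamicalSeparation.exists_excursion (h : DynamicalSeparation f μ Y A) {x : X} {n : ℕ}
    (hx : firstReturn f Y x = n + 2) : ∃ j, excursion f Y (A j) x = n + 1 ∧
      ∀ i, i ≠ j → excursion f Y (A i) x = 0 := by
  have hret : f^[n + 2] x ∈ Y := hx ▸ iterate_firstReturn_mem (by omega)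
  have hmem : ∀ k, 1 ≤ k → k < n + 2 → ∃ i, f^[k] x ∈ A i := fun k h1 h2 => by
    have h3 : f^[k] x ∉ Y := iterate_notMem_of_lt_firstReturn h1 (by omega)
    have h4 : f^[k] x ∈ Y ∪ ⋃ j, A j := by rw [h.cover]; trivial
    exact Set.mem_iUnion.1 (h4.resolve_left h3)
  obtain ⟨j, hj⟩ := hmem 1 le_rfl (by omega)
  have hall : ∀ k, k < n + 1 → f^[k + 1] x ∈ A j := by
    intro k
    induction k with
    | zero => exact fun _ => hj
    | succ k ih =>
      intro hk
      obtain ⟨i, hi⟩ := hmem (k + 1 + 1) (by omega) (by omega)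
      have h5 : f^[k + 1] x ∈ f ⁻¹' A i := by
        rwa [Set.mem_preimage, ← Function.iterate_succ_apply' f]
      have h6 := (h.preimage_subset i h5).resolve_right
        (iterate_notMem_of_lt_firstReturn (by omega) (by omega))
      by_cases hij : i = j
      · rwa [← hij]
      · exact absurd (ih (by omega)) (Set.disjoint_left.1 (h.disjoint_ray hij) h6)
  have hocc : ∀ i, excursion f Y (A i) x = ∑ k ∈ Finset.Icc 1 (n + 1), if i = j then 1 else 0 := by
    intro i
    rw [excursion, hx, occupation, Finset.sum_Icc_succ_top (by omega),
      if_neg fun hA => Set.disjoint_left.1 (h.disjoint_base i) hret hA, add_zero]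
    refine Finset.sum_congr rfl fun k hk => ?_
    rw [Finset.mem_Icc] at hk
    have h7 := hall (k - 1) (by omega)
    rw [Nat.sub_add_cancel hk.1] at h7
    by_cases hij : i = j
    · rw [if_pos hij, if_pos (hij ▸ h7)]
    · rw [if_neg hij, if_neg fun h8 => Set.disjoint_left.1 (h.disjoint_ray hij) h8 h7]
  refine ⟨j, by rw [hocc]; simp, fun i hi => by rw [hocc]; simp [hi]⟩

lemma measurable_occupation_comp (hf : Measurable f) {A : Set X} (hA : MeasurableSet A)
    {g : X → ℕ} (hg : Measurable g) : Measurable fun x => occupation f A (g x) x := by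
  classical
  have h : Measurable fun p : X × ℕ => occupation f A p.2 p.1 := by
    refine measurable_from_prod_countable_left fun n => ?_
    change Measurable fun x => ∑ k ∈ Finset.Icc 1 n, if f^[k] x ∈ A then 1 else 0
    exact Finset.measurable_fun_sum (Finset.Icc 1 n) fun k _ =>
      Measurable.ite (hf.iterate k hA) measurable_const measurable_const
  exact h.comp (measurable_id.prodMk hg)

lemma measurable_excursion (hf : Measurable f) (hY : MeasurableSet Y) {A : Set X}
    (hA : MeasurableSet A) : Measurable (excursion f Y A) :=
  measurable_occupation_comp hf hA (measurable_firstReturn hf hY)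

lemma measurable_returnMap (hf : MeasurePreserving f μ μ) (hY : MeasurableSet Y) :
    Measurable (returnMap f Y) := (quasiMeasurePreserving_returnMap hf hY).measurable

lemma measurable_returnTime (hf : MeasurePreserving f μ μ) (hY : MeasurableSet Y) (k : ℕ) :
    Measurable (returnTime f Y k) := by
  unfold returnTime
  exact Finset.measurable_fun_sum _ fun m _ =>
    (measurable_firstReturn hf.measurable hY).comp ((measurable_returnMap hf hY).iterate m)

/-! ### The first return map preserves the measure -/

lemma ae_one_le_firstReturn (hcons : Conservative f μ) (hY : MeasurableSet Y) :
    ∀ᵐ x ∂μ.restrict Y, 1 ≤ firstReturn f Y x := by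
  rw [ae_restrict_iff' hY]
  filter_upwards [hcons.ae_mem_imp_frequently_image_mem hY.nullMeasurableSet] with x hx hxY
  obtain ⟨n, hn1, hn⟩ := (frequently_atTop.1 (hx hxY)) 1
  have hne : {k : ℕ | 1 ≤ k ∧ f^[k] x ∈ Y}.Nonempty := ⟨n, hn1, hn⟩
  exact (Nat.sInf_mem hne).1

/-- Kac's decomposition. The remainder consists of points that avoid Y at times 0, …, N - 1 and lie
in E at time N. Its preimage under f is cut along Y: the part in Y returns first at time N + 1, the
other part is the next remainder. -/
lemma sum_measure_firstReturn_inter_add (hf : MeasurePreserving f μ μ) (hY : MeasurableSet Y)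
    {E : Set X} (hE : MeasurableSet E) (hEY : E ⊆ Y) (N : ℕ) :
    (∑ n ∈ Finset.range N, μ ({x | firstReturn f Y x = n + 1} ∩ returnMap f Y ⁻¹' E ∩ Y)) +
      μ (f^[N] ⁻¹' E ∩ {x | ∀ k < N, f^[k] x ∉ Y}) = μ E := by
  induction N with
  | zero => simp
  | succ N ih =>
    rw [Finset.sum_range_succ, add_assoc, ← ih]
    congr 1
    set H : Set X := f^[N] ⁻¹' E ∩ {x | ∀ k < N, f^[k] x ∉ Y} with hH
    have hHm : MeasurableSet H := by
      refine (hf.measurable.iterate N hE).inter ?_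
      simp only [Set.ofPred_forall]
      exact MeasurableSet.iInter fun k => MeasurableSet.iInter fun _ =>
        (hf.measurable.iterate k hY).compl
    rw [← hf.measure_preimage hHm.nullMeasurableSet, ← measure_inter_add_sdiff (f ⁻¹' H) hY]
    congr 1
    · congr 1
      ext x
      simp only [Set.mem_inter_iff, Set.mem_ofPred_eq, Set.mem_preimage, hH,
        firstReturn_eq_succ_iff, ← Function.iterate_succ_apply]
      constructor
      · rintro ⟨⟨⟨h1, h2⟩, h3⟩, h4⟩
        have : firstReturn f Y x = N + 1 := firstReturn_eq_succ_iff.2 ⟨h1, h2⟩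
        rw [returnMap, this] at h3
        exact ⟨⟨h3, h2⟩, h4⟩
      · rintro ⟨⟨h3, h2⟩, h4⟩
        have : firstReturn f Y x = N + 1 := firstReturn_eq_succ_iff.2 ⟨hEY h3, h2⟩
        refine ⟨⟨⟨hEY h3, h2⟩, ?_⟩, h4⟩
        rwa [returnMap, this]
    · congr 1
      ext x
      simp only [Set.mem_inter_iff, Set.mem_ofPred_eq, Set.mem_preimage, hH, Set.mem_sdiff,
        ← Function.iterate_succ_apply]
      constructor
      · rintro ⟨h1, h2⟩
        exact ⟨⟨h1, fun k hk => h2 (k + 1) (by omega)⟩, h2 0 (by omega)⟩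
      · rintro ⟨⟨h1, h2⟩, h3⟩
        refine ⟨h1, fun k hk => ?_⟩
        cases k with
        | zero => exact h3
        | succ k => exact h2 k (by omega)

/-- The first return map of a conservative measure preserving map preserves the restricted
measure. -/
theorem measurePreserving_returnMap (hcons : Conservative f μ) (hf : MeasurePreserving f μ μ)
    (hY : MeasurableSet Y) (hfin : μ Y ≠ ∞) :
    MeasurePreserving (returnMap f Y) (μ.restrict Y) (μ.restrict Y) := by
  have hm := measurable_returnMap hf hY
  -- The inequality suffices: applied to the complement it gives equality, as the measure is finite,
  -- and the Kac remainder needs no limit.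
  have hle : ∀ E, MeasurableSet E → μ.restrict Y (returnMap f Y ⁻¹' E) ≤ μ.restrict Y E := by
    intro E hE
    have hEY := hE.inter hY
    have h1 : μ.restrict Y (returnMap f Y ⁻¹' E) ≤
        ∑' n, μ ({x | firstReturn f Y x = n + 1} ∩ returnMap f Y ⁻¹' (E ∩ Y) ∩ Y) := by
      refine le_trans ?_ (measure_iUnion_le _)
      rw [Measure.restrict_apply (hm hE)]
      refine measure_mono_ae ?_
      filter_upwards [ae_imp_of_ae_restrict (ae_one_le_firstReturn hcons hY)] with x hx h2
      obtain ⟨h3, h4⟩ := h2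
      have hx1 := hx h4
      refine Set.mem_iUnion.2 ⟨firstReturn f Y x - 1, ⟨?_, h3, returnMap_mem f h4⟩, h4⟩
      simp only [Set.mem_ofPred_eq]
      omega
    refine h1.trans ?_
    rw [Measure.restrict_apply hE]
    refine ENNReal.tsum_le_of_sum_range_le fun N => ?_
    rw [← sum_measure_firstReturn_inter_add hf hY hEY Set.inter_subset_right N]
    exact le_self_add
  have : IsFiniteMeasure (μ.restrict Y) := ⟨by simpa using hfin.lt_top⟩
  refine ⟨hm, Measure.ext fun E hE => ?_⟩
  rw [Measure.map_apply hm hE]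
  refine le_antisymm (hle E hE) ?_
  have h1 := hle Eᶜ hE.compl
  rw [Set.preimage_compl, measure_compl (hm hE) (measure_ne_top _ _),
    measure_compl hE (measure_ne_top _ _)] at h1
  have h2 : μ.restrict Y E ≤ μ.restrict Y Set.univ := measure_mono (Set.subset_univ _)
  exact (ENNReal.sub_le_sub_iff_left h2 (measure_ne_top _ _)).1 h1

end Excursions

/-! ### Calculus of transfer operators -/

section TransferCalculus

variable {X : Type*} [MeasurableSpace X] {ν : Measure X} {F : X → X} {u v : X → ℂ}

lemma transfer_congr (h : u =ᵐ[ν] v) : transfer ν F u = transfer ν F v := by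
  have h1 : (fun y => (u y).re) =ᵐ[ν] fun y => (v y).re := h.mono fun y hy => by simp only [hy]
  have h2 : (fun y => (u y).im) =ᵐ[ν] fun y => (v y).im := h.mono fun y hy => by simp only [hy]
  unfold transfer transferReal
  rw [WithDensityᵥEq.congr_ae h1, WithDensityᵥEq.congr_ae h2]

lemma integrable_transfer (ν : Measure X) (F : X → X) (u : X → ℂ) :
    Integrable (transfer ν F u) ν :=
  ((integrable_transferReal ν F _).ofReal).add
    (((integrable_transferReal ν F _).ofReal).mul_const _)

variable [SigmaFinite ν]

lemma transfer_ae_eq (hF : Measure.QuasiMeasurePreserving F ν ν) (hu : Integrable u ν)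
    (hv : Integrable v ν) (h : ∀ s, MeasurableSet s → ∫ x in s, v x ∂ν = ∫ x in F ⁻¹' s, u x ∂ν) :
    transfer ν F u =ᵐ[ν] v :=
  (integrable_transfer ν F u).ae_eq_of_forall_setIntegral_eq _ _ hv fun s hs _ => by
    rw [setIntegral_transfer ν hF hu hs, h s hs]

/-- A condition on F(x) turns into a condition on the new base point. Constraints on later
excursions thereby pass through one application of the transfer operator. -/
lemma transfer_indicator (hF : Measure.QuasiMeasurePreserving F ν ν) (hu : Integrable u ν)
    {s : Set X} (hs : MeasurableSet s) :
    transfer ν F ((F ⁻¹' s).indicator u) =ᵐ[ν] s.indicator (transfer ν F u) := by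
  have hs' := hF.measurable hs
  refine transfer_ae_eq hF (hu.indicator hs') ((integrable_transfer ν F u).indicator hs)
    fun t ht => ?_
  rw [setIntegral_indicator hs, setIntegral_indicator hs', setIntegral_transfer ν hF hu (ht.inter hs),
    Set.preimage_inter]

lemma transfer_add (hF : Measure.QuasiMeasurePreserving F ν ν) (hu : Integrable u ν)
    (hv : Integrable v ν) :
    transfer ν F (fun x => u x + v x) =ᵐ[ν] fun x => transfer ν F u x + transfer ν F v x := by
  refine transfer_ae_eq hF (hu.add hv) ((integrable_transfer ν F u).add (integrable_transfer ν F v))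
    fun s hs => ?_
  rw [integral_add (integrable_transfer ν F u).integrableOn (integrable_transfer ν F v).integrableOn,
    integral_add hu.integrableOn hv.integrableOn, setIntegral_transfer ν hF hu hs,
    setIntegral_transfer ν hF hv hs]

omit [SigmaFinite ν] in
lemma iterate_transfer_congr (h : u =ᵐ[ν] v) (k : ℕ) :
    (transfer ν F)^[k] u =ᵐ[ν] (transfer ν F)^[k] v := by
  cases k with
  | zero => exact h
  | succ k => rw [Function.iterate_succ_apply, Function.iterate_succ_apply, transfer_congr h]


lemma iterate_transfer_add (hF : Measure.QuasiMeasurePreserving F ν ν) (hu : Integrable u ν)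
    (hv : Integrable v ν) (k : ℕ) :
    (transfer ν F)^[k] (fun x => u x + v x) =ᵐ[ν]
      fun x => (transfer ν F)^[k] u x + (transfer ν F)^[k] v x := by
  induction k generalizing u v with
  | zero => exact EventuallyEq.rfl
  | succ k ih =>
    simp only [Function.iterate_succ_apply]
    exact (iterate_transfer_congr (transfer_add hF hu hv) k).trans
      (ih (integrable_transfer _ _ _) (integrable_transfer _ _ _))

lemma iterate_transfer_zero (hF : Measure.QuasiMeasurePreserving F ν ν) (k : ℕ) :
    (transfer ν F)^[k] (fun _ => 0) =ᵐ[ν] fun _ => 0 := by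
  induction k with
  | zero => exact EventuallyEq.rfl
  | succ k ih =>
    rw [Function.iterate_succ_apply]
    refine (iterate_transfer_congr ?_ k).trans ih
    exact transfer_ae_eq hF (integrable_zero _ _ _) (integrable_zero _ _ _) fun s _ => by simp

lemma iterate_transfer_sum (hF : Measure.QuasiMeasurePreserving F ν ν) {κ : Type*} (s : Finset κ)
    {w : κ → X → ℂ} (hw : ∀ i ∈ s, Integrable (w i) ν) (k : ℕ) :
    (transfer ν F)^[k] (fun x => ∑ i ∈ s, w i x) =ᵐ[ν]
      fun x => ∑ i ∈ s, (transfer ν F)^[k] (w i) x := by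
  classical
  induction s using Finset.induction_on with
  | empty => simpa using iterate_transfer_zero hF k
  | insert a s ha ih =>
    simp only [Finset.sum_insert ha]
    refine (iterate_transfer_add hF (hw a (Finset.mem_insert_self _ _))
      (integrable_finsetSum s fun i hi => hw i (Finset.mem_insert_of_mem hi)) k).trans ?_
    filter_upwards [ih fun i hi => hw i (Finset.mem_insert_of_mem hi)] with x hx
    rw [hx]

end TransferCalculus

/-! ### The renewal recursion -/

/-- The coefficients of the `k`-th power of `R₀ + ∑ z_j^(m+1) R_{j,m}`. -/
def renewalCoeff {A : Type*} [Ring A] {d : ℕ} (R₀ : A) (R : Fin d → ℕ → A) :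
    ℕ → (Fin d → ℕ) → A
  | 0, n => if n = 0 then 1 else 0
  | k + 1, n => renewalCoeff R₀ R k n * R₀ +
      ∑ j, ∑ m ∈ Finset.range (n j),
        renewalCoeff R₀ R k (Function.update n j (n j - (m + 1))) * R j m

section Recursion

variable {X : Type*} [MeasurableSpace X] {d : ℕ} {f : X → X} {μ : Measure X} {Y : Set X}
  {A : Fin d → Set X}

/-- The set where the occupation times up to the `k`-th return are `n`. -/
def occupationSet (f : X → X) (Y : Set X) (A : Fin d → Set X) (n : Fin d → ℕ) (k : ℕ) : Set X :=
  {x | ∀ j, occupation f (A j) (returnTime f Y k x) x = n j}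

lemma measurableSet_occupationSet (hf : MeasurePreserving f μ μ)
    (h : DynamicalSeparation f μ Y A) (n : Fin d → ℕ) (k : ℕ) :
    MeasurableSet (occupationSet f Y A n k) := by
  unfold occupationSet
  rw [Set.ofPred_forall]
  exact MeasurableSet.iInter fun j => measurable_occupation_comp hf.measurable
    (h.measurableSet_ray j) (measurable_returnTime hf h.measurableSet_base k)
    (measurableSet_singleton _)

lemma measurableSet_excursionSet (hf : Measurable f) (h : DynamicalSeparation f μ Y A)
    (j : Fin d) (m : ℕ) : MeasurableSet (excursionSet f Y (A j) m) :=
  measurable_excursion hf h.measurableSet_base (h.measurableSet_ray j) (measurableSet_singleton m)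

/-- Case distinction on the first excursion: it has length one, or spends m + 1 steps in exactly one
ray. At most one term on the right is nonzero, and m < n_j makes the subtraction genuine. -/
lemma indicator_occupationSet_succ (h : DynamicalSeparation f μ Y A) (n : Fin d → ℕ) (k : ℕ)
    (u : X → ℂ) {x : X} (hx : 1 ≤ firstReturn f Y x) :
    (occupationSet f Y A n (k + 1)).indicator u x =
      (returnMap f Y ⁻¹' occupationSet f Y A n k).indicator
        ({x | firstReturn f Y x = 1}.indicator u) x +
      ∑ j, ∑ m ∈ Finset.range (n j),
        (returnMap f Y ⁻¹' occupationSet f Y A (Function.update n j (n j - (m + 1))) k).indicator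
          ((excursionSet f Y (A j) (m + 1)).indicator u) x := by
  classical
  set O : Fin d → ℕ := fun j =>
    occupation f (A j) (returnTime f Y k (returnMap f Y x)) (returnMap f Y x) with hO
  have hmem : ∀ n', x ∈ returnMap f Y ⁻¹' occupationSet f Y A n' k ↔ ∀ j, O j = n' j :=
    fun n' => Iff.rfl
  have hmem1 : x ∈ occupationSet f Y A n (k + 1) ↔ ∀ j, excursion f Y (A j) x + O j = n j := by
    simp only [occupationSet, Set.mem_ofPred_eq, occupation_returnTime_succ]
    exact Iff.rfl
  have hexc : ∀ j m, x ∈ excursionSet f Y (A j) m ↔ excursion f Y (A j) x = m :=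
    fun _ _ => Iff.rfl
  simp only [Set.indicator_apply, hmem, hmem1, hexc, Set.mem_ofPred_eq]
  obtain ⟨p, hp⟩ : ∃ p, firstReturn f Y x = p + 1 := ⟨_, (Nat.sub_add_cancel hx).symm⟩
  cases p with
  | zero =>
    have h0 := h.excursion_eq_zero hp
    simp [h0, hp]
  | succ p =>
    obtain ⟨j₀, hj₀, hne⟩ := h.exists_excursion hp
    have hp1 : firstReturn f Y x ≠ 1 := by omega
    simp only [hp1, if_false, ite_self, zero_add]
    rw [Finset.sum_eq_single j₀]
    · simp only [hj₀, add_left_inj]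
      have hcond : ∀ m, (∀ i, O i = Function.update n j₀ (n j₀ - (m + 1)) i) ↔
          O j₀ = n j₀ - (m + 1) ∧ ∀ i, i ≠ j₀ → O i = n i := by
        intro m
        constructor
        · intro hi
          refine ⟨by simpa using hi j₀, fun i hij => by simpa [hij] using hi i⟩
        · rintro ⟨h1, h2⟩ i
          by_cases hij : i = j₀
          · subst hij; simpa using h1
          · simpa [hij] using h2 i hij
      have hcond2 : (∀ j, excursion f Y (A j) x + O j = n j) ↔
          p + 1 + O j₀ = n j₀ ∧ ∀ i, i ≠ j₀ → O i = n i := by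
        constructor
        · intro hi
          refine ⟨by rw [← hj₀]; exact hi j₀, fun i hij => ?_⟩
          have := hi i
          rwa [hne i hij, zero_add] at this
        · rintro ⟨h1, h2⟩ i
          by_cases hij : i = j₀
          · subst hij; rw [hj₀]; exact h1
          · rw [hne i hij, zero_add]; exact h2 i hij
      simp only [hcond, hcond2]
      by_cases hpn : p < n j₀
      · rw [Finset.sum_eq_single_of_mem p (Finset.mem_range.2 hpn)]
        · have : p + 1 + O j₀ = n j₀ ↔ O j₀ = n j₀ - (p + 1) := by omega
          simp only [this, if_true]
        · intro m _ hmp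
          rw [if_neg (Ne.symm hmp), ite_self]
      · rw [if_neg (by omega)]
        refine (Finset.sum_eq_zero fun m hm => ?_).symm
        rw [Finset.mem_range] at hm
        rw [if_neg (by omega : ¬p = m), ite_self]
    · intro i _ hij
      refine Finset.sum_eq_zero fun m _ => ?_
      simp [hne i hij]
    · intro hj
      exact absurd (Finset.mem_univ _) hj

variable {B : Type*} [NormedAddCommGroup B] [NormedSpace ℂ B]
  {ι : B →ₗ[ℂ] Lp ℂ ∞ (μ.restrict Y)}

lemma DynamicalSeparation.isProbabilityMeasure (h : DynamicalSeparation f μ Y A) :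
    IsProbabilityMeasure (μ.restrict Y) := ⟨by simp [h.measure_base]⟩

lemma integrable_coe_Lp_top {Ω : Type*} [MeasurableSpace Ω] {ν : Measure Ω} [IsFiniteMeasure ν]
    (g : Lp ℂ ∞ ν) : Integrable g ν :=
  (Lp.memLp g).integrable le_top

/-- Peels off the first excursion. The rightmost operator of a product acts first, so the first
excursion contributes the right factor of the recursion, and `transfer_indicator` carries the
remaining conditions past it. -/
theorem induces_occupationTransfer (hcons : Conservative f μ) (hf : MeasurePreserving f μ μ)
    (h : DynamicalSeparation f μ Y A) {R₀ : B →L[ℂ] B} {R : Fin d → ℕ → B →L[ℂ] B}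
    (hR₀ : Induces ι (renewalZero f μ Y) R₀)
    (hR : ∀ j m, Induces ι (renewal f μ Y (A j) (m + 1)) (R j m)) (n : Fin d → ℕ) (k : ℕ) :
    Induces ι (occupationTransfer f μ Y A n k) (renewalCoeff R₀ R k n) := by
  have := h.isProbabilityMeasure
  have hF := quasiMeasurePreserving_returnMap hf h.measurableSet_base
  induction k generalizing n with
  | zero =>
    intro u
    simp only [renewalCoeff, occupationTransfer, Function.iterate_zero, id_eq, returnTime,
      Finset.range_zero, Finset.sum_empty, occupation]
    by_cases hn : n = 0
    · subst hn
      simp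
    · have hn' : ¬ ∀ j, 0 = n j := fun hc => hn (funext fun j => (hc j).symm)
      simp only [hn, if_false]
      simp [hn']
      exact Lp.coeFn_zero ℂ ∞ (μ.restrict Y)
  | succ k ih =>
    intro u
    have hu : Integrable (ι u) (μ.restrict Y) := integrable_coe_Lp_top _
    set D := fun n => occupationSet f Y A n k with hD
    have hDm : ∀ n, MeasurableSet (D n) := fun n => measurableSet_occupationSet hf h n k
    have hφm : MeasurableSet {x | firstReturn f Y x = 1} :=
      measurable_firstReturn hf.measurable h.measurableSet_base (measurableSet_singleton 1)
    have hpre : ∀ n, MeasurableSet (returnMap f Y ⁻¹' D n) := fun n => hF.measurable (hDm n)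
    have hstep : ∀ (n' : Fin d → ℕ) (S : B →L[ℂ] B) (s : Set X), MeasurableSet s →
        (ι (S u) : X → ℂ) =ᵐ[μ.restrict Y] transfer (μ.restrict Y) (returnMap f Y) (s.indicator (ι u)) →
        (transfer (μ.restrict Y) (returnMap f Y))^[k + 1]
          ((returnMap f Y ⁻¹' D n').indicator (s.indicator (ι u))) =ᵐ[μ.restrict Y]
        (ι ((renewalCoeff R₀ R k n' * S) u) : X → ℂ) := by
      intro n' S s hs hS
      rw [Function.iterate_succ_apply]
      refine (iterate_transfer_congr (transfer_indicator hF (hu.indicator hs) (hDm n')) k).trans ?_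
      refine (iterate_transfer_congr ?_ k).trans (ih n' (S u)).symm
      filter_upwards [hS] with x hx
      change (D n').indicator _ x = (D n').indicator _ x
      by_cases hxD : x ∈ D n'
      · rw [Set.indicator_of_mem hxD, Set.indicator_of_mem hxD, hx]
      · rw [Set.indicator_of_notMem hxD, Set.indicator_of_notMem hxD]
    have h1 : occupationTransfer f μ Y A n (k + 1) (ι u) =ᵐ[μ.restrict Y]
        (transfer (μ.restrict Y) (returnMap f Y))^[k + 1] (fun x =>
          (returnMap f Y ⁻¹' D n).indicator ({x | firstReturn f Y x = 1}.indicator (ι u)) x +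
          ∑ j, ∑ m ∈ Finset.range (n j),
            (returnMap f Y ⁻¹' D (Function.update n j (n j - (m + 1)))).indicator
            ((excursionSet f Y (A j) (m + 1)).indicator (ι u)) x) := by
      refine iterate_transfer_congr ?_ (k + 1)
      filter_upwards [ae_one_le_firstReturn hcons h.measurableSet_base] with x hx
      exact indicator_occupationSet_succ h n k _ hx
    have hi1 := (hu.indicator hφm).indicator (hpre n)
    have hi2 : ∀ j m, Integrable ((returnMap f Y ⁻¹' D (Function.update n j (n j - (m + 1)))).indicator
        ((excursionSet f Y (A j) (m + 1)).indicator (ι u))) (μ.restrict Y) := fun j m =>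
      (hu.indicator (measurableSet_excursionSet hf.measurable h j (m + 1))).indicator (hpre _)
    have h2 := iterate_transfer_add hF hi1 (integrable_finsetSum Finset.univ fun j _ =>
      integrable_finsetSum (Finset.range (n j)) fun m _ => hi2 j m) (k + 1)
    have h3 := iterate_transfer_sum hF Finset.univ (fun j _ =>
      integrable_finsetSum (Finset.range (n j)) fun m _ => hi2 j m) (k + 1)
    have h4 : ∀ j, _ := fun j =>
      iterate_transfer_sum hF (Finset.range (n j)) (fun m _ => hi2 j m) (k + 1)
    have h5 := hstep n R₀ _ hφm (hR₀ u)
    have h6 : ∀ j m, _ := fun j m => hstep (Function.update n j (n j - (m + 1))) (R j m) _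
      (measurableSet_excursionSet hf.measurable h j (m + 1)) (hR j m u)
    have h7 : (ι (renewalCoeff R₀ R (k + 1) n u) : X → ℂ) =ᵐ[μ.restrict Y] fun x =>
        (ι ((renewalCoeff R₀ R k n * R₀) u) : X → ℂ) x + ∑ j, ∑ m ∈ Finset.range (n j),
          (ι ((renewalCoeff R₀ R k (Function.update n j (n j - (m + 1))) * R j m) u) : X → ℂ) x := by
      rw [renewalCoeff, add_apply, map_add, sum_apply, map_sum]
      refine (Lp.coeFn_add _ _).trans ?_
      refine EventuallyEq.add EventuallyEq.rfl ?_
      filter_upwards [Lp.coeFn_fun_finsetSum Finset.univ fun j => ι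
          ((∑ m ∈ Finset.range (n j),
            renewalCoeff R₀ R k (Function.update n j (n j - (m + 1))) * R j m) u),
        ae_all_iff.2 fun j => Lp.coeFn_fun_finsetSum (Finset.range (n j)) fun m => ι
          ((renewalCoeff R₀ R k (Function.update n j (n j - (m + 1))) * R j m) u)] with x hx1 hx2
      rw [hx1]
      refine Finset.sum_congr rfl fun j _ => ?_
      rw [sum_apply, map_sum]
      exact hx2 j
    refine h7.trans (EventuallyEq.trans ?_ (h1.trans h2).symm)
    filter_upwards [h3, ae_all_iff.2 h4, h5, ae_all_iff.2 fun j => ae_all_iff.2 (h6 j)] with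
      x hx3 hx4 hx5 hx6
    rw [hx3, hx5]
    congr 1
    refine Finset.sum_congr rfl fun j _ => ?_
    rw [hx4 j]
    exact Finset.sum_congr rfl fun m _ => (hx6 j m).symm

end Recursion

/-! ### Laws of excursion lengths -/

section CountableSums

variable {X : Type*} [MeasurableSpace X] {ν : Measure X}

lemma hasSum_setIntegral_fiber {E : Type*} [NormedAddCommGroup E] [NormedSpace ℝ E]
    {o : X → ℕ} (ho : Measurable o) {g : X → E}
    (hg : Integrable g ν) (n : ℕ) :
    HasSum (fun k => ∫ x in {x | o x = k + n}, g x ∂ν) (∫ x in {x | n ≤ o x}, g x ∂ν) := by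
  have hU : {x | n ≤ o x} = ⋃ k, {x | o x = k + n} := by
    ext x
    simp only [Set.mem_ofPred_eq, Set.mem_iUnion]
    exact ⟨fun h => ⟨o x - n, by omega⟩, fun ⟨k, hk⟩ => by omega⟩
  rw [hU]
  refine hasSum_integral_iUnion (fun k => ho (measurableSet_singleton (k + n))) ?_ hg.integrableOn
  intro i j hij
  refine Set.disjoint_left.2 fun x h1 h2 => hij ?_
  simp only [Set.mem_ofPred_eq] at h1 h2
  omega

/-- The law of a natural number valued function, as a measure on the real line. -/
def realLaw (ν : Measure X) (o : X → ℕ) : Measure ℝ := ν.map fun x => (o x : ℝ)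

variable {o : X → ℕ}

lemma isFiniteMeasure_realLaw [IsFiniteMeasure ν] : IsFiniteMeasure (realLaw ν o) := by
  unfold realLaw
  infer_instance

lemma ae_nonneg_realLaw (ho : Measurable o) : ∀ᵐ s ∂realLaw ν o, 0 ≤ s := by
  rw [realLaw, ae_map_iff (by fun_prop) measurableSet_Ici]
  exact Eventually.of_forall fun x => Nat.cast_nonneg _

lemma tailFun_realLaw (ho : Measurable o) (n : ℕ) :
    tailFun (realLaw ν o) n = ν.real {x | n ≤ o x} := by
  rw [tailFun, realLaw, map_measureReal_apply (by fun_prop) measurableSet_Ici]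
  congr 1
  ext x
  simp

/-- The condition `G 0 = 0` discards the fibre over zero, so only excursions that enter the ray are
counted. -/
lemma hasSum_integral_realLaw [IsFiniteMeasure ν] {E : Type*} [NormedAddCommGroup E]
    [NormedSpace ℝ E] [CompleteSpace E] (ho : Measurable o) {G : ℝ → E}
    (hG : StronglyMeasurable G) (hG0 : G 0 = 0) {C : ℝ} (hb : ∀ s, ‖G s‖ ≤ C) :
    HasSum (fun k : ℕ => ν.real {x | o x = k + 1} • G (k + 1)) (∫ s, G s ∂realLaw ν o) := by
  have ho' : Measurable fun x => (o x : ℝ) := by fun_prop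
  have hint : Integrable (fun x => G (o x)) ν :=
    Integrable.of_bound (hG.comp_measurable ho').aestronglyMeasurable C
      (Eventually.of_forall fun x => hb _)
  have h := hasSum_setIntegral_fiber ho hint 1
  rw [realLaw, integral_map ho'.aemeasurable hG.aestronglyMeasurable]
  have e : ∫ x in {x | 1 ≤ o x}, G (o x) ∂ν = ∫ x, G (o x) ∂ν := by
    refine setIntegral_eq_integral_of_forall_compl_eq_zero fun x hx => ?_
    have : o x = 0 := by
      simp only [Set.mem_ofPred_eq] at hx
      omega
    rw [this, Nat.cast_zero, hG0]
  rw [e] at h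
  convert! h using 2 with k
  have hk : MeasurableSet {x | o x = k + 1} := ho (measurableSet_singleton (k + 1))
  rw [setIntegral_congr_fun (g := fun _ => G (k + 1)) hk
    (fun x (hx : o x = k + 1) => by simp only [hx, Nat.cast_add, Nat.cast_one]), setIntegral_const]

end CountableSums

/-! ### Return times, integration functionals and the operator R(1) -/

section RenewalOperators

variable {X : Type*} [MeasurableSpace X] {d : ℕ} {f : X → X} {μ : Measure X} {Y : Set X}
  {A : Fin d → Set X}

/-- At most one ray is visited, for all but the last step of the excursion, and the other summands
vanish. -/
lemma DynamicalSeparation.sum_excursion (h : DynamicalSeparation f μ Y A) {M : Type*}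
    [AddCommMonoid M] {H : ℕ → M} (hH : H 0 = 0) {x : X} (hx : 1 ≤ firstReturn f Y x) :
    ∑ j, H (excursion f Y (A j) x) = H (firstReturn f Y x - 1) := by
  obtain ⟨p, hp⟩ : ∃ p, firstReturn f Y x = p + 1 := ⟨_, (Nat.sub_add_cancel hx).symm⟩
  cases p with
  | zero => simp [h.excursion_eq_zero hp, hp, hH]
  | succ p =>
    obtain ⟨j₀, hj₀, hne⟩ := h.exists_excursion hp
    rw [Finset.sum_eq_single j₀ (fun i _ hi => by rw [hne i hi, hH])
      (fun hj => absurd (Finset.mem_univ _) hj), hj₀, hp]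
    rfl

/-- A return time exceeds the occupation time by one, the final step in Y. This ties the sequence
b_n to the tails of the excursions. -/
lemma measureReal_le_firstReturn (hcons : Conservative f μ) (hf : Measurable f)
    (h : DynamicalSeparation f μ Y A) (n : ℕ) :
    μ.real (Y ∩ {x | n + 2 ≤ firstReturn f Y x}) =
      ∑ j, tailFun (realLaw (μ.restrict Y) (excursion f Y (A j))) (n + 1 : ℕ) := by
  have := h.isProbabilityMeasure
  have hm := fun j => measurable_excursion hf h.measurableSet_base (h.measurableSet_ray j)
  have hφ := measurable_firstReturn hf h.measurableSet_base
  have hφm : MeasurableSet {x | n + 2 ≤ firstReturn f Y x} := measurableSet_le measurable_const hφ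
  have hem : ∀ j, MeasurableSet {x | n + 1 ≤ excursion f Y (A j) x} := fun j =>
    measurableSet_le measurable_const (hm j)
  simp_rw [fun j => tailFun_realLaw (ν := μ.restrict Y) (hm j) (n + 1)]
  rw [Set.inter_comm, ← measureReal_restrict_apply hφm, ← integral_indicator_one hφm]
  simp_rw [← fun j => integral_indicator_one (μ := μ.restrict Y) (hem j)]
  have hint : ∀ j, Integrable ({x | n + 1 ≤ excursion f Y (A j) x}.indicator (1 : X → ℝ))
      (μ.restrict Y) := fun j => (integrable_const (1 : ℝ)).indicator (hem j)
  rw [← integral_finsetSum _ fun j _ => hint j]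
  refine integral_congr_ae ?_
  filter_upwards [ae_one_le_firstReturn hcons h.measurableSet_base] with x hx
  have := h.sum_excursion (H := fun p => if n + 1 ≤ p then (1 : ℝ) else 0) (by simp) hx
  simp only [Set.indicator_apply, Set.mem_ofPred_eq, Pi.one_apply]
  rw [this]
  congr 1
  rw [eq_iff_iff]
  omega

lemma integral_eq_add_sum_setIntegral (hcons : Conservative f μ) (hf : Measurable f)
    (h : DynamicalSeparation f μ Y A) {g : X → ℂ} (hg : Integrable g (μ.restrict Y)) :
    ∫ x in Y, g x ∂μ = (∫ x in {x | firstReturn f Y x = 1}, g x ∂μ.restrict Y) +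
      ∑ j, ∫ x in {x | 1 ≤ excursion f Y (A j) x}, g x ∂μ.restrict Y := by
  have hm := fun j => measurable_excursion hf h.measurableSet_base (h.measurableSet_ray j)
  have hφ := measurable_firstReturn hf h.measurableSet_base
  have hφm : MeasurableSet {x | firstReturn f Y x = 1} := hφ (measurableSet_singleton 1)
  have hem : ∀ j, MeasurableSet {x | 1 ≤ excursion f Y (A j) x} := fun j =>
    measurableSet_le measurable_const (hm j)
  rw [← integral_indicator hφm]
  simp_rw [← fun j => integral_indicator (μ := μ.restrict Y) (f := g) (hem j)]
  rw [← integral_finsetSum _ fun j _ => hg.indicator (hem j),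
    ← integral_add (hg.indicator hφm) (integrable_finsetSum _ fun j _ => hg.indicator (hem j))]
  refine integral_congr_ae ?_
  filter_upwards [ae_one_le_firstReturn hcons h.measurableSet_base] with x hx
  have := h.sum_excursion (H := fun p => if 1 ≤ p then g x else 0) (by simp) hx
  simp only [Set.indicator_apply, Set.mem_ofPred_eq]
  rw [this]
  by_cases h1 : firstReturn f Y x = 1
  · simp [h1]
  · rw [if_neg h1, if_pos (by omega), zero_add]

variable {B : Type*} [NormedAddCommGroup B] [NormedSpace ℂ B]
  {ι : B →ₗ[ℂ] Lp ℂ ∞ (μ.restrict Y)}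

lemma induces_inducedOp {ν : Measure X} {ι : B →ₗ[ℂ] Lp ℂ ∞ ν} {T : (X → ℂ) → X → ℂ}
    (h : ∃ S, Induces ι T S) : Induces ι T (inducedOp ι T) := by
  rw [inducedOp, dif_pos h]
  exact h.choose_spec

/-- Integration over `s`, as a continuous functional. -/
def setMean {ν : Measure X} [IsProbabilityMeasure ν] (ι : B →ₗ[ℂ] Lp ℂ ∞ ν)
    (hι : ∀ u, ‖ι u‖ ≤ ‖u‖) (s : Set X) : B →L[ℂ] ℂ :=
  LinearMap.mkContinuous
    { toFun := fun u => ∫ x in s, ι u x ∂ν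
      map_add' := fun u v => by
        rw [map_add, ← integral_add (integrable_coe_Lp_top _).integrableOn
          (integrable_coe_Lp_top _).integrableOn]
        exact integral_congr_ae (ae_restrict_of_ae (Lp.coeFn_add _ _))
      map_smul' := fun c u => by
        rw [map_smul, RingHom.id_apply, smul_eq_mul, ← integral_const_mul]
        exact integral_congr_ae (ae_restrict_of_ae (Lp.coeFn_smul _ _)) } 1 fun u => by
    rw [one_mul]
    refine le_trans ?_ (hι u)
    have hb : ∀ᵐ x ∂ν.restrict s, ‖ι u x‖ ≤ ‖ι u‖ := by
      refine ae_restrict_of_ae ?_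
      have h := ae_le_eLpNormEssSup (f := ι u) (μ := ν)
      filter_upwards [h] with x hx
      rw [Lp.norm_def, eLpNorm_exponent_top]
      have hfin : eLpNormEssSup (ι u) ν ≠ ∞ := by
        have := (Lp.memLp (ι u)).eLpNorm_ne_top
        rwa [eLpNorm_exponent_top] at this
      rw [← toReal_enorm]
      exact ENNReal.toReal_mono hfin hx
    refine (norm_integral_le_of_norm_le_const hb).trans ?_
    exact mul_le_of_le_one_right (norm_nonneg _) (by simp)

lemma setMean_apply {ν : Measure X} [IsProbabilityMeasure ν] {ι : B →ₗ[ℂ] Lp ℂ ∞ ν}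
    (hι : ∀ u, ‖ι u‖ ≤ ‖u‖) (s : Set X) (u : B) : setMean ι hι s u = ∫ x in s, ι u x ∂ν := rfl

lemma setMean_apply_of_induces [SigmaFinite μ] [IsProbabilityMeasure (μ.restrict Y)]
    (hf : MeasurePreserving f μ μ) (hY : MeasurableSet Y) (hι : ∀ u, ‖ι u‖ ≤ ‖u‖)
    {w : Set X} (hw : MeasurableSet w) {S : B →L[ℂ] B}
    (hS : Induces ι (fun u => returnTransfer f μ Y (w.indicator u)) S) {s : Set X}
    (hs : MeasurableSet s) (u : B) :
    setMean ι hι s (S u) =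
      ∫ x in w, (returnMap f Y ⁻¹' s).indicator (ι u) x ∂μ.restrict Y := by
  have hF := quasiMeasurePreserving_returnMap hf hY
  have hu : Integrable (ι u) (μ.restrict Y) := integrable_coe_Lp_top _
  rw [setMean_apply, integral_congr_ae (ae_restrict_of_ae (hS u))]
  simp only [returnTransfer]
  rw [setIntegral_transfer _ hF (hu.indicator hw) hs, setIntegral_indicator hw,
    setIntegral_indicator (hF.measurable hs), Set.inter_comm]

/-- The series `R₀ + ∑_j ∑_n z_j^(n+1) R_{j,n}`. -/
def powerSum {B : Type*} [NormedAddCommGroup B] [NormedSpace ℂ B] {d : ℕ}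
    (R₀ : B →L[ℂ] B) (R : Fin d → ℕ → B →L[ℂ] B) (z : Fin d → ℂ) : B →L[ℂ] B :=
  R₀ + ∑ j, ∑' n : ℕ, z j ^ (n + 1) • R j n

lemma summable_pow_smul {B : Type*} [NormedAddCommGroup B] [NormedSpace ℂ B] [CompleteSpace B]
    {R : ℕ → B →L[ℂ] B} (hR : Summable fun n => ‖R n‖) {z : ℂ} (hz : ‖z‖ ≤ 1) :
    Summable fun n : ℕ => z ^ (n + 1) • R n := by
  refine Summable.of_norm_bounded hR fun n => ?_
  rw [norm_smul, norm_pow]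
  exact mul_le_of_le_one_left (norm_nonneg _) (pow_le_one₀ (norm_nonneg _) hz)

variable [CompleteSpace B]

/-- Both sides are tested by integration over measurable sets. That functional is continuous on B
and commutes with the series, and countable additivity over the values of the excursions gives the
same sum. -/
lemma induces_powerSum_one [SigmaFinite μ] (hcons : Conservative f μ)
    (hf : MeasurePreserving f μ μ)
    (h : DynamicalSeparation f μ Y A) (hι : ∀ u, ‖ι u‖ ≤ ‖u‖)
    {R₀ : B →L[ℂ] B} {R : Fin d → ℕ → B →L[ℂ] B}
    (hR₀ : Induces ι (renewalZero f μ Y) R₀)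
    (hR : ∀ j m, Induces ι (renewal f μ Y (A j) (m + 1)) (R j m))
    (hsum : ∀ j, Summable fun m => ‖R j m‖) :
    Induces ι (returnTransfer f μ Y) (powerSum R₀ R 1) := by
  intro u
  have := h.isProbabilityMeasure
  have hF := quasiMeasurePreserving_returnMap hf h.measurableSet_base
  have hu : Integrable (ι u) (μ.restrict Y) := integrable_coe_Lp_top _
  symm
  refine transfer_ae_eq hF hu (integrable_coe_Lp_top _) fun s hs => ?_
  have hφm : MeasurableSet {x | firstReturn f Y x = 1} :=
    measurable_firstReturn hf.measurable h.measurableSet_base (measurableSet_singleton 1)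
  have hFs := hF.measurable hs
  have hg := hu.indicator hFs
  rw [← integral_indicator hFs, integral_eq_add_sum_setIntegral hcons hf.measurable h hg,
    ← setMean_apply hι]
  have e1 : powerSum R₀ R 1 u = R₀ u + ∑ j, ∑' m, R j m u := by
    simp only [powerSum, Pi.one_apply, one_pow, one_smul]
    rw [add_apply, sum_apply]
    congr 1
    refine Finset.sum_congr rfl fun j _ => ?_
    exact (ContinuousLinearMap.apply ℂ B u).map_tsum (hsum j).of_norm
  have hsu : ∀ j, Summable fun m => R j m u := fun j =>
    (ContinuousLinearMap.apply ℂ B u).summable (hsum j).of_norm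
  rw [e1, map_add, map_sum]
  congr 1
  · exact setMean_apply_of_induces hf h.measurableSet_base hι hφm hR₀ hs u
  · refine Finset.sum_congr rfl fun j _ => ?_
    rw [(setMean ι hι s).map_tsum (hsu j),
      ← (hasSum_setIntegral_fiber (measurable_excursion hf.measurable h.measurableSet_base
        (h.measurableSet_ray j)) hg 1).tsum_eq]
    exact tsum_congr fun m => setMean_apply_of_induces hf h.measurableSet_base hι
      (measurableSet_excursionSet hf.measurable h j (m + 1)) (hR j m) hs u

lemma excursionProb_eq (hf : Measurable f) (h : DynamicalSeparation f μ Y A) (j : Fin d) (n : ℕ) :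
    excursionProb f μ Y (A j) n = (μ.restrict Y).real {x | excursion f Y (A j) x = n} := by
  have hm : MeasurableSet {x | excursion f Y (A j) x = n} := measurableSet_excursionSet hf h j n
  rw [measureReal_restrict_apply hm, Set.inter_comm]
  rfl

lemma tsum_excursionProb (hf : Measurable f) (h : DynamicalSeparation f μ Y A) (j : Fin d)
    (n : ℕ) : ∑' k, excursionProb f μ Y (A j) (n + k) =
      tailFun (realLaw (μ.restrict Y) (excursion f Y (A j))) n := by
  have := h.isProbabilityMeasure
  have hm := measurable_excursion hf h.measurableSet_base (h.measurableSet_ray j)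
  have hs := hasSum_setIntegral_fiber (ν := μ.restrict Y) hm (integrable_const (1 : ℝ)) n
  simp only [setIntegral_const, smul_eq_mul, mul_one] at hs
  rw [tailFun_realLaw hm, ← hs.tsum_eq]
  exact tsum_congr fun k => by rw [excursionProb_eq hf h, add_comm]

end RenewalOperators

/-! ### The renewal operators on the torus -/

section CircleSum

variable {B : Type*} [NormedAddCommGroup B] [NormedSpace ℂ B] {d : ℕ}
  {R₀ : B →L[ℂ] B} {R : Fin d → ℕ → B →L[ℂ] B}

/-- The series `powerSum` at the point `(e^{iθ_1}, …, e^{iθ_d})`. -/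
def circleSum (R₀ : B →L[ℂ] B) (R : Fin d → ℕ → B →L[ℂ] B) (θ : Fin d → ℝ) : B →L[ℂ] B :=
  powerSum R₀ R fun j => Complex.exp (θ j * Complex.I)

lemma circleSum_zero : circleSum R₀ R 0 = powerSum R₀ R 1 := by
  unfold circleSum
  congr 1
  ext j
  simp

lemma norm_exp_pow_sub_one_le (t : ℝ) (n : ℕ) :
    ‖1 - Complex.exp (t * Complex.I) ^ n‖ ≤ 2 := by
  refine (norm_sub_le _ _).trans ?_
  rw [norm_pow, Complex.norm_exp_ofReal_mul_I, one_pow, norm_one]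
  norm_num

variable [CompleteSpace B]

lemma circleSum_zero_sub (hR : ∀ j, Summable fun n => ‖R j n‖) (θ : Fin d → ℝ) :
    circleSum R₀ R 0 - circleSum R₀ R θ =
      ∑ j, ∑' n : ℕ, (1 - Complex.exp (θ j * Complex.I) ^ (n + 1)) • R j n := by
  simp only [circleSum, powerSum, add_sub_add_left_eq_sub]
  rw [← Finset.sum_sub_distrib]
  refine Finset.sum_congr rfl fun j _ => ?_
  rw [← (summable_pow_smul (hR j) (Complex.norm_exp_ofReal_mul_I _).le).tsum_sub
    (summable_pow_smul (hR j) (Complex.norm_exp_ofReal_mul_I _).le)]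
  refine tsum_congr fun n => ?_
  rw [sub_smul]
  simp

lemma summable_one_sub_smul (hR : ∀ j, Summable fun n => ‖R j n‖) (θ : Fin d → ℝ) (j : Fin d) :
    Summable fun n : ℕ => (1 - Complex.exp (θ j * Complex.I) ^ (n + 1)) • R j n := by
  refine Summable.of_norm_bounded ((hR j).mul_left 2) fun n => ?_
  rw [norm_smul]
  exact mul_le_mul_of_nonneg_right (norm_exp_pow_sub_one_le _ _) (norm_nonneg _)

lemma continuous_circleSum (hR : ∀ j, Summable fun n => ‖R j n‖) :
    Continuous (circleSum R₀ R) := by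
  unfold circleSum powerSum
  refine continuous_const.add (continuous_finsetSum _ fun j _ => ?_)
  refine continuous_tsum (fun n => by fun_prop) (hR j) fun n θ => ?_
  rw [norm_smul, norm_pow, Complex.norm_exp_ofReal_mul_I, one_pow, one_mul]

end CircleSum

/-- A renewal sequence of operators with regularly varying tails: `e` spans the fixed vectors of
`R(1)`, which preserves the functional `φ` and has a spectral gap; `R(z)` has spectral radius less
than one at the other points of the torus; and the behaviour of `R(z)` near `z = 1` is governed by
the measures `ν j`. -/
structure IsRenewalFamily {B : Type*} [NormedAddCommGroup B] [NormedSpace ℂ B] {d : ℕ}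
    (R₀ : B →L[ℂ] B) (R : Fin d → ℕ → B →L[ℂ] B) (e : B) (φ : B →L[ℂ] ℂ)
    (ν : Fin d → Measure ℝ) (α : ℝ) : Prop where
  summable : ∀ j, Summable fun n => ‖R j n‖
  apply_vector : φ e = 1
  map_vector : circleSum R₀ R 0 e = e
  apply_map : ∀ u, φ (circleSum R₀ R 0 u) = φ u
  gap : spectralRadius ℂ (circleSum R₀ R 0 - φ.smulRight e) < 1
  aperiodic : ∀ z : Fin d → ℂ, (∀ j, ‖z j‖ = 1) → z ≠ 1 → spectralRadius ℂ (powerSum R₀ R z) < 1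
  finite : ∀ j, IsFiniteMeasure (ν j)
  nonneg : ∀ j, ∀ᵐ s ∂ν j, 0 ≤ s
  tail : ∀ j, IsRegVarTail (tailFun (ν j)) α
  mean : ∀ θ : Fin d → ℝ, 1 - φ (circleSum R₀ R θ e) =
    ∑ j, ∫ s, (1 - Complex.exp ((θ j * s : ℝ) * Complex.I)) ∂ν j
  norm_sub_le : ∃ C, 0 < C ∧ ∀ θ : Fin d → ℝ, ‖circleSum R₀ R θ - circleSum R₀ R 0‖ ≤
    C * ∑ j, ∫ s, ‖1 - Complex.exp ((θ j * s : ℝ) * Complex.I)‖ ∂ν j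

/-! ### Regularly varying tails from asymptotics along the integers -/

section RegularlyVaryingTails

lemma IsRegVarTail.of_tendsto_div {G : ℝ → ℝ} {α c : ℝ} {ℓ : ℝ≥0 → ℝ} (hG : Antitone G)
    (hc : 0 < c) (hℓ : IsSlowlyVarying ℓ)
    (h : Tendsto (fun n : ℕ => G n / ((n : ℝ) ^ (-α) * ℓ n)) atTop (𝓝 c)) :
    IsRegVarTail G α := by
  -- Positivity at some large integer spreads to the left by monotonicity.
  have hpos : ∀ x, 0 < G x := by
    intro x
    have h1 := h.eventually_const_lt hc
    obtain ⟨n, h1, h2, h3⟩ := (h1.and ((eventually_gt_atTop 0).and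
      (tendsto_natCast_atTop_atTop.eventually_ge_atTop x))).exists
    have hn : (0 : ℝ) < n := by exact_mod_cast h2
    have := (div_pos_iff_of_pos_right (mul_pos (Real.rpow_pos_of_pos hn _) (hℓ.pos n))).1 h1
    exact this.trans_le (hG h3)
  refine IsRegVarTail.of_nat hG hpos fun p hp => ?_
  have hp' : (0 : ℝ) < p := by exact_mod_cast hp
  have hmul : Tendsto (fun n : ℕ => p * n) atTop atTop := tendsto_id.const_mul_atTop' hp
  have h1 := (h.comp hmul).div h hc.ne'
  have h2 := (hℓ.tendsto p (by exact_mod_cast hp)).comp (tendsto_natCast_atTop_atTop (R := ℝ≥0))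
  have h3 := (h1.mul h2).mul_const ((p : ℝ) ^ (-α))
  rw [div_self hc.ne', one_mul, one_mul] at h3
  refine h3.congr' ?_
  filter_upwards [eventually_gt_atTop 0] with n hn
  have hn' : (0 : ℝ) < n := by exact_mod_cast hn
  have e1 := (Real.rpow_pos_of_pos hn' (-α)).ne'
  have e2 := (hℓ.pos n).ne'
  have e3 := (hℓ.pos (p * n)).ne'
  have e4 := (hpos n).ne'
  have e5 := (Real.rpow_pos_of_pos hp' (-α)).ne'
  simp only [Function.comp_apply, Pi.div_apply]
  push_cast
  rw [Real.mul_rpow hp'.le hn'.le]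
  field_simp

/-- A fixed shift is eventually smaller than any dilation by x < 1. This absorbs the off-by-one
effects in the scaling sequence. -/
lemma IsRegVarTail.tendsto_div_sub {G : ℝ → ℝ} {α : ℝ} (hG : IsRegVarTail G α) (c : ℝ) (hc : 0 ≤ c) :
    Tendsto (fun a => G (a - c) / G a) atTop (𝓝 1) := by
  refine tendsto_order.2 ⟨fun b hb => ?_, fun b hb => ?_⟩
  · filter_upwards with a
    refine hb.trans_le ?_
    rw [one_le_div (hG.pos _)]
    exact hG.antitone (by linarith)
  · have hcont : Tendsto (fun x : ℝ => x ^ (-α)) (𝓝[<] 1) (𝓝 1) := by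
      have : ContinuousAt (fun x : ℝ => x ^ (-α)) 1 :=
        Real.continuousAt_rpow_const _ _ (Or.inl one_ne_zero)
      have h := this.tendsto
      rw [Real.one_rpow] at h
      exact h.mono_left nhdsWithin_le_nhds
    obtain ⟨x, hxb, hx1, hx0⟩ := ((hcont.eventually_lt_const hb).and
      (eventually_mem_nhdsWithin.and (nhdsWithin_le_nhds (eventually_gt_nhds one_pos)))).exists
    simp only [Set.mem_Iio] at hx1
    filter_upwards [(hG.tendsto x hx0).eventually_lt_const hxb,
      eventually_ge_atTop (c / (1 - x))] with a h1 h2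
    refine lt_of_le_of_lt ?_ h1
    refine div_le_div_of_nonneg_right (hG.antitone ?_) (hG.pos _).le
    rw [div_le_iff₀ (by linarith)] at h2
    linarith

end RegularlyVaryingTails

/-! ### From the dynamical assumptions to an abstract renewal family -/

section RenewalFamily

variable {X : Type*} [MeasurableSpace X] {d : ℕ} {f : X → X} {μ : Measure X} {Y : Set X}
  {A : Fin d → Set X} {α : ℝ} {β : Fin d → ℝ} {ℓ : ℝ≥0 → ℝ}

lemma RegularVariation.tendsto_tail_div (hreg : RegularVariation f μ Y A α β ℓ)
    (hf : Measurable f) (h : DynamicalSeparation f μ Y A) (j : Fin d) :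
    Tendsto (fun n : ℕ => tailFun (realLaw (μ.restrict Y) (excursion f Y (A j))) n /
      ((n : ℝ) ^ (-α) * ℓ n)) atTop (𝓝 (β j)) := by
  have h1 := hreg.tail j
  simp_rw [tsum_excursionProb hf h j] at h1
  have hne : ∀ᶠ n : ℕ in atTop, β j * (n : ℝ) ^ (-α) * ℓ n ≠ 0 := by
    filter_upwards [eventually_gt_atTop 0] with n hn
    have hn' : (0 : ℝ) < n := by exact_mod_cast hn
    exact (mul_pos (mul_pos (hreg.weight_mem j).1 (Real.rpow_pos_of_pos hn' _))
      (hreg.slowly.pos _)).ne'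
  have h2 := ((isEquivalent_iff_tendsto_one hne).1 h1).const_mul (β j)
  rw [mul_one] at h2
  refine h2.congr' ?_
  filter_upwards [hne] with n hn
  have h3 := (hreg.weight_mem j).1.ne'
  simp only [Pi.div_apply]
  rw [mul_assoc, ← mul_div_assoc, mul_div_mul_left _ _ h3]

lemma RegularVariation.isRegVarTail (hreg : RegularVariation f μ Y A α β ℓ)
    (hf : Measurable f) (h : DynamicalSeparation f μ Y A) (j : Fin d) :
    IsRegVarTail (tailFun (realLaw (μ.restrict Y) (excursion f Y (A j)))) α := by
  have := h.isProbabilityMeasure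
  have := isFiniteMeasure_realLaw (ν := μ.restrict Y) (o := excursion f Y (A j))
  exact .of_tendsto_div antitone_tailFun (hreg.weight_mem j).1 hreg.slowly
    (hreg.tendsto_tail_div hf h j)

variable {B : Type*} [NormedAddCommGroup B] [NormedSpace ℂ B]
  {ι : B →ₗ[ℂ] Lp ℂ ∞ (μ.restrict Y)}

lemma induces_meanValue [IsProbabilityMeasure (μ.restrict Y)] (hι : ∀ u, ‖ι u‖ ≤ ‖u‖) {e : B}
    (he : ι e =ᵐ[μ.restrict Y] fun _ => 1) :
    Induces ι (meanValue μ Y) ((setMean ι hι Set.univ).smulRight e) := by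
  intro u
  have h1 : (setMean ι hι Set.univ).smulRight e u = (∫ x in Y, ι u x ∂μ) • e := by
    rw [ContinuousLinearMap.smulRight_apply, setMean_apply, Measure.restrict_univ]
  rw [h1, map_smul]
  filter_upwards [Lp.coeFn_smul (∫ x in Y, ι u x ∂μ) (ι e), he] with x h2 h3
  rw [h2, Pi.smul_apply, h3, smul_eq_mul, mul_one]
  rfl

lemma AperiodicRenewal.summable [SigmaFinite μ] (hape : AperiodicRenewal f μ Y A ι)
    (hf : Measurable f) (h : DynamicalSeparation f μ Y A) (j : Fin d) :
    Summable fun m => ‖inducedOp ι (renewal f μ Y (A j) (m + 1))‖ := by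
  have := h.isProbabilityMeasure
  obtain ⟨C, hC, hb⟩ := hape.norm_bound
  have hs := (hasSum_setIntegral_fiber (ν := μ.restrict Y)
    (measurable_excursion hf h.measurableSet_base (h.measurableSet_ray j))
    (integrable_const (1 : ℝ)) 1).summable
  simp only [setIntegral_const, smul_eq_mul, mul_one] at hs
  refine Summable.of_nonneg_of_le (fun _ => norm_nonneg _) (fun m => ?_) (hs.mul_left C)
  rw [← excursionProb_eq hf h]
  exact hb j (m + 1) (by omega)

variable [CompleteSpace B]

/-- The constant 1 is fixed because F preserves the measure on Y, and integration is invariant by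
duality. As R_{j,n}1 has integral r_{j,n}, the mean of R(e^{iθ})1 is expressed through the
one-dimensional excursion laws, one ray at a time. -/
theorem AperiodicRenewal.isRenewalFamily [SigmaFinite μ] (hcons : Conservative f μ)
    (hf : MeasurePreserving f μ μ) (h : DynamicalSeparation f μ Y A)
    (hreg : RegularVariation f μ Y A α β ℓ) (hape : AperiodicRenewal f μ Y A ι)
    [IsProbabilityMeasure (μ.restrict Y)]
    {R₀ : B →L[ℂ] B} {R : Fin d → ℕ → B →L[ℂ] B} {e : B}
    (hR₀ : Induces ι (renewalZero f μ Y) R₀)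
    (hR : ∀ j m, Induces ι (renewal f μ Y (A j) (m + 1)) (R j m))
    (hsum : ∀ j, Summable fun m => ‖R j m‖) {C : ℝ} (hC : 0 < C)
    (hb : ∀ j m, ‖R j m‖ ≤ C * (μ.restrict Y).real {x | excursion f Y (A j) x = m + 1})
    (haper : ∀ z : Fin d → ℂ, (∀ j, ‖z j‖ = 1) → z ≠ 1 → spectralRadius ℂ (powerSum R₀ R z) < 1)
    (he : ι e =ᵐ[μ.restrict Y] fun _ => 1) :
    IsRenewalFamily R₀ R e (setMean ι hape.norm_le Set.univ)
      (fun j => realLaw (μ.restrict Y) (excursion f Y (A j))) α := by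
  have hm := fun j => measurable_excursion hf.measurable h.measurableSet_base
    (h.measurableSet_ray j)
  have hfin := fun j => isFiniteMeasure_realLaw (ν := μ.restrict Y) (o := excursion f Y (A j))
  have hF := quasiMeasurePreserving_returnMap hf h.measurableSet_base
  have hfinY : μ Y ≠ ∞ := by rw [h.measure_base]; exact ENNReal.one_ne_top
  have hFm := measurePreserving_returnMap hcons hf h.measurableSet_base hfinY
  have hone := induces_powerSum_one hcons hf h hape.norm_le hR₀ hR hsum
  rw [← circleSum_zero] at hone
  have hS := inducedOp_eq hape.injective hone
  have hφe : setMean ι hape.norm_le Set.univ e = 1 := by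
    rw [setMean_apply, Measure.restrict_univ, integral_congr_ae he]
    simp
  have hSe : circleSum R₀ R 0 e = e := by
    refine hape.injective (Lp.ext ((hone e).trans ?_))
    rw [returnTransfer]
    refine transfer_ae_eq hF (integrable_coe_Lp_top _) (integrable_coe_Lp_top _) fun s hs => ?_
    rw [integral_congr_ae (ae_restrict_of_ae he), integral_congr_ae (ae_restrict_of_ae he)]
    simp only [integral_const, measureReal_restrict_apply_univ]
    rw [hFm.measureReal_preimage hs.nullMeasurableSet]
  have hφS : ∀ u, setMean ι hape.norm_le Set.univ (circleSum R₀ R 0 u) =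
      setMean ι hape.norm_le Set.univ u := by
    intro u
    rw [setMean_apply, setMean_apply, integral_congr_ae (ae_restrict_of_ae (hone u))]
    simp only [returnTransfer]
    rw [setIntegral_transfer _ hF (integrable_coe_Lp_top _) MeasurableSet.univ, Set.preimage_univ]
  have hφR : ∀ j m, setMean ι hape.norm_le Set.univ (R j m e) =
      ((μ.restrict Y).real {x | excursion f Y (A j) x = m + 1} : ℝ) := by
    intro j m
    rw [setMean_apply_of_induces hf h.measurableSet_base hape.norm_le
      (measurableSet_excursionSet hf.measurable h j (m + 1)) (hR j m) MeasurableSet.univ]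
    simp only [Set.preimage_univ, Set.indicator_univ]
    rw [integral_congr_ae (ae_restrict_of_ae he)]
    simp only [integral_const, measureReal_restrict_apply_univ, Complex.real_smul, mul_one]
    rfl
  have hnt : Nontrivial B := ⟨⟨e, 0, fun h0 => by simp [h0] at hφe⟩⟩
  have hgap : spectralRadius ℂ (circleSum R₀ R 0 -
      (setMean ι hape.norm_le Set.univ).smulRight e) < 1 := by
    obtain ⟨K, -, hK, hspec⟩ := hape.spectral_gap
    have hsimple := hape.simple
    rw [hS] at hspec hsimple
    exact spectralRadius_sub_smulRight_lt_one hφe hSe hφS hsimple hK hspec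
  have hcast : ∀ (θ : ℝ) (k : ℕ), Complex.exp (((θ * ((k : ℝ) + 1) : ℝ) : ℂ) * Complex.I) =
      Complex.exp (θ * Complex.I) ^ (k + 1) := by
    intro θ k
    rw [← Complex.exp_nat_mul]
    congr 1
    push_cast
    ring
  have hG : ∀ θ : ℝ, Continuous fun s : ℝ => 1 - Complex.exp (((θ * s : ℝ) : ℂ) * Complex.I) :=
    fun θ => by fun_prop
  have hle : ∀ θ s : ℝ, ‖1 - Complex.exp (((θ * s : ℝ) : ℂ) * Complex.I)‖ ≤ 2 := by
    intro θ s
    have := norm_exp_pow_sub_one_le (θ * s) 1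
    rwa [pow_one] at this
  refine ⟨hsum, hφe, hSe, hφS, hgap, haper, hfin, fun j => ae_nonneg_realLaw (hm j),
    hreg.isRegVarTail hf.measurable h, fun θ => ?_, C, hC, fun θ => ?_⟩
  · have h1 : 1 - setMean ι hape.norm_le Set.univ (circleSum R₀ R θ e) =
        setMean ι hape.norm_le Set.univ ((circleSum R₀ R 0 - circleSum R₀ R θ) e) := by
      rw [sub_apply, map_sub, hSe, hφe]
    rw [h1, circleSum_zero_sub hsum, sum_apply, map_sum]
    refine Finset.sum_congr rfl fun j _ => ?_
    have h2 := (summable_one_sub_smul hsum θ j).hasSum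
    have h3 := (h2.mapL (ContinuousLinearMap.apply ℂ B e)).mapL
      (setMean ι hape.norm_le Set.univ)
    have h4 := hasSum_integral_realLaw (ν := μ.restrict Y) (hm j) (hG (θ j)).stronglyMeasurable
      (by simp) (hle (θ j))
    refine h3.unique ?_
    convert! h4 using 2 with k
    rw [ContinuousLinearMap.apply_apply, smul_apply, map_smul, hφR, hcast, Complex.real_smul,
      smul_eq_mul, mul_comm]
  · rw [norm_sub_rev, circleSum_zero_sub hsum, Finset.mul_sum]
    refine (norm_sum_le _ _).trans (Finset.sum_le_sum fun j _ => ?_)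
    have h4 := (hasSum_integral_realLaw (ν := μ.restrict Y) (hm j)
      (hG (θ j)).norm.stronglyMeasurable (by simp) (C := 2)
      (fun s => by rw [norm_norm]; exact hle (θ j) s)).mul_left C
    refine tsum_of_norm_bounded h4 fun k => ?_
    rw [norm_smul, hcast, smul_eq_mul, ← mul_assoc, mul_comm]
    exact mul_le_mul_of_nonneg_right (hb j k) (norm_nonneg _)

theorem AperiodicRenewal.exists_isRenewalFamily [SigmaFinite μ] (hcons : Conservative f μ)
    (hf : MeasurePreserving f μ μ) (h : DynamicalSeparation f μ Y A)
    (hreg : RegularVariation f μ Y A α β ℓ) (hape : AperiodicRenewal f μ Y A ι) :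
    ∃ (R₀ : B →L[ℂ] B) (R : Fin d → ℕ → B →L[ℂ] B) (e : B) (φ : B →L[ℂ] ℂ),
      IsRenewalFamily R₀ R e φ
        (fun j => realLaw (μ.restrict Y) (excursion f Y (A j))) α ∧
      Induces ι (renewalZero f μ Y) R₀ ∧
      (∀ j m, Induces ι (renewal f μ Y (A j) (m + 1)) (R j m)) ∧
      Induces ι (meanValue μ Y) (φ.smulRight e) := by
  have hprob := h.isProbabilityMeasure
  obtain ⟨C, hC, hb⟩ := hape.norm_bound
  obtain ⟨e, he⟩ := hape.const_mem 1
  have hR₀ := induces_inducedOp hape.induces_zero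
  have hR := fun (j : Fin d) (m : ℕ) => induces_inducedOp (hape.induces j (m + 1) (by omega))
  refine ⟨_, _, e, _, hape.isRenewalFamily hcons hf h hreg hR₀ hR (hape.summable hf.measurable h)
    hC (fun j m => ?_) hape.aperiodic he, hR₀, hR, induces_meanValue hape.norm_le he⟩
  rw [← excursionProb_eq hf.measurable h]
  exact hb j (m + 1) (by omega)

end RenewalFamily

/-! ### The scaling sequence -/

section Scaling

lemma IsRegVarTail.tendsto_zero {G : ℝ → ℝ} {α : ℝ} (hG : IsRegVarTail G α) (h0 : 0 < α) :
    Tendsto G atTop (𝓝 0) := by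
  obtain ⟨C, a₀, hC, ha₀, h⟩ := hG.exists_le_rpow_mul (half_lt_self h0) (half_pos h0)
  have h1 : Tendsto (fun a : ℝ => C * (a₀ ^ (α / 2) * G a₀) * a ^ (-(α / 2))) atTop (𝓝 0) := by
    have := (tendsto_rpow_neg_atTop (half_pos h0)).const_mul (C * (a₀ ^ (α / 2) * G a₀))
    rwa [mul_zero] at this
  refine squeeze_zero' (Eventually.of_forall fun a => (hG.pos a).le) ?_ h1
  filter_upwards [eventually_ge_atTop a₀] with a ha
  have hapos : 0 < a := ha₀.trans_le ha
  rw [Real.rpow_neg hapos.le, ← div_eq_mul_inv, le_div_iff₀ (by positivity), mul_comm]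
  exact h a₀ le_rfl a ha

variable {H : ℝ → ℝ} {α g : ℝ} {b : ℕ → ℝ}

/-- By minimality b(a_k - 1) ≤ k < b(a_k), that is, k g H(a_k - 1) < 1 ≤ k g H(a_k - 2). The shifts
do not matter in the limit. -/
lemma IsRegVarTail.tendsto_sInf (hH : IsRegVarTail H α) (h0 : 0 < α) (hg : 0 < g)
    (hb : ∀ n : ℕ, b (n + 2) = 1 / (g * H (n + 1 : ℕ))) :
    Tendsto (fun k : ℕ => sInf {n : ℕ | 1 ≤ n ∧ (k : ℝ) < b n}) atTop atTop ∧
    Tendsto (fun k : ℕ => k * (g * H (sInf {n : ℕ | 1 ≤ n ∧ (k : ℝ) < b n} : ℕ))) atTop (𝓝 1) := by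
  have hgH : ∀ x, 0 < g * H x := fun x => mul_pos hg (hH.pos x)
  have hne : ∀ k : ℕ, {n : ℕ | 1 ≤ n ∧ (k : ℝ) < b n}.Nonempty := by
    intro k
    have h1 : Tendsto (fun n : ℕ => (k : ℝ) * (g * H (n + 1 : ℕ))) atTop (𝓝 (k * (g * 0))) :=
      (((hH.tendsto_zero h0).comp (tendsto_natCast_atTop_atTop.comp
        (tendsto_add_atTop_nat 1))).const_mul g).const_mul _
    rw [mul_zero, mul_zero] at h1
    obtain ⟨n, hn⟩ := (h1.eventually_lt_const one_pos).exists
    refine ⟨n + 2, by omega, ?_⟩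
    rwa [hb, lt_div_iff₀ (hgH _)]
  set a : ℕ → ℕ := fun k => sInf {n : ℕ | 1 ≤ n ∧ (k : ℝ) < b n} with ha
  have hmem : ∀ k, 1 ≤ a k ∧ (k : ℝ) < b (a k) := fun k => Nat.sInf_mem (hne k)
  have hlt : ∀ k n, 1 ≤ n → n < a k → b n ≤ k := fun k n h1 hn => by
    have := Nat.notMem_of_lt_sInf hn
    simp only [Set.mem_ofPred_eq, not_and, not_lt] at this
    exact this h1
  have htop : Tendsto a atTop atTop := by
    refine tendsto_atTop.2 fun N => ?_
    have h1 : ∀ᶠ k : ℕ in atTop, ∀ n ∈ Finset.range N, b n ≤ k := by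
      rw [Filter.eventually_all_finset]
      exact fun n _ => tendsto_natCast_atTop_atTop.eventually_ge_atTop _
    filter_upwards [h1] with k hk
    by_contra hN
    exact absurd (hk _ (Finset.mem_range.2 (not_le.1 hN))) (not_le.2 (hmem k).2)
  refine ⟨htop, ?_⟩
  have htopR : Tendsto (fun k => (a k : ℝ)) atTop atTop := tendsto_natCast_atTop_atTop.comp htop
  have h2 := ((hH.tendsto_div_sub 2 zero_le_two).comp htopR).inv₀ one_ne_zero
  rw [inv_one] at h2
  refine tendsto_of_tendsto_of_tendsto_of_le_of_le' h2 tendsto_const_nhds ?_ ?_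
  · filter_upwards [htop.eventually_ge_atTop 3] with k hk
    obtain ⟨m, hm⟩ : ∃ m, a k = m + 3 := ⟨a k - 3, by omega⟩
    have h3 := hlt k (m + 2) (by omega) (by omega)
    rw [hb, div_le_iff₀ (hgH _)] at h3
    simp only [Function.comp_apply, inv_div]
    rw [div_le_iff₀ (hH.pos _)]
    have h4 : ((a k : ℕ) : ℝ) - 2 = (m + 1 : ℕ) := by
      rw [hm]
      push_cast
      ring
    rw [h4]
    nlinarith [hH.pos (a k : ℕ)]
  · filter_upwards [htop.eventually_ge_atTop 3] with k hk
    obtain ⟨m, hm⟩ : ∃ m, a k = m + 2 := ⟨a k - 2, by omega⟩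
    have h3 := (hmem k).2
    rw [hm, hb, lt_div_iff₀ (hgH _)] at h3
    refine le_trans ?_ h3.le
    have : H (a k : ℕ) ≤ H (m + 1 : ℕ) := hH.antitone (by rw [hm]; push_cast; linarith)
    gcongr

end Scaling

/-! ### The scaling sequence of the dynamical system -/

section ScalingDynamics

variable {X : Type*} [MeasurableSpace X] {d : ℕ} {f : X → X} {μ : Measure X} {Y : Set X}
  {A : Fin d → Set X} {α : ℝ} {β : Fin d → ℝ} {ℓ : ℝ≥0 → ℝ}

/-- The excursion tails add up to the tail of the return time, and the weights sum to one, so ray j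
carries the asymptotic share β_j of the normalised tail. -/
theorem RegularVariation.tendsto_scaling (hreg : RegularVariation f μ Y A α β ℓ)
    (hcons : Conservative f μ) (hf : Measurable f) (h : DynamicalSeparation f μ Y A) :
    Tendsto (scaling f μ Y α) atTop atTop ∧
    ∀ j, Tendsto (fun k : ℕ => k * (Real.Gamma (1 - α) *
      tailFun (realLaw (μ.restrict Y) (excursion f Y (A j))) (scaling f μ Y α k))) atTop
        (𝓝 (β j)) := by
  have := h.isProbabilityMeasure
  have hfin := fun j => isFiniteMeasure_realLaw (ν := μ.restrict Y) (o := excursion f Y (A j))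
  set G : Fin d → ℝ → ℝ := fun j => tailFun (realLaw (μ.restrict Y) (excursion f Y (A j))) with hGd
  have hdiv : ∀ j, Tendsto (fun n : ℕ => G j n / ((n : ℝ) ^ (-α) * ℓ n)) atTop (𝓝 (β j)) :=
    fun j => hreg.tendsto_tail_div hf h j
  have hHdiv : Tendsto (fun n : ℕ => (∑ j, G j n) / ((n : ℝ) ^ (-α) * ℓ n)) atTop (𝓝 1) := by
    rw [← hreg.sum_weight]
    simp_rw [Finset.sum_div]
    exact tendsto_finsetSum _ fun j _ => hdiv j
  have hH : IsRegVarTail (fun x => ∑ j, G j x) α :=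
    .of_tendsto_div (fun x y hxy => Finset.sum_le_sum fun j _ => antitone_tailFun hxy) one_pos
      hreg.slowly hHdiv
  have hΓ : 0 < Real.Gamma (1 - α) := Real.Gamma_pos_of_pos (by linarith [hreg.index_mem.2])
  obtain ⟨h1, h2⟩ : Tendsto (scaling f μ Y α) atTop atTop ∧ Tendsto (fun k : ℕ =>
      k * (Real.Gamma (1 - α) * ∑ j, G j (scaling f μ Y α k))) atTop (𝓝 1) :=
    hH.tendsto_sInf (b := returnSeq f μ Y α) hreg.index_mem.1 hΓ fun n => by
    rw [returnSeq, measureReal_le_firstReturn hcons hf h]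
  refine ⟨h1, fun j => ?_⟩
  have h3 := ((hdiv j).div hHdiv one_ne_zero).comp h1
  have h4 := h2.mul h3
  rw [div_one, one_mul] at h4
  refine h4.congr' ?_
  filter_upwards [h1.eventually_gt_atTop 0] with k hk
  have hk' : (0 : ℝ) < scaling f μ Y α k := by exact_mod_cast hk
  have e1 := (Real.rpow_pos_of_pos hk' (-α)).ne'
  have e2 := (hreg.slowly.pos (scaling f μ Y α k)).ne'
  have e3 : ∑ j, G j (scaling f μ Y α k) ≠ 0 := (hH.pos (scaling f μ Y α k)).ne'
  simp only [Function.comp_apply, Pi.div_apply]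
  field_simp
  simp only [hGd]

end ScalingDynamics

/-! ### Fourier inversion on the torus -/

section TorusInversion

/-- The cube `(-π, π]^d`. -/
def torusCube (d : ℕ) : Set (Fin d → ℝ) := Set.univ.pi fun _ => Set.Ioc (-Real.pi) Real.pi

lemma measurableSet_torusCube (d : ℕ) : MeasurableSet (torusCube d) :=
  MeasurableSet.univ_pi fun _ => measurableSet_Ioc

lemma volume_torusCube_ne_top (d : ℕ) : volume (torusCube d) ≠ ∞ := by
  rw [torusCube, Real.volume_pi_Ioc]
  exact ENNReal.prod_ne_top fun _ _ => ENNReal.ofReal_ne_top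

lemma integral_Ioc_exp_int_mul (n : ℤ) :
    ∫ θ in Set.Ioc (-Real.pi) Real.pi, Complex.exp (-(n * θ : ℝ) * Complex.I) =
      if n = 0 then 2 * Real.pi else 0 := by
  rw [← intervalIntegral.integral_of_le (by linarith [Real.pi_pos])]
  split_ifs with h
  · simp [h]
    ring
  · have hc : -(n : ℂ) * Complex.I ≠ 0 :=
      mul_ne_zero (neg_ne_zero.2 (Int.cast_ne_zero.2 h)) Complex.I_ne_zero
    have e : ∀ θ : ℝ, Complex.exp (-(n * θ : ℝ) * Complex.I) =
        Complex.exp (-(n : ℂ) * Complex.I * θ) := fun θ => by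
      congr 1
      push_cast
      ring
    simp_rw [e]
    rw [integral_exp_mul_complex hc, Complex.ofReal_zero, div_eq_zero_iff, sub_eq_zero]
    left
    rw [Complex.exp_eq_exp_iff_exists_int]
    refine ⟨-n, ?_⟩
    push_cast
    ring

/-- The character `e^{-i n·θ}`. -/
def torusChar {d : ℕ} (n : Fin d → ℤ) (θ : Fin d → ℝ) : ℂ :=
  ∏ j, Complex.exp (-(n j * θ j : ℝ) * Complex.I)

lemma norm_torusChar {d : ℕ} (n : Fin d → ℤ) (θ : Fin d → ℝ) : ‖torusChar n θ‖ = 1 := by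
  rw [torusChar, norm_prod]
  exact Finset.prod_eq_one fun j _ => norm_exp_neg_ofReal_mul_I _

lemma continuous_torusChar {d : ℕ} (n : Fin d → ℤ) : Continuous (torusChar n) := by
  unfold torusChar
  fun_prop

lemma setIntegral_torusChar {d : ℕ} (n : Fin d → ℤ) :
    ∫ θ in torusCube d, torusChar n θ = if n = 0 then (2 * Real.pi : ℂ) ^ d else 0 := by
  rw [torusCube, volume_pi, Measure.restrict_pi_pi]
  simp only [torusChar]
  rw [integral_fintype_prod_eq_prod (𝕜 := ℂ)
    (f := fun (j : Fin d) (x : ℝ) => Complex.exp (-(n j * x : ℝ) * Complex.I))]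
  simp_rw [integral_Ioc_exp_int_mul]
  split_ifs with h
  · simp [h]
  · obtain ⟨j, hj⟩ := Function.ne_iff.1 h
    refine Finset.prod_eq_zero (Finset.mem_univ j) ?_
    rw [if_neg (by simpa using hj), Complex.ofReal_zero]

lemma torusChar_mul_exp {d : ℕ} (n : Fin d → ℤ) (j : Fin d) (m : ℕ) (θ : Fin d → ℝ) :
    torusChar n θ * Complex.exp (θ j * Complex.I) ^ m =
      torusChar (Function.update n j (n j - m)) θ := by
  unfold torusChar
  rw [← Finset.mul_prod_erase _ _ (Finset.mem_univ j),
    ← Finset.mul_prod_erase _ (fun i => Complex.exp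
      (-(Function.update n j (n j - m) i * θ i : ℝ) * Complex.I)) (Finset.mem_univ j),
    mul_right_comm, ← Complex.exp_nat_mul, ← Complex.exp_add]
  congr 1
  · congr 1
    rw [Function.update_self]
    push_cast
    ring
  · refine Finset.prod_congr rfl fun i hi => ?_
    rw [Function.update_of_ne (Finset.ne_of_mem_erase hi)]

variable {B : Type*} [NormedAddCommGroup B] [NormedSpace ℂ B] {d : ℕ}
  {R₀ : B →L[ℂ] B} {R : Fin d → ℕ → B →L[ℂ] B}

/-- The coefficients `renewalCoeff`, extended by zero to multi-indices with negative entries. -/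
def intCoeff (R₀ : B →L[ℂ] B) (R : Fin d → ℕ → B →L[ℂ] B) (k : ℕ) (n : Fin d → ℤ) : B →L[ℂ] B :=
  if ∀ j, 0 ≤ n j then renewalCoeff R₀ R k fun j => (n j).toNat else 0

lemma intCoeff_zero (n : Fin d → ℤ) : intCoeff R₀ R 0 n = if n = 0 then 1 else 0 := by
  rw [intCoeff]
  split_ifs with h1 h2 h2
  · simp [renewalCoeff, h2, Pi.zero_def]
  · rw [renewalCoeff, if_neg]
    contrapose h2
    ext j
    have h3 := congrFun h2 j
    have h4 := h1 j
    simp only [Pi.zero_apply] at h3 h4 ⊢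
    omega
  · exact absurd (fun j => by simp [h2]) h1
  · rfl

/-- Terms with m + 1 > n_j have a negative index and vanish, so the finite sum of the recursion
equals a series over all m. -/
lemma hasSum_intCoeff_mul (k : ℕ) (n : Fin d → ℤ) (j : Fin d) :
    HasSum (fun m : ℕ => intCoeff R₀ R k (Function.update n j (n j - (m + 1 : ℕ))) * R j m)
      (if ∀ i, 0 ≤ n i then ∑ m ∈ Finset.range (n j).toNat,
        renewalCoeff R₀ R k (Function.update (fun i => (n i).toNat) j ((n j).toNat - (m + 1))) *
          R j m else 0) := by
  split_ifs with h
  · have e : ∑ m ∈ Finset.range (n j).toNat,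
        renewalCoeff R₀ R k (Function.update (fun i => (n i).toNat) j ((n j).toNat - (m + 1))) *
          R j m = ∑ m ∈ Finset.range (n j).toNat,
        intCoeff R₀ R k (Function.update n j (n j - (m + 1 : ℕ))) * R j m := by
      refine Finset.sum_congr rfl fun m hm => ?_
      rw [Finset.mem_range] at hm
      rw [intCoeff, if_pos]
      · congr 2
        ext i
        by_cases hi : i = j
        · subst hi
          simp only [Function.update_self]
          omega
        · simp only [Function.update_of_ne hi]
      · intro i
        by_cases hi : i = j
        · subst hi
          simp only [Function.update_self]
          omega
        · rw [Function.update_of_ne hi]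
          exact h i
    rw [e]
    refine hasSum_sum_of_ne_finset_zero fun m hm => ?_
    rw [Finset.mem_range] at hm
    rw [intCoeff, if_neg, zero_mul]
    intro h'
    have h1 := h' j
    have h2 := h j
    simp only [Function.update_self] at h1 h2
    omega
  · convert! hasSum_zero using 2 with m
    rw [intCoeff, if_neg, zero_mul]
    contrapose h
    intro i
    have h1 := h i
    by_cases hi : i = j
    · subst hi
      simp only [Function.update_self] at h1 ⊢
      omega
    · rwa [Function.update_of_ne hi] at h1

lemma intCoeff_succ (k : ℕ) (n : Fin d → ℤ) :
    intCoeff R₀ R (k + 1) n = intCoeff R₀ R k n * R₀ +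
      ∑ j, ∑' m : ℕ, intCoeff R₀ R k (Function.update n j (n j - (m + 1 : ℕ))) * R j m := by
  simp_rw [(hasSum_intCoeff_mul k n _).tsum_eq]
  simp only [intCoeff]
  split_ifs with h
  · rw [renewalCoeff]
  · simp

lemma norm_pow_le_pow_norm (S : B →L[ℂ] B) (k : ℕ) : ‖S ^ k‖ ≤ ‖S‖ ^ k := by
  cases k with
  | zero => exact ContinuousLinearMap.norm_id_le
  | succ k => exact norm_pow_le' S k.succ_pos

lemma exists_norm_circleSum_le (hR : ∀ j, Summable fun n => ‖R j n‖) :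
    ∃ M, 0 ≤ M ∧ ∀ θ, ‖circleSum R₀ R θ‖ ≤ M := by
  refine ⟨‖R₀‖ + ∑ j, ∑' n, ‖R j n‖, add_nonneg (norm_nonneg _) (Finset.sum_nonneg fun j _ =>
    tsum_nonneg fun n => norm_nonneg _), fun θ => (norm_add_le _ _).trans ?_⟩
  refine add_le_add_right ((norm_sum_le _ _).trans (Finset.sum_le_sum fun j _ => ?_)) _
  refine tsum_of_norm_bounded (hR j).hasSum fun n => ?_
  rw [norm_smul, norm_pow, Complex.norm_exp_ofReal_mul_I, one_pow, one_mul]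

variable [CompleteSpace B]

lemma integrableOn_torusChar_smul (hR : ∀ j, Summable fun n => ‖R j n‖) (n : Fin d → ℤ) (k : ℕ) :
    IntegrableOn (fun θ => torusChar n θ • circleSum R₀ R θ ^ k) (torusCube d) := by
  obtain ⟨M, hM0, hM⟩ := exists_norm_circleSum_le (R₀ := R₀) hR
  refine Measure.integrableOn_of_bounded (M := M ^ k) (volume_torusCube_ne_top d)
    ((continuous_torusChar n).smul ((continuous_circleSum hR).pow k)).aestronglyMeasurable
    (Eventually.of_forall fun θ => ?_)
  rw [norm_smul, norm_torusChar, one_mul]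
  exact (norm_pow_le_pow_norm _ k).trans (pow_le_pow_left₀ (norm_nonneg _) (hM θ) k)

/-- Induction on k: multiplication by R(e^{iθ}) convolves the Fourier coefficients, and this is the
recursion `intCoeff_succ`. Integer indices keep the convolution free of truncated subtraction. -/
theorem setIntegral_torusChar_smul_circleSum_pow (hR : ∀ j, Summable fun n => ‖R j n‖) (k : ℕ) :
    ∀ n : Fin d → ℤ, ∫ θ in torusCube d, torusChar n θ • circleSum R₀ R θ ^ k =
      (2 * Real.pi : ℂ) ^ d • intCoeff R₀ R k n := by
  induction k with
  | zero =>
    intro n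
    simp only [pow_zero]
    rw [integral_smul_const, setIntegral_torusChar, intCoeff_zero]
    split_ifs <;> simp
  | succ k ih =>
    intro n
    have hint := fun n => integrableOn_torusChar_smul (R₀ := R₀) hR n k
    have hterm : ∀ j m, IntegrableOn (fun θ => torusChar (Function.update n j (n j - (m + 1 : ℕ))) θ •
        circleSum R₀ R θ ^ k * R j m) (torusCube d) := fun j m => (hint _).mul_const _
    have hnorm : ∀ j, Summable fun m => ∫ θ in torusCube d,
        ‖torusChar (Function.update n j (n j - (m + 1 : ℕ))) θ • circleSum R₀ R θ ^ k * R j m‖ := by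
      intro j
      refine Summable.of_nonneg_of_le (fun m => integral_nonneg fun θ => norm_nonneg _) (fun m => ?_)
        ((hR j).mul_left (∫ θ in torusCube d, ‖circleSum R₀ R θ ^ k‖))
      rw [← integral_mul_const]
      refine integral_mono_of_nonneg (Eventually.of_forall fun θ => norm_nonneg _) ?_
        (Eventually.of_forall fun θ => ?_)
      · refine Integrable.mul_const ?_ _
        have := (hint 0).norm
        simpa only [norm_smul, norm_torusChar, one_mul] using this
      · refine (norm_mul_le _ _).trans ?_
        rw [norm_smul, norm_torusChar, one_mul]
    have hexp : ∀ θ, torusChar n θ • circleSum R₀ R θ ^ (k + 1) =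
        torusChar n θ • circleSum R₀ R θ ^ k * R₀ + ∑ j, ∑' m : ℕ,
          torusChar (Function.update n j (n j - (m + 1 : ℕ))) θ • circleSum R₀ R θ ^ k * R j m := by
      intro θ
      rw [pow_succ]
      nth_rewrite 2 [circleSum]
      rw [powerSum, mul_add, smul_add, smul_mul_assoc, Finset.mul_sum, Finset.smul_sum]
      congr 1
      refine Finset.sum_congr rfl fun j _ => ?_
      have hs := summable_pow_smul (hR j) (Complex.norm_exp_ofReal_mul_I (θ j)).le
      rw [← hs.tsum_mul_left, ← (hs.mul_left _).tsum_const_smul]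
      refine tsum_congr fun m => ?_
      rw [← torusChar_mul_exp, mul_smul_comm, smul_smul, smul_mul_assoc]
    simp_rw [hexp]
    have hsumint : ∀ j, IntegrableOn (fun θ => ∑' m : ℕ,
        torusChar (Function.update n j (n j - (m + 1 : ℕ))) θ • circleSum R₀ R θ ^ k * R j m)
        (torusCube d) := fun j => by
      obtain ⟨M, hM0, hM⟩ := exists_norm_circleSum_le (R₀ := R₀) hR
      have hle : ∀ m θ, ‖torusChar (Function.update n j (n j - (m + 1 : ℕ))) θ •
          circleSum R₀ R θ ^ k * R j m‖ ≤ M ^ k * ‖R j m‖ := fun m θ => by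
        refine (norm_mul_le _ _).trans (mul_le_mul_of_nonneg_right ?_ (norm_nonneg _))
        rw [norm_smul, norm_torusChar, one_mul]
        exact (norm_pow_le_pow_norm _ k).trans (pow_le_pow_left₀ (norm_nonneg _) (hM θ) k)
      refine Measure.integrableOn_of_bounded (M := ∑' m, M ^ k * ‖R j m‖)
        (volume_torusCube_ne_top d) (Continuous.aestronglyMeasurable ?_)
        (Eventually.of_forall fun θ =>
          tsum_of_norm_bounded ((hR j).mul_left (M ^ k)).hasSum fun m => hle m θ)
      exact continuous_tsum (fun m => ((continuous_torusChar _).smul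
        ((continuous_circleSum hR).pow k)).mul continuous_const) ((hR j).mul_left (M ^ k)) hle
    rw [integral_add ((hint n).mul_const _) (integrable_finsetSum _ fun j _ => hsumint j),
      integral_finsetSum _ fun j _ => hsumint j, intCoeff_succ, smul_add, Finset.smul_sum,
      integral_mul_const_of_integrable (hint n), ih, smul_mul_assoc]
    congr 1
    refine Finset.sum_congr rfl fun j _ => ?_
    have h1 := hasSum_integral_of_summable_integral_norm (hterm j) (hnorm j)
    rw [← h1.tsum_eq, ← (hasSum_intCoeff_mul (R₀ := R₀) (R := R) k n j).summable.tsum_const_smul]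
    refine tsum_congr fun m => ?_
    rw [integral_mul_const_of_integrable (hint _), ih, smul_mul_assoc]

theorem renewalCoeff_eq_integral (hR : ∀ j, Summable fun n => ‖R j n‖) (k : ℕ) (n : Fin d → ℕ) :
    (2 * Real.pi : ℂ) ^ d • renewalCoeff R₀ R k n =
      ∫ θ in torusCube d, torusChar (fun j => (n j : ℤ)) θ • circleSum R₀ R θ ^ k := by
  rw [setIntegral_torusChar_smul_circleSum_pow hR, intCoeff, if_pos fun j => by simp]
  simp

end TorusInversion

/-! ### Behaviour of the renewal operators near and away from zero -/

section Local

variable {B : Type*} [NormedAddCommGroup B] [NormedSpace ℂ B] {d : ℕ}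
  {R₀ : B →L[ℂ] B} {R : Fin d → ℕ → B →L[ℂ] B} {e : B} {φ : B →L[ℂ] ℂ}
  {ν : Fin d → Measure ℝ} {α : ℝ}

/-- The points with nonzero coordinates. -/
def offAxes (d : ℕ) : Set (Fin d → ℝ) := {θ | ∀ j, θ j ≠ 0}

/-- The sum of the tails of the measures `ν j` beyond `1 / |θ_j|`. -/
def tailSum (ν : Fin d → Measure ℝ) (θ : Fin d → ℝ) : ℝ := ∑ j, tailFun (ν j) |θ j|⁻¹

lemma tailSum_nonneg (ν : Fin d → Measure ℝ) (θ : Fin d → ℝ) : 0 ≤ tailSum ν θ :=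
  Finset.sum_nonneg fun _ _ => tailFun_nonneg _

/-- The axes are excluded because |0|⁻¹ = 0 would evaluate a tail at zero instead of infinity; they
form a null set. -/
lemma tendsto_inv_abs_offAxes (j : Fin d) :
    Tendsto (fun θ : Fin d → ℝ => |θ j|⁻¹) (𝓝[offAxes d] 0) atTop := by
  refine tendsto_inv_nhdsGT_zero.comp (tendsto_abs_nhdsNE_zero.comp ?_)
  refine tendsto_nhdsWithin_iff.2 ⟨?_, ?_⟩
  · exact ((continuous_apply j).tendsto' 0 0 rfl).mono_left nhdsWithin_le_nhds
  · filter_upwards [self_mem_nhdsWithin] with θ hθ using hθ j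

namespace IsRenewalFamily

variable (hF : IsRenewalFamily R₀ R e φ ν α)

include hF

lemma tendsto_tailSum (h0 : 0 < α) : Tendsto (tailSum ν) (𝓝[offAxes d] 0) (𝓝 0) := by
  have h : Tendsto (tailSum ν) (𝓝[offAxes d] 0) (𝓝 (∑ _j : Fin d, (0 : ℝ))) :=
    tendsto_finsetSum _ fun j _ => ((hF.tail j).tendsto_zero h0).comp (tendsto_inv_abs_offAxes j)
  rwa [Finset.sum_const_zero] at h

lemma exists_sum_integral_norm_le (h0 : 0 < α) (h1 : α < 1) :
    ∃ C, 0 < C ∧ ∀ᶠ θ in 𝓝[offAxes d] 0,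
      ∑ j, ∫ s, ‖1 - Complex.exp ((θ j * s : ℝ) * Complex.I)‖ ∂ν j ≤ C * tailSum ν θ := by
  have := hF.finite
  choose C a₀ hC ha₀ h using fun j =>
    exists_integral_norm_one_sub_exp_le (hF.nonneg j) (hF.tail j) h0 h1
  obtain ⟨D, hD, hD0⟩ := ((eventually_all.2 fun j => eventually_ge_atTop (C j)).and
    (eventually_gt_atTop 0)).exists
  refine ⟨D, hD0, ?_⟩
  filter_upwards [self_mem_nhdsWithin, eventually_all.2 fun j =>
    (tendsto_inv_abs_offAxes j).eventually_ge_atTop (a₀ j)] with θ hθ ha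
  rw [tailSum, Finset.mul_sum]
  refine Finset.sum_le_sum fun j _ => (h j (θ j) (hθ j) (ha j)).trans ?_
  exact mul_le_mul_of_nonneg_right (hD j) (tailFun_nonneg _)

lemma exists_le_re_sum_integral (h0 : 0 < α) (h1 : α < 1) :
    ∃ c, 0 < c ∧ ∀ᶠ θ in 𝓝[offAxes d] 0,
      c * tailSum ν θ ≤
        (∑ j, ∫ s, (1 - Complex.exp ((θ j * s : ℝ) * Complex.I)) ∂ν j).re := by
  have := hF.finite
  choose c a₀ hc ha₀ h using fun j =>
    exists_le_re_integral_one_sub_exp (hF.nonneg j) (hF.tail j) h0 h1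
  obtain ⟨b, hb, hb0⟩ := ((eventually_all.2 fun j => nhdsWithin_le_nhds (s := Set.Ioi (0 : ℝ))
    (eventually_le_nhds (hc j))).and eventually_mem_nhdsWithin).exists
  refine ⟨b, hb0, ?_⟩
  filter_upwards [self_mem_nhdsWithin, eventually_all.2 fun j =>
    (tendsto_inv_abs_offAxes j).eventually_ge_atTop (a₀ j)] with θ hθ ha
  rw [tailSum, Finset.mul_sum, Complex.re_sum]
  refine Finset.sum_le_sum fun j _ => le_trans ?_ (h j (θ j) (hθ j) (ha j))
  exact mul_le_mul_of_nonneg_right (hb j) (tailFun_nonneg _)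

lemma norm_one_sub_apply_le (θ : Fin d → ℝ) : ‖1 - φ (circleSum R₀ R θ e)‖ ≤
    ∑ j, ∫ s, ‖1 - Complex.exp ((θ j * s : ℝ) * Complex.I)‖ ∂ν j := by
  rw [hF.mean]
  exact (norm_sum_le _ _).trans (Finset.sum_le_sum fun j _ => norm_integral_le_integral_norm _)

variable [CompleteSpace B]

lemma tendsto_circleSum : Tendsto (circleSum R₀ R) (𝓝 0) (𝓝 (circleSum R₀ R 0)) :=
  (continuous_circleSum hF.summable).tendsto 0

/-- R(e^{iθ}) - R(1) is at most of the order of `tailSum`, so replacing the eigenvalue by its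
first-order part is negligible at that order. -/
lemma isLittleO_eigenvalue (h0 : 0 < α) (h1 : α < 1) {lam : (B →L[ℂ] B) → ℂ}
    (ho : (fun S => lam S - φ (S e)) =o[𝓝 (circleSum R₀ R 0)] fun S => S - circleSum R₀ R 0) :
    (fun θ => lam (circleSum R₀ R θ) - φ (circleSum R₀ R θ e)) =o[𝓝[offAxes d] 0] tailSum ν := by
  have h2 := ho.comp_tendsto (hF.tendsto_circleSum.mono_left
    (nhdsWithin_le_nhds (s := offAxes d)))
  refine h2.trans_isBigO ?_
  obtain ⟨C, hC, hb⟩ := hF.exists_sum_integral_norm_le h0 h1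
  obtain ⟨D, hD, hd⟩ := hF.norm_sub_le
  refine IsBigO.of_bound (D * C) ?_
  filter_upwards [hb] with θ hθ
  rw [Real.norm_of_nonneg (tailSum_nonneg ν θ), mul_assoc]
  exact (hd θ).trans (mul_le_mul_of_nonneg_left hθ hD.le)

/-- Let w = 1 - φ(R(e^{iθ})e) and g = `tailSum`. From Re w ≥ c g and |w| ≤ C g one gets |1 - w|² ≤ 1
- 2cg + C²g² ≤ 1 - cg once g ≤ c/C². The correction to the eigenvalue uses up another c g/4. -/
lemma exists_norm_eigenvalue_le (h0 : 0 < α) (h1 : α < 1) {lam : (B →L[ℂ] B) → ℂ}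
    (ho : (fun S => lam S - φ (S e)) =o[𝓝 (circleSum R₀ R 0)] fun S => S - circleSum R₀ R 0) :
    ∃ c, 0 < c ∧ ∀ᶠ θ in 𝓝[offAxes d] 0,
      ‖lam (circleSum R₀ R θ)‖ ≤ Real.exp (-(c * tailSum ν θ)) := by
  obtain ⟨C, hC, hb⟩ := hF.exists_sum_integral_norm_le h0 h1
  obtain ⟨c, hc, hre⟩ := hF.exists_le_re_sum_integral h0 h1
  have ho' := (hF.isLittleO_eigenvalue h0 h1 ho).bound (show 0 < c / 4 by positivity)
  have hsmall := (hF.tendsto_tailSum h0).eventually_le_const (u := c / C ^ 2) (by positivity)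
  refine ⟨c / 4, by positivity, ?_⟩
  filter_upwards [hb, hre, ho', hsmall] with θ h1 h2 h3 h4
  have hg := tailSum_nonneg ν θ
  rw [Real.norm_of_nonneg hg] at h3
  have h5 := (hF.norm_one_sub_apply_le θ).trans h1
  rw [← hF.mean] at h2
  set w := 1 - φ (circleSum R₀ R θ e) with hw
  have hφ : φ (circleSum R₀ R θ e) = 1 - w := by rw [hw]; ring
  have h6 : ‖1 - w‖ ≤ 1 - c / 2 * tailSum ν θ := by
    have hcg : c * tailSum ν θ ≤ 1 := by
      have h7 : c * tailSum ν θ ≤ C * tailSum ν θ := h2.trans ((Complex.re_le_norm w).trans h5)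
      rcases hg.eq_or_lt with hg0 | hg0
      · rw [← hg0]
        simp
      · have h8 : c ≤ C := le_of_mul_le_mul_right h7 hg0
        rw [le_div_iff₀ (by positivity)] at h4
        have h9 : c * tailSum ν θ * C ^ 2 ≤ C ^ 2 := by nlinarith
        exact le_of_mul_le_mul_right (by linarith) (show 0 < C ^ 2 by positivity)
    refine abs_le_of_sq_le_sq' ?_ (by linarith) |>.2
    have e1 : ‖1 - w‖ ^ 2 = 1 - 2 * w.re + ‖w‖ ^ 2 := by
      rw [Complex.sq_norm, Complex.sq_norm, Complex.normSq_apply, Complex.normSq_apply]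
      simp
      ring
    have e2 : ‖w‖ ^ 2 ≤ (C * tailSum ν θ) ^ 2 := pow_le_pow_left₀ (norm_nonneg _) h5 2
    have e3 : (C * tailSum ν θ) ^ 2 ≤ c * tailSum ν θ := by
      rw [le_div_iff₀ (by positivity)] at h4
      nlinarith
    nlinarith [sq_nonneg (c / 2 * tailSum ν θ)]
  have h7 : ‖lam (circleSum R₀ R θ)‖ ≤ 1 - c / 4 * tailSum ν θ := by
    have := norm_add_le (lam (circleSum R₀ R θ) - φ (circleSum R₀ R θ e)) (1 - w)
    rw [← hφ, sub_add_cancel, hφ] at this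
    rw [hφ] at h3
    linarith
  refine h7.trans ?_
  linarith [Real.add_one_le_exp (-(c / 4 * tailSum ν θ))]

/-- Aperiodicity gives geometric decay with constants uniform near each point, and compactness of
the closed cube minus a ball makes them uniform. -/
lemma exists_norm_pow_le_of_le_norm {δ : ℝ} (hδ : 0 < δ) :
    ∃ C q, 0 ≤ C ∧ 0 < q ∧ q < 1 ∧ ∀ θ ∈ torusCube d, δ ≤ ‖θ‖ →
      ∀ k : ℕ, ‖circleSum R₀ R θ ^ k‖ ≤ C * q ^ k := by
  set K : Set (Fin d → ℝ) := (Set.univ.pi fun _ => Set.Icc (-Real.pi) Real.pi) ∩ {θ | δ ≤ ‖θ‖}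
  have hK : IsCompact K := (isCompact_univ_pi fun _ => isCompact_Icc).inter_right
    (isClosed_le continuous_const continuous_norm)
  have key : ∃ C q, 0 ≤ C ∧ 0 < q ∧ q < 1 ∧ ∀ θ ∈ K,
      ∀ k : ℕ, ‖circleSum R₀ R θ ^ k‖ ≤ C * q ^ k := by
    refine hK.induction_on (p := fun s => ∃ C q, 0 ≤ C ∧ 0 < q ∧ q < 1 ∧ ∀ θ ∈ s,
      ∀ k : ℕ, ‖circleSum R₀ R θ ^ k‖ ≤ C * q ^ k) ?_ ?_ ?_ ?_
    · exact ⟨0, 1 / 2, le_rfl, by norm_num, by norm_num, fun θ hθ => absurd hθ (Set.notMem_empty θ)⟩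
    · rintro s t hst ⟨C, q, hC, hq, hq1, h⟩
      exact ⟨C, q, hC, hq, hq1, fun θ hθ => h θ (hst hθ)⟩
    · rintro s t ⟨C, q, hC, hq, hq1, h⟩ ⟨C', q', hC', hq', hq1', h'⟩
      refine ⟨max C C', max q q', le_max_of_le_left hC, lt_max_of_lt_left hq, max_lt hq1 hq1',
        fun θ hθ k => ?_⟩
      rcases hθ with hθ | hθ
      · refine (h θ hθ k).trans ?_
        gcongr
        · exact le_max_left _ _
        · exact le_max_left _ _
      · refine (h' θ hθ k).trans ?_
        gcongr
        · exact le_max_right _ _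
        · exact le_max_right _ _
    · intro θ hθ
      have hrad : spectralRadius ℂ (circleSum R₀ R θ) < 1 := by
        refine hF.aperiodic _ (fun j => Complex.norm_exp_ofReal_mul_I _) fun h => ?_
        -- On the closed cube e^{iθ_j} = 1 only at θ_j = 0, since |θ_j| ≤ π < 2π.
        have hzero : θ = 0 := by
          ext j
          have h2 := congrFun h j
          simp only [Pi.one_apply, Complex.exp_eq_one_iff] at h2
          obtain ⟨n, hn⟩ := h2
          have h3 : θ j = n * (2 * Real.pi) := by
            have := congrArg Complex.im hn
            simpa using this
          have h4 := hθ.1 j (Set.mem_univ j)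
          have hpi := Real.pi_pos
          have h5 : n = 0 := by
            have h6 : (n : ℝ) < 1 := by
              by_contra h7
              nlinarith [h4.2, not_lt.1 h7]
            have h8 : (-1 : ℝ) < n := by
              by_contra h9
              nlinarith [h4.1, not_lt.1 h9]
            have h6' : n < 1 := by exact_mod_cast h6
            have h8' : -1 < n := by exact_mod_cast h8
            omega
          rw [h3, h5]
          simp
        have := hθ.2
        rw [hzero, Set.mem_ofPred_eq, norm_zero] at this
        linarith
      obtain ⟨C, q, hC, hq, hq1, h⟩ := exists_eventually_norm_pow_le hrad
      have hev := ((continuous_circleSum hF.summable).tendsto θ).eventually h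
      exact ⟨_, mem_nhdsWithin_of_mem_nhds hev, C, q, hC, hq, hq1, fun θ' hθ' => hθ'⟩
  obtain ⟨C, q, hC, hq, hq1, h⟩ := key
  refine ⟨C, q, hC, hq, hq1, fun θ hθ hθδ => h θ ⟨fun j hj => ?_, hθδ⟩⟩
  exact Set.Ioc_subset_Icc_self (hθ j hj)

end IsRenewalFamily

end Local

/-! ### Limits and bounds along the scaling θ = t/a_k -/

section ScaledLimit

variable {B : Type*} [NormedAddCommGroup B] [NormedSpace ℂ B] {d : ℕ}
  {R₀ : B →L[ℂ] B} {R : Fin d → ℕ → B →L[ℂ] B} {e : B} {φ : B →L[ℂ] ℂ}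
  {ν : Fin d → Measure ℝ} {α : ℝ} {β : Fin d → ℝ} {a : ℕ → ℕ}

/-- `a` is a scaling sequence for the measures `ν j`, with weights `β j`. -/
structure IsScaling (ν : Fin d → Measure ℝ) (α : ℝ) (β : Fin d → ℝ) (a : ℕ → ℕ) : Prop where
  tendsto_atTop : Tendsto a atTop atTop
  tendsto_mul : ∀ j, Tendsto (fun k : ℕ => k * (Real.Gamma (1 - α) * tailFun (ν j) (a k))) atTop
    (𝓝 (β j))

/-- The characteristic function of the product of the one-sided stable laws. -/
def stableProd (α : ℝ) (β : Fin d → ℝ) (t : Fin d → ℝ) : ℂ :=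
  ∏ j, stableTransform α (β j) (-(t j * Complex.I))

lemma IsScaling.tendsto_cast (ha : IsScaling ν α β a) :
    Tendsto (fun k => (a k : ℝ)) atTop atTop := tendsto_natCast_atTop_atTop.comp ha.tendsto_atTop

lemma IsScaling.tendsto_inv_smul (ha : IsScaling ν α β a) {t : Fin d → ℝ} (ht : t ∈ offAxes d) :
    Tendsto (fun k => (a k : ℝ)⁻¹ • t) atTop (𝓝[offAxes d] 0) := by
  refine tendsto_nhdsWithin_iff.2 ⟨?_, ?_⟩
  · have := (tendsto_inv_atTop_zero.comp ha.tendsto_cast).smul_const t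
    rwa [zero_smul] at this
  · filter_upwards [ha.tendsto_cast.eventually_gt_atTop 0] with k hk j
    exact mul_ne_zero (inv_pos.2 hk).ne' (ht j)

lemma IsScaling.tendsto_mul_tailFun (ha : IsScaling ν α β a) (h1 : α < 1) {j : Fin d}
    (hG : IsRegVarTail (tailFun (ν j)) α) {x : ℝ} (hx : 0 < x) :
    Tendsto (fun k : ℕ => k * tailFun (ν j) (a k * x)) atTop
      (𝓝 (β j / Real.Gamma (1 - α) * x ^ (-α))) := by
  have hΓ : 0 < Real.Gamma (1 - α) := Real.Gamma_pos_of_pos (by linarith)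
  have h2 := ((ha.tendsto_mul j).div_const (Real.Gamma (1 - α))).mul
    ((hG.tendsto x hx).comp ha.tendsto_cast)
  refine h2.congr fun k => ?_
  have := (hG.pos (a k)).ne'
  simp only [Function.comp_apply]
  field_simp

lemma abs_inv_smul_inv {k : ℕ} (t : Fin d → ℝ) (j : Fin d) :
    |((k : ℝ)⁻¹ • t) j|⁻¹ = k * |t j|⁻¹ := by
  rw [Pi.smul_apply, smul_eq_mul, abs_mul, mul_inv, abs_inv, inv_inv, Nat.abs_cast]

lemma IsScaling.tendsto_mul_tailSum (ha : IsScaling ν α β a) (h1 : α < 1)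
    (hG : ∀ j, IsRegVarTail (tailFun (ν j)) α) {t : Fin d → ℝ} (ht : t ∈ offAxes d) :
    Tendsto (fun k : ℕ => k * tailSum ν ((a k : ℝ)⁻¹ • t)) atTop
      (𝓝 (∑ j, β j / Real.Gamma (1 - α) * |t j|⁻¹ ^ (-α))) := by
  simp_rw [tailSum, Finset.mul_sum, abs_inv_smul_inv]
  exact tendsto_finsetSum _ fun j _ =>
    ha.tendsto_mul_tailFun h1 (hG j) (inv_pos.2 (abs_pos.2 (ht j)))

namespace IsRenewalFamily

variable (hF : IsRenewalFamily R₀ R e φ ν α)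

include hF

lemma tendsto_mul_one_sub_apply (ha : IsScaling ν α β a) (h0 : 0 < α) (h1 : α < 1)
    (t : Fin d → ℝ) :
    Tendsto (fun k : ℕ => k * (1 - φ (circleSum R₀ R ((a k : ℝ)⁻¹ • t) e))) atTop
      (𝓝 (∑ j, β j * (-(t j * Complex.I)) ^ (α : ℂ))) := by
  have := hF.finite
  have hΓ : 0 < Real.Gamma (1 - α) := Real.Gamma_pos_of_pos (by linarith)
  simp_rw [hF.mean, Finset.mul_sum]
  refine tendsto_finsetSum _ fun j _ => ?_
  have h2 := (tendsto_integral_one_sub_exp_div (hF.nonneg j) (hF.tail j) h0 h1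
    (z := -(t j * Complex.I)) (by simp)).comp ha.tendsto_cast
  have h3 := ((Complex.continuous_ofReal.tendsto _).comp (ha.tendsto_mul j)).mul h2
  have h4 := h3.div_const (Real.Gamma (1 - α) : ℂ)
  have hΓ' : (Real.Gamma (1 - α) : ℂ) ≠ 0 := Complex.ofReal_ne_zero.2 hΓ.ne'
  have e1 : (β j : ℂ) * (Real.Gamma (1 - α) * (-(t j * Complex.I)) ^ (α : ℂ)) /
      Real.Gamma (1 - α) = β j * (-(t j * Complex.I)) ^ (α : ℂ) := by
    field_simp
  rw [e1] at h4
  refine h4.congr fun k => ?_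
  have h5 : (tailFun (ν j) (a k) : ℂ) ≠ 0 := Complex.ofReal_ne_zero.2 ((hF.tail j).pos _).ne'
  simp only [Function.comp_apply, Pi.smul_apply, smul_eq_mul]
  push_cast
  field_simp

variable [CompleteSpace B]

/-- Writing λ^k = (1 + (λ - 1))^k, it is enough that k(λ - 1) converges; the error term vanishes
because k times `tailSum` stays bounded. -/
lemma tendsto_eigenvalue_pow (ha : IsScaling ν α β a) (h0 : 0 < α) (h1 : α < 1)
    {lam : (B →L[ℂ] B) → ℂ}
    (ho : (fun S => lam S - φ (S e)) =o[𝓝 (circleSum R₀ R 0)] fun S => S - circleSum R₀ R 0)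
    {t : Fin d → ℝ} (ht : t ∈ offAxes d) :
    Tendsto (fun k : ℕ => lam (circleSum R₀ R ((a k : ℝ)⁻¹ • t)) ^ k) atTop
      (𝓝 (stableProd α β t)) := by
  have h2 := ((hF.isLittleO_eigenvalue h0 h1 ho).comp_tendsto (ha.tendsto_inv_smul ht))
  have h3 : Tendsto (fun k : ℕ => (k : ℂ) * (lam (circleSum R₀ R ((a k : ℝ)⁻¹ • t)) -
      φ (circleSum R₀ R ((a k : ℝ)⁻¹ • t) e))) atTop (𝓝 0) := by
    have h4 : (fun k : ℕ => (k : ℂ) * (lam (circleSum R₀ R ((a k : ℝ)⁻¹ • t)) -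
        φ (circleSum R₀ R ((a k : ℝ)⁻¹ • t) e))) =o[atTop] fun k : ℕ =>
          (k : ℝ) * tailSum ν ((a k : ℝ)⁻¹ • t) := by
      refine IsBigO.mul_isLittleO (IsBigO.of_bound 1 (Eventually.of_forall fun k => ?_)) h2
      simp
    exact (h4.trans_isBigO
      ((ha.tendsto_mul_tailSum h1 hF.tail ht).isBigO_one ℝ)).tendsto_zero_of_tendsto
        tendsto_const_nhds
  have h5 := h3.sub (hF.tendsto_mul_one_sub_apply ha h0 h1 t)
  have h6 := Complex.tendsto_one_add_pow_exp_of_tendsto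
    (g := fun k => lam (circleSum R₀ R ((a k : ℝ)⁻¹ • t)) - 1) (h5.congr fun k => by ring)
  have e1 : Complex.exp (0 - ∑ j, β j * (-(t j * Complex.I)) ^ (α : ℂ)) = stableProd α β t := by
    simp only [stableProd, stableTransform]
    rw [← Complex.exp_sum, zero_sub, Finset.sum_neg_distrib]
  rw [e1] at h6
  simpa only [add_sub_cancel] using h6

omit [CompleteSpace B] in
-- Potter's lower bound with exponent α/2 compares the tail at a_k/|x| with the tail at a_k, whose
-- product with k stays away from zero. The factor exp(b) takes care of |x| ≤ 1, and `r` marks where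
-- the bound is valid.
lemma exists_exp_neg_mul_tailFun_le (ha : IsScaling ν α β a) (h0 : 0 < α) (h1 : α < 1)
    {j : Fin d} (hβ : 0 < β j) {c : ℝ} (hc : 0 < c) :
    ∃ b r, 0 < b ∧ 0 < r ∧ ∀ᶠ k : ℕ in atTop, ∀ x : ℝ, x ≠ 0 → r ≤ (a k) * |x|⁻¹ →
      Real.exp (-(c * (k * tailFun (ν j) (a k * |x|⁻¹)))) ≤
        Real.exp b * Real.exp (-b * |x| ^ (α / 2)) := by
  obtain ⟨C, r, hC, hr, h⟩ := (hF.tail j).exists_le_rpow_mul (half_lt_self h0) (half_pos h0)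
  have hΓ : 0 < Real.Gamma (1 - α) := Real.Gamma_pos_of_pos (by linarith)
  set g := β j / Real.Gamma (1 - α) / 2 with hg
  have hgpos : 0 < g := by positivity
  have hev : ∀ᶠ k : ℕ in atTop, g < k * tailFun (ν j) (a k) := by
    have h2 := ha.tendsto_mul_tailFun h1 (hF.tail j) one_pos
    simp only [mul_one, Real.one_rpow] at h2
    exact h2.eventually_const_lt (half_lt_self (by positivity))
  refine ⟨c * g / C, r, by positivity, hr, ?_⟩
  filter_upwards [hev, ha.tendsto_cast.eventually_gt_atTop 0] with k hk hak x hx hrx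
  have hx' : 0 < |x| := abs_pos.2 hx
  have hGx := (hF.tail j).pos (a k * |x|⁻¹)
  rw [← Real.exp_add, Real.exp_le_exp]
  rcases le_total 1 |x| with h1x | h1x
  · have h2 := h _ hrx (a k) (mul_le_of_le_one_right hak.le (inv_le_one_of_one_le₀ h1x))
    rw [Real.mul_rpow hak.le (inv_pos.2 hx').le, Real.inv_rpow hx'.le] at h2
    have hap : 0 < (a k : ℝ) ^ (α / 2) := Real.rpow_pos_of_pos hak _
    have hxp : 0 < |x| ^ (α / 2) := Real.rpow_pos_of_pos hx' _
    have h3 : tailFun (ν j) (a k) * |x| ^ (α / 2) ≤ C * tailFun (ν j) (a k * |x|⁻¹) := by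
      have h4 : C * ((a k : ℝ) ^ (α / 2) * (|x| ^ (α / 2))⁻¹ * tailFun (ν j) (a k * |x|⁻¹)) =
          (a k : ℝ) ^ (α / 2) * ((C * tailFun (ν j) (a k * |x|⁻¹)) / |x| ^ (α / 2)) := by
        field_simp
      rw [h4] at h2
      have h5 := le_of_mul_le_mul_left h2 hap
      rwa [le_div_iff₀ hxp] at h5
    have h6 : g * |x| ^ (α / 2) ≤ C * (k * tailFun (ν j) (a k * |x|⁻¹)) := by
      have hk0 : (0 : ℝ) ≤ k := k.cast_nonneg
      calc g * |x| ^ (α / 2) ≤ k * tailFun (ν j) (a k) * |x| ^ (α / 2) := by gcongr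
        _ = k * (tailFun (ν j) (a k) * |x| ^ (α / 2)) := by ring
        _ ≤ k * (C * tailFun (ν j) (a k * |x|⁻¹)) := by gcongr
        _ = _ := by ring
    have h7 : c * g / C * |x| ^ (α / 2) ≤ c * (k * tailFun (ν j) (a k * |x|⁻¹)) := by
      rw [div_mul_eq_mul_div, div_le_iff₀ hC]
      calc c * g * |x| ^ (α / 2) = c * (g * |x| ^ (α / 2)) := by ring
        _ ≤ c * (C * (k * tailFun (ν j) (a k * |x|⁻¹))) := by gcongr
        _ = _ := by ring
    have : 0 < c * g / C := by positivity
    linarith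
  · have h2 : |x| ^ (α / 2) ≤ 1 := Real.rpow_le_one hx'.le h1x (by positivity)
    have h3 : 0 ≤ c * (k * tailFun (ν j) (a k * |x|⁻¹)) := by positivity
    have h4 : 0 < c * g / C := by positivity
    nlinarith

end IsRenewalFamily

end ScaledLimit

/-! ### Pointwise limit and majorant of the rescaled error -/

section Profile

variable {B : Type*} [NormedAddCommGroup B] [NormedSpace ℂ B] {d : ℕ}
  {R₀ : B →L[ℂ] B} {R : Fin d → ℕ → B →L[ℂ] B} {e : B} {φ : B →L[ℂ] ℂ}
  {ν : Fin d → Measure ℝ} {α : ℝ} {β : Fin d → ℝ} {a : ℕ → ℕ}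

lemma integrable_stableProd (h0 : 0 < α) (h1 : α < 1) (hβ : ∀ j, 0 < β j) :
    Integrable (stableProd α β) :=
  Integrable.fintype_prod fun j => integrable_stableTransform h0 h1 (hβ j)

lemma ae_mem_offAxes : ∀ᵐ t : Fin d → ℝ, t ∈ offAxes d := by
  refine ae_all_iff.2 fun j => ?_
  exact (Measure.ae_eval_ne (μ := fun _ : Fin d => (volume : Measure ℝ)) j 0)

/-- The Fourier transform of the rescaled renewal coefficients, minus its limit. -/
def scaledError (R₀ : B →L[ℂ] B) (R : Fin d → ℕ → B →L[ℂ] B) (P : B →L[ℂ] B) (α : ℝ)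
    (β : Fin d → ℝ) (k m : ℕ) (t : Fin d → ℝ) : B →L[ℂ] B :=
  (torusCube d).indicator (fun θ => circleSum R₀ R θ ^ k) ((m : ℝ)⁻¹ • t) - stableProd α β t • P

namespace IsRenewalFamily

variable (hF : IsRenewalFamily R₀ R e φ ν α) [CompleteSpace B]

include hF

lemma tendsto_scaledError (ha : IsScaling ν α β a) (h0 : 0 < α) (h1 : α < 1) {t : Fin d → ℝ}
    (ht : t ∈ offAxes d) :
    Tendsto (fun k => scaledError R₀ R (φ.smulRight e) α β k (a k) t) atTop (𝓝 0) := by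
  obtain ⟨lam, Pi, C, q, hC, hq, hq1, hlam, hPi, hpow, ho⟩ :=
    exists_dominant_eigenvalue hF.apply_vector hF.map_vector hF.apply_map hF.gap
  have hθ := ha.tendsto_inv_smul ht
  have hθ0 := hθ.mono_right nhdsWithin_le_nhds
  have hS := hF.tendsto_circleSum.comp hθ0
  have h2 := (hF.tendsto_eigenvalue_pow ha h0 h1 ho ht).smul (hPi.comp hS)
  have h3 : Tendsto (fun k => circleSum R₀ R ((a k : ℝ)⁻¹ • t) ^ k -
      lam (circleSum R₀ R ((a k : ℝ)⁻¹ • t)) ^ k • Pi (circleSum R₀ R ((a k : ℝ)⁻¹ • t)))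
      atTop (𝓝 0) := by
    have h4 : Tendsto (fun k : ℕ => C * q ^ k) atTop (𝓝 0) := by
      have := (tendsto_pow_atTop_nhds_zero_of_lt_one hq.le hq1).const_mul C
      rwa [mul_zero] at this
    refine squeeze_zero_norm' ?_ h4
    filter_upwards [hS.eventually hpow, eventually_ge_atTop 1] with k hk hk1
    obtain ⟨m, rfl⟩ : ∃ m, k = m + 1 := ⟨k - 1, by omega⟩
    exact hk m
  have h5 := (h3.add h2).sub_const (stableProd α β t • φ.smulRight e)
  rw [zero_add, sub_self] at h5
  refine h5.congr' ?_
  have hcube : ∀ᶠ θ : Fin d → ℝ in 𝓝 0, θ ∈ torusCube d := by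
    refine set_pi_mem_nhds Set.finite_univ fun j _ => Ioc_mem_nhds ?_ ?_
    · simpa using Real.pi_pos
    · simpa using Real.pi_pos
  filter_upwards [hθ0.eventually hcube] with k hk
  rw [scaledError, Set.indicator_of_mem hk]
  simp only [Function.comp_apply, sub_add_cancel]

/-- Near zero the eigenvalue part yields an integrable product and the spectral remainder C q^k; far
from zero aperiodicity yields C q^k. This last term lives on a cube growing with k and has no fixed
integrable majorant, so it is kept apart from `H`. -/
lemma exists_scaledError_bound (ha : IsScaling ν α β a) (h0 : 0 < α) (h1 : α < 1)
    (hβ : ∀ j, 0 < β j) :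
    ∃ (C q : ℝ) (H : (Fin d → ℝ) → ℝ), 0 ≤ C ∧ 0 < q ∧ q < 1 ∧ Integrable H ∧
      ∀ᶠ k in atTop, ∀ t ∈ offAxes d, ‖scaledError R₀ R (φ.smulRight e) α β k (a k) t‖ ≤
        (torusCube d).indicator (fun _ => C * q ^ k) ((a k : ℝ)⁻¹ • t) + H t := by
  obtain ⟨lam, Pi, C, q, hC, hq, hq1, hlam, hPi, hpow, ho⟩ :=
    exists_dominant_eigenvalue hF.apply_vector hF.map_vector hF.apply_map hF.gap
  obtain ⟨c, hc, hlamle⟩ := hF.exists_norm_eigenvalue_le h0 h1 ho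
  choose b r hb hr hbr using fun j => hF.exists_exp_neg_mul_tailFun_le ha h0 h1 (hβ j) hc
  set P := φ.smulRight e with hP
  have hS := hF.tendsto_circleSum.mono_left (nhdsWithin_le_nhds (s := offAxes d))
  have hPib : ∀ᶠ S in 𝓝 (circleSum R₀ R 0), ‖Pi S‖ ≤ ‖P‖ + 1 :=
    hPi.norm.eventually_le_const (lt_add_one _)
  have hcube : ∀ᶠ θ : Fin d → ℝ in 𝓝 0, θ ∈ torusCube d := by
    refine set_pi_mem_nhds Set.finite_univ fun j _ => Ioc_mem_nhds ?_ ?_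
    · simpa using Real.pi_pos
    · simpa using Real.pi_pos
  have hnear := (hS.eventually hpow).and ((hS.eventually hPib).and (hlamle.and
    ((eventually_all.2 fun j => (tendsto_inv_abs_offAxes j).eventually_ge_atTop (r j)).and
      (nhdsWithin_le_nhds hcube))))
  obtain ⟨δ, hδ, hball⟩ := Metric.mem_nhdsWithin_iff.1 hnear
  obtain ⟨C', q', hC', hq', hq1', hfar⟩ := hF.exists_norm_pow_le_of_le_norm hδ
  have hHint : Integrable fun t : Fin d → ℝ => (‖P‖ + 1) *
      ∏ j, (Real.exp (b j) * Real.exp (-b j * |t j| ^ (α / 2))) :=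
    (Integrable.fintype_prod (f := fun (j : Fin d) (x : ℝ) =>
      Real.exp (b j) * Real.exp (-b j * |x| ^ (α / 2))) fun j =>
        (integrable_exp_neg_mul_abs_rpow (half_pos h0) (hb j)).const_mul _).const_mul _
  refine ⟨max C C', max q q', fun t => (‖P‖ + 1) *
    ∏ j, (Real.exp (b j) * Real.exp (-b j * |t j| ^ (α / 2))) + ‖stableProd α β t‖ * ‖P‖,
    le_max_of_le_left hC, lt_max_of_lt_left hq, max_lt hq1 hq1',
    hHint.add ((integrable_stableProd h0 h1 hβ).norm.mul_const _), ?_⟩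
  filter_upwards [eventually_all.2 hbr, ha.tendsto_cast.eventually_gt_atTop 0,
    eventually_ge_atTop 1] with k hk hak hk1 t ht
  have hθ : (a k : ℝ)⁻¹ • t ∈ offAxes d := fun j => mul_ne_zero (inv_pos.2 hak).ne' (ht j)
  have hHnn : 0 ≤ (‖P‖ + 1) * ∏ j, (Real.exp (b j) * Real.exp (-b j * |t j| ^ (α / 2))) := by
    positivity
  have hχ : ‖stableProd α β t • P‖ = ‖stableProd α β t‖ * ‖P‖ := norm_smul _ _
  rw [scaledError]
  by_cases hnorm : ‖(a k : ℝ)⁻¹ • t‖ < δ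
  · obtain ⟨n1, n2, n3, n4, n5⟩ := hball ⟨mem_ball_zero_iff.2 hnorm, hθ⟩
    rw [Set.indicator_of_mem n5, Set.indicator_of_mem n5]
    set θ := (a k : ℝ)⁻¹ • t with hθd
    have e1 : ‖circleSum R₀ R θ ^ k - lam (circleSum R₀ R θ) ^ k • Pi (circleSum R₀ R θ)‖ ≤
        max C C' * max q q' ^ k := by
      obtain ⟨m, rfl⟩ : ∃ m, k = m + 1 := ⟨k - 1, by omega⟩
      refine (n1 m).trans ?_
      gcongr
      · exact le_max_left _ _
      · exact le_max_left _ _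
    have e2 : ‖lam (circleSum R₀ R θ) ^ k • Pi (circleSum R₀ R θ)‖ ≤
        (‖P‖ + 1) * ∏ j, (Real.exp (b j) * Real.exp (-b j * |t j| ^ (α / 2))) := by
      rw [norm_smul, norm_pow, mul_comm]
      refine mul_le_mul n2 ?_ (by positivity) (by positivity)
      refine (pow_le_pow_left₀ (norm_nonneg _) n3 k).trans ?_
      rw [← Real.exp_nat_mul]
      have e3 : (k : ℝ) * -(c * tailSum ν θ) =
          ∑ j, -(c * (k * tailFun (ν j) (a k * |t j|⁻¹))) := by
        rw [tailSum, Finset.sum_neg_distrib, ← Finset.mul_sum, ← Finset.mul_sum]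
        simp_rw [hθd, abs_inv_smul_inv]
        ring
      rw [e3, Real.exp_sum]
      refine Finset.prod_le_prod (fun j _ => (Real.exp_pos _).le) fun j _ => hk j (t j) (ht j) ?_
      have := n4 j
      rwa [hθd, abs_inv_smul_inv] at this
    have e4 := _root_.norm_sub_le (circleSum R₀ R θ ^ k) (stableProd α β t • P)
    have e5 := norm_add_le
      (circleSum R₀ R θ ^ k - lam (circleSum R₀ R θ) ^ k • Pi (circleSum R₀ R θ))
      (lam (circleSum R₀ R θ) ^ k • Pi (circleSum R₀ R θ))
    rw [sub_add_cancel] at e5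
    linarith
  · refine (_root_.norm_sub_le _ _).trans ?_
    rw [hχ, ← add_assoc]
    refine add_le_add_left (le_add_of_le_of_nonneg ?_ hHnn) _
    by_cases hQ : (a k : ℝ)⁻¹ • t ∈ torusCube d
    · rw [Set.indicator_of_mem hQ, Set.indicator_of_mem hQ]
      refine (hfar _ hQ (not_lt.1 hnorm) k).trans ?_
      gcongr
      · exact le_max_right _ _
      · exact le_max_right _ _
    · rw [Set.indicator_of_notMem hQ, Set.indicator_of_notMem hQ, norm_zero]

end IsRenewalFamily

end Profile

/-! ### The local limit theorem for renewal families -/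

section LocalLimit

variable {B : Type*} [NormedAddCommGroup B] [NormedSpace ℂ B] {d : ℕ}
  {R₀ : B →L[ℂ] B} {R : Fin d → ℕ → B →L[ℂ] B} {e : B} {φ : B →L[ℂ] ℂ}
  {ν : Fin d → Measure ℝ} {α : ℝ} {β : Fin d → ℝ} {a : ℕ → ℕ}

/-- Potter's lower bound from the fixed point `r` shows that a_k^{α/2} is at most a multiple of k.
Such polynomial growth lets q^k beat the volume of the dilated cube. -/
lemma exists_pow_le_of_isScaling (ha : IsScaling ν α β a) (h0 : 0 < α) (h1 : α < 1)
    {j : Fin d} (hβ : 0 < β j) (hG : IsRegVarTail (tailFun (ν j)) α) (N : ℕ) :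
    ∃ (C : ℝ) (M : ℕ), ∀ᶠ k : ℕ in atTop, (a k : ℝ) ^ N ≤ C * k ^ M := by
  obtain ⟨C, r, hC, hr, h⟩ := hG.exists_le_rpow_mul (half_lt_self h0) (half_pos h0)
  have hΓ : 0 < Real.Gamma (1 - α) := Real.Gamma_pos_of_pos (by linarith)
  set g := β j / Real.Gamma (1 - α) / 2 with hg
  have hgpos : 0 < g := by positivity
  have hev : ∀ᶠ k : ℕ in atTop, g < k * tailFun (ν j) (a k) := by
    have h2 := ha.tendsto_mul_tailFun h1 hG one_pos
    simp only [mul_one, Real.one_rpow] at h2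
    exact h2.eventually_const_lt (half_lt_self (by positivity))
  obtain ⟨M, hM⟩ := exists_nat_ge (N / (α / 2))
  rw [div_le_iff₀ (half_pos h0)] at hM
  set D := C * (r ^ (α / 2) * tailFun (ν j) r) / g with hD
  refine ⟨D ^ M, M, ?_⟩
  filter_upwards [hev, ha.tendsto_cast.eventually_ge_atTop (max r 1)] with k hk hak
  have hak1 : (1 : ℝ) ≤ a k := (le_max_right _ _).trans hak
  have h2 := h r le_rfl (a k) ((le_max_left _ _).trans hak)
  have h3 : (a k : ℝ) ^ (α / 2) ≤ D * k := by
    rw [hD, div_mul_eq_mul_div, le_div_iff₀ hgpos]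
    calc (a k : ℝ) ^ (α / 2) * g ≤ (a k : ℝ) ^ (α / 2) * (k * tailFun (ν j) (a k)) := by gcongr
      _ = (a k : ℝ) ^ (α / 2) * tailFun (ν j) (a k) * k := by ring
      _ ≤ _ := by gcongr
  calc (a k : ℝ) ^ N = (a k : ℝ) ^ (N : ℝ) := (Real.rpow_natCast _ _).symm
    _ ≤ (a k : ℝ) ^ (α / 2 * M) := Real.rpow_le_rpow_of_exponent_le hak1 (by linarith)
    _ = ((a k : ℝ) ^ (α / 2)) ^ M := by rw [Real.rpow_mul (by positivity), Real.rpow_natCast]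
    _ ≤ (D * k) ^ M := by gcongr
    _ = _ := mul_pow _ _ _

lemma integral_inv_smul_indicator_torusCube {m : ℕ} (hm : 0 < m) (c : ℝ) :
    Integrable (fun t : Fin d → ℝ => (torusCube d).indicator (fun _ => c) ((m : ℝ)⁻¹ • t)) ∧
    ∫ t : Fin d → ℝ, (torusCube d).indicator (fun _ => c) ((m : ℝ)⁻¹ • t) =
      (m : ℝ) ^ d * (volume.real (torusCube d) * c) := by
  have hm' : (m : ℝ)⁻¹ ≠ 0 := by positivity
  constructor
  · refine (integrable_comp_smul_iff volume _ hm').2 ?_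
    exact (integrable_indicator_iff (measurableSet_torusCube d)).2
      (integrableOn_const (volume_torusCube_ne_top d))
  · rw [Measure.integral_comp_inv_smul_of_nonneg _ _ m.cast_nonneg,
      integral_indicator (measurableSet_torusCube d), setIntegral_const, smul_eq_mul, smul_eq_mul,
      Module.finrank_fin_fun]

variable [CompleteSpace B]

lemma integrable_scaledError (hR : ∀ j, Summable fun n => ‖R j n‖) (h0 : 0 < α) (h1 : α < 1)
    (hβ : ∀ j, 0 < β j) (P : B →L[ℂ] B) (k : ℕ) {m : ℕ} (hm : 0 < m) :
    Integrable (scaledError R₀ R P α β k m) := by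
  have hm' : (m : ℝ)⁻¹ ≠ 0 := by positivity
  refine Integrable.sub ?_ ((integrable_stableProd h0 h1 hβ).smul_const P)
  refine (integrable_comp_smul_iff volume _ hm').2 ?_
  refine (integrable_indicator_iff (measurableSet_torusCube d)).2 ?_
  have := integrableOn_torusChar_smul (R₀ := R₀) hR 0 k
  simpa [torusChar] using this

lemma integral_stableProd (h0 : 0 < α) (h1 : α < 1) (hβ : ∀ j, 0 < β j) (n : Fin d → ℕ) (m : ℕ) :
    ∫ t, torusChar (fun j => (n j : ℤ)) ((m : ℝ)⁻¹ • t) * stableProd α β t =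
      (2 * Real.pi : ℂ) ^ d * ((∏ j, stableDensity α (β j) (n j / m : ℝ) : ℝ) : ℂ) := by
  simp only [torusChar, stableProd, ← Finset.prod_mul_distrib, Pi.smul_apply]
  rw [volume_pi, integral_fintype_prod_eq_prod (𝕜 := ℂ) (f := fun (j : Fin d) (x : ℝ) =>
    Complex.exp (-(((n j : ℤ) : ℝ) * ((m : ℝ)⁻¹ • x) : ℝ) * Complex.I) *
      stableTransform α (β j) (-(x * Complex.I)))]
  have e1 : ∀ j, ∫ x : ℝ, Complex.exp (-(((n j : ℤ) : ℝ) * ((m : ℝ)⁻¹ • x) : ℝ) * Complex.I) *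
      stableTransform α (β j) (-(x * Complex.I)) =
        2 * Real.pi * (stableDensity α (β j) (n j / m : ℝ) : ℂ) := by
    intro j
    have h2 := stableFourier_eq h0 h1 (hβ j) (n j / m)
    rw [stableFourier] at h2
    push_cast at h2
    rw [← h2]
    congr 1
    ext x
    congr 2
    push_cast
    rw [smul_eq_mul]
    push_cast
    ring
  simp_rw [e1]
  rw [Finset.prod_mul_distrib, Finset.prod_const, Finset.card_univ, Fintype.card_fin]
  push_cast
  rfl

/-- Both terms are Fourier integrals with the same character of modulus one. The bound does not
involve `n`, and this is the source of uniformity. -/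
lemma norm_smul_renewalCoeff_sub_le (hR : ∀ j, Summable fun n => ‖R j n‖) (h0 : 0 < α)
    (h1 : α < 1) (hβ : ∀ j, 0 < β j) (P : B →L[ℂ] B) (k : ℕ) {m : ℕ} (hm : 0 < m)
    (n : Fin d → ℕ) :
    (2 * Real.pi) ^ d * ‖(m : ℂ) ^ d • renewalCoeff R₀ R k n -
      ((∏ j, stableDensity α (β j) (n j / m : ℝ) : ℝ) : ℂ) • P‖ ≤
        ∫ t, ‖scaledError R₀ R P α β k m t‖ := by
  have hm' : (m : ℝ)⁻¹ ≠ 0 := by positivity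
  set N : Fin d → ℤ := fun j => (n j : ℤ) with hN
  set Φ : (Fin d → ℝ) → B →L[ℂ] B :=
    (torusCube d).indicator fun θ => torusChar N θ • circleSum R₀ R θ ^ k with hΦ
  have hΦon := integrableOn_torusChar_smul (R₀ := R₀) hR N k
  have hΦint : Integrable Φ := by
    rw [hΦ]
    exact (integrable_indicator_iff (f := fun θ => torusChar N θ • circleSum R₀ R θ ^ k)
      (measurableSet_torusCube d)).2 hΦon
  have hint1 : Integrable fun t => Φ ((m : ℝ)⁻¹ • t) :=
    (integrable_comp_smul_iff volume _ hm').2 hΦint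
  have e1 : ∫ t, Φ ((m : ℝ)⁻¹ • t) =
      (2 * Real.pi : ℂ) ^ d • (m : ℂ) ^ d • renewalCoeff R₀ R k n := by
    rw [Measure.integral_comp_inv_smul_of_nonneg _ _ m.cast_nonneg,
      integral_indicator (measurableSet_torusCube d), ← renewalCoeff_eq_integral hR,
      Module.finrank_fin_fun, smul_comm]
    congr 1
    rw [← Complex.coe_smul]
    push_cast
    rfl
  have hint2 : Integrable fun t => (torusChar N ((m : ℝ)⁻¹ • t) * stableProd α β t) • P := by
    refine Integrable.smul_const ?_ P
    refine (integrable_stableProd h0 h1 hβ).bdd_mul (c := 1)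
      ((continuous_torusChar N).comp (continuous_const_smul _)).aestronglyMeasurable
      (Eventually.of_forall fun t => (norm_torusChar _ _).le)
  have e2 : ∫ t, (torusChar N ((m : ℝ)⁻¹ • t) * stableProd α β t) • P =
      (2 * Real.pi : ℂ) ^ d • ((∏ j, stableDensity α (β j) (n j / m : ℝ) : ℝ) : ℂ) • P := by
    rw [integral_smul_const, integral_stableProd h0 h1 hβ, mul_smul]
  have e3 : (2 * Real.pi) ^ d * ‖(m : ℂ) ^ d • renewalCoeff R₀ R k n -
      ((∏ j, stableDensity α (β j) (n j / m : ℝ) : ℝ) : ℂ) • P‖ =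
        ‖∫ t, (Φ ((m : ℝ)⁻¹ • t) - (torusChar N ((m : ℝ)⁻¹ • t) * stableProd α β t) • P)‖ := by
    rw [integral_sub hint1 hint2, e1, e2, ← smul_sub, norm_smul]
    congr 1
    rw [norm_pow, norm_mul, Complex.norm_real, Complex.norm_two,
      Real.norm_of_nonneg Real.pi_pos.le]
  rw [e3]
  refine (norm_integral_le_integral_norm _).trans (le_of_eq ?_)
  congr 1
  ext t
  have e4 : Φ ((m : ℝ)⁻¹ • t) - (torusChar N ((m : ℝ)⁻¹ • t) * stableProd α β t) • P =
      torusChar N ((m : ℝ)⁻¹ • t) • scaledError R₀ R P α β k m t := by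
    rw [scaledError, smul_sub, mul_smul, hΦ]
    congr 1
    by_cases hQ : (m : ℝ)⁻¹ • t ∈ torusCube d
    · rw [Set.indicator_of_mem hQ, Set.indicator_of_mem hQ]
    · rw [Set.indicator_of_notMem hQ, Set.indicator_of_notMem hQ, smul_zero]
  rw [e4, norm_smul, norm_torusChar, one_mul]

namespace IsRenewalFamily

variable (hF : IsRenewalFamily R₀ R e φ ν α)

include hF

lemma tendsto_integral_norm_scaledError (ha : IsScaling ν α β a) (h0 : 0 < α) (h1 : α < 1)
    (hβ : ∀ j, 0 < β j) (hd : 0 < d) :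
    Tendsto (fun k => ∫ t, ‖scaledError R₀ R (φ.smulRight e) α β k (a k) t‖) atTop (𝓝 0) := by
  obtain ⟨C, q, H, hC, hq, hq1, hH, hb⟩ := hF.exists_scaledError_bound ha h0 h1 hβ
  set P := φ.smulRight e
  set I : ℕ → (Fin d → ℝ) → ℝ := fun k t =>
    (torusCube d).indicator (fun _ => C * q ^ k) ((a k : ℝ)⁻¹ • t) with hI
  -- The excess over `I k` is dominated by `H`; for `I k` itself only the integrals tend to zero.
  set E : ℕ → (Fin d → ℝ) → ℝ := fun k t => max (‖scaledError R₀ R P α β k (a k) t‖ - I k t) 0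
    with hE
  have hapos : ∀ᶠ k in atTop, 0 < a k := ha.tendsto_atTop.eventually_gt_atTop 0
  have hInn : ∀ k t, 0 ≤ I k t := fun k t => Set.indicator_nonneg (fun _ _ => by positivity) _
  have hEint : ∀ᶠ k in atTop, Integrable (E k) := by
    filter_upwards [hapos] with k hk
    exact ((integrable_scaledError hF.summable h0 h1 hβ P k hk).norm.sub
      (integral_inv_smul_indicator_torusCube hk _).1).sup (integrable_zero _ _ _)
  have hElim : Tendsto (fun k => ∫ t, E k t) atTop (𝓝 0) := by
    have := tendsto_integral_filter_of_dominated_convergence (μ := volume) (F := E)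
      (f := fun _ => (0 : ℝ)) (fun t => ‖H t‖)
      (hEint.mono fun k hk => hk.aestronglyMeasurable) ?_ hH.norm ?_
    · simpa using this
    · filter_upwards [hb] with k hk
      filter_upwards [ae_mem_offAxes] with t ht
      rw [Real.norm_of_nonneg (le_max_right _ _)]
      refine max_le ?_ (norm_nonneg _)
      have h2 := hk t ht
      have h3 := le_abs_self (H t)
      rw [← Real.norm_eq_abs] at h3
      simp only [hI]
      linarith
    · filter_upwards [ae_mem_offAxes] with t ht
      refine squeeze_zero (fun k => le_max_right _ _) (fun k => ?_)
        (tendsto_zero_iff_norm_tendsto_zero.1 (hF.tendsto_scaledError ha h0 h1 ht))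
      exact max_le (sub_le_self _ (hInn k t)) (norm_nonneg _)
  have hIlim : Tendsto (fun k => ∫ t, I k t) atTop (𝓝 0) := by
    -- Any single coordinate controls the growth of `a`, hence the need for d > 0.
    obtain ⟨D, M, hDM⟩ := exists_pow_le_of_isScaling ha h0 h1 (hβ ⟨0, hd⟩) (hF.tail ⟨0, hd⟩) d
    have h2 : Tendsto (fun k : ℕ => D * (volume.real (torusCube d) * C) * ((k : ℝ) ^ M * q ^ k))
        atTop (𝓝 0) := by
      have := (tendsto_pow_const_mul_const_pow_of_abs_lt_one M
        (by rwa [abs_of_pos hq])).const_mul (D * (volume.real (torusCube d) * C))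
      rwa [mul_zero] at this
    refine squeeze_zero' (Eventually.of_forall fun k => integral_nonneg (hInn k)) ?_ h2
    filter_upwards [hDM, hapos] with k hk hk0
    simp only [hI]
    rw [(integral_inv_smul_indicator_torusCube hk0 _).2]
    calc (a k : ℝ) ^ d * (volume.real (torusCube d) * (C * q ^ k))
        ≤ D * k ^ M * (volume.real (torusCube d) * (C * q ^ k)) := by gcongr
      _ = _ := by ring
  have hsum := hElim.add hIlim
  rw [add_zero] at hsum
  refine squeeze_zero' (Eventually.of_forall fun k => integral_nonneg fun t => norm_nonneg _) ?_ hsum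
  filter_upwards [hEint, hapos] with k hk hk0
  have hIk := (integral_inv_smul_indicator_torusCube (d := d) hk0 (C * q ^ k)).1
  rw [← integral_add hk hIk]
  refine integral_mono (integrable_scaledError hF.summable h0 h1 hβ P k hk0).norm (hk.add hIk)
    fun t => ?_
  have : ‖scaledError R₀ R P α β k (a k) t‖ - I k t ≤ E k t := le_max_left _ _
  simp only [hI] at this
  linarith

/-- The local limit theorem for the coefficients of the powers of `R(z)`. -/
theorem tendsto_iSup_enorm (ha : IsScaling ν α β a) (h0 : 0 < α) (h1 : α < 1)
    (hβ : ∀ j, 0 < β j) (hd : 0 < d) :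
    Tendsto (fun k : ℕ => ⨆ n : Fin d → ℕ, ‖(a k : ℂ) ^ d • renewalCoeff R₀ R k n -
      ((∏ j, stableDensity α (β j) ((n j : ℝ) / (a k : ℝ)) : ℝ) : ℂ) • φ.smulRight e‖ₑ)
        atTop (𝓝 0) := by
  have h2 := ENNReal.tendsto_ofReal
    ((hF.tendsto_integral_norm_scaledError ha h0 h1 hβ hd).div_const ((2 * Real.pi) ^ d))
  rw [zero_div, ENNReal.ofReal_zero] at h2
  refine tendsto_of_tendsto_of_tendsto_of_le_of_le' tendsto_const_nhds h2
    (Eventually.of_forall fun k => zero_le) ?_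
  filter_upwards [ha.tendsto_atTop.eventually_gt_atTop 0] with k hk
  refine iSup_le fun n => ?_
  rw [← ofReal_norm]
  refine ENNReal.ofReal_le_ofReal ?_
  rw [le_div_iff₀ (by positivity), mul_comm]
  exact norm_smul_renewalCoeff_sub_le hF.summable h0 h1 hβ _ k hk n

end IsRenewalFamily

end LocalLimit

end LocLim

end

/-! ### The local limit theorem for the dynamical system -/

open LocLim in
theorem proposition5p1 {X : Type*} [MeasurableSpace X] (μ : Measure X) [SigmaFinite μ]
    (f : X → X) (hcons : Conservative f μ) (herg : Ergodic f μ)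
    {d : ℕ} (hd : 2 ≤ d) (Y : Set X) (A : Fin d → Set X)
    (hsep : DynamicalSeparation f μ Y A)
    (α : ℝ) (β : Fin d → ℝ) (ℓ : ℝ≥0 → ℝ)
    (hreg : RegularVariation f μ Y A α β ℓ)
    {B : Type*} [NormedAddCommGroup B] [NormedSpace ℂ B] [CompleteSpace B]
    (ι : B →ₗ[ℂ] Lp ℂ ∞ (μ.restrict Y))
    (hape : AperiodicRenewal f μ Y A ι) :
    (∃ S, Induces ι (meanValue μ Y) S) ∧
    (∀ (n : Fin d → ℕ) (k : ℕ), ∃ S, Induces ι (occupationTransfer f μ Y A n k) S) ∧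
    ∃ ψ : Fin d → ℝ → ℝ, (∀ j, IsStableDensity α (β j) (ψ j)) ∧
      Tendsto (fun k : ℕ => ⨆ n : Fin d → ℕ,
        ‖((scaling f μ Y α k : ℂ) ^ d) • inducedOp ι (occupationTransfer f μ Y A n k) -
          ((∏ j, ψ j ((n j : ℝ) / (scaling f μ Y α k : ℝ)) : ℝ) : ℂ) •
            inducedOp ι (meanValue μ Y)‖ₑ) atTop (𝓝 0) := by 
  obtain ⟨R₀, R, e, φ, hF, hR₀, hR, hP⟩ :=
    hape.exists_isRenewalFamily hcons herg.toMeasurePreserving hsep hreg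
  have hf : MeasurePreserving f μ μ := herg.toMeasurePreserving
  have hT := induces_occupationTransfer hcons hf hsep hR₀ hR
  refine ⟨⟨_, hP⟩, fun n k => ⟨_, hT n k⟩, fun j => stableDensity α (β j), fun j =>
    isStableDensity_stableDensity hreg.index_mem.1 hreg.index_mem.2 (hreg.weight_mem j).1, ?_⟩
  obtain ⟨h1, h2⟩ := hreg.tendsto_scaling hcons hf.measurable hsep
  have h3 := hF.tendsto_iSup_enorm ⟨h1, h2⟩ hreg.index_mem.1 hreg.index_mem.2
    (fun j => (hreg.weight_mem j).1) (by omega)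
  -- Injectivity of `ι` makes induced operators unique, so the renewal coefficients and φ ⊗ e may be
  -- substituted.
  simp_rw [fun n k => inducedOp_eq hape.injective (hT n k), inducedOp_eq hape.injective hP]
  exact h3
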